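/- Let $\ell\in\frac12\mathbb{N}$ (with $0\in\mathbb N$) and index the rows and columns of $(2\ell+1)\times(2\ell+1)$ matrices by $0,1,\dots,2\ell$. Let $E_{i,j}$ denote the matrix units, with $E_{i,j}=0$ if $i$ or $j$ is outside $\{0,\dots,2\ell\}$. Let $U_k$ be the Chebyshev polynomials of the second kind, $(a)_k=a(a+1)\cdots(a+k-1)$, and let $W$ be the matrix weight on $[-1,1]$ given by $$W(x)_{n,m}=\sqrt{1-x^2}\sum_{t=0}^m\alpha_t(m,n)\,U_{n+m-2t}(x),\qquad \alpha_t(m,n)=\frac{2\ell+1}{n+1}\,\frac{(2\ell-m)!\,m!}{(2\ell)!}\,(-1)^{m-t}\,\frac{(n-2\ell)_{m-t}}{(n+2)_{m-t}}\,\frac{(2\ell+2-t)_t}{t!}$$ for $n\ge m$, and $W(x)_{n,m}=W(x)_{m,n}$ otherwise. **Theorem.** There is exactly one sequence $(P_n)_{n\ge0}$ of matrix-valued polynomials $P_n(x)=\sum_{k=0}^n x^kP^n_k$, $P^n_k\in M_{2\ell+1}(\mathbb{C})$, $P^n_n=I$, such that $\int_{-1}^1P_n(x)W(x)P_m(x)^*\,dx=\delta_{nm}H_n$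 with every $H_n$ positive definite. The polynomials $R_n(u)=(-1)^n2^{-n}P_n(1-2u)$ are the monic orthogonal polynomials, in the same sense, for the weight $Z(u)=W(1-2u)$ on $[0,1]$. With $R_{-1}=P_{-1}=0$ they satisfy, for all $n\ge0$, $$u\,R_n(u)=R_{n+1}(u)+X_n\,R_n(u)+Y_n\,R_{n-1}(u),$$ where $$X_n=-\sum_{i=0}^{2\ell}\left[\frac{i^2}{4(n+i)(n+i+1)}E_{i,i-1}-\frac12E_{i,i}+\frac{(2\ell-i)^2}{4(2\ell+n-i)(2\ell+n-i+1)}E_{i,i+1}\right],$$ $$Y_n=\sum_{i=0}^{2\ell}\frac{n^2(2\ell+n+1)^2}{16(n+i)(n+i+1)(2\ell+n-i)(2\ell+n-i+1)}E_{i,i}$$ (for $n=0$ set $Y_0=0$, and ignore in $X_0$ the terms with $E_{0,-1}=0$ and $E_{2\ell,2\ell+1}=0$). Consequently, for all $n\ge0$, $$x\,P_n(x)=P_{n+1}(x)+(1-2X_n)\,P_n(x)+4Y_n\,P_{n-1}(x).$$ -/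

import Mathlib

open scoped ComplexOrder

noncomputable section

/-! Throughout, `N = 2ℓ` for a spin `ℓ ∈ ½ℕ`, and matrices of size `2ℓ + 1` are indexed by
`Fin (N + 1) = {0, …, 2ℓ}`. -/

/-- Complex matrices of size `2ℓ + 1 = N + 1`. -/
abbrev Mat (N : ℕ) : Type := Matrix (Fin (N + 1)) (Fin (N + 1)) ℂ

/-- Matrix-valued polynomials `∑ₖ xᵏ Pₖ` with `Pₖ ∈ M_{2ℓ+1}(ℂ)`. -/
abbrev MatPoly (N : ℕ) : Type := Polynomial (Mat N)

/-- The value `P(x) = ∑ₖ xᵏ Pₖ` of a matrix-valued polynomial at a scalar `x`. -/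
def MatPoly.at {N : ℕ} (P : MatPoly N) (x : ℂ) : Mat N :=
  ∑ k ∈ Finset.range (P.natDegree + 1), x ^ k • P.coeff k

/-- The Pochhammer symbol `(a)_k = a (a + 1) ⋯ (a + k - 1)`. -/
def pochhammer (a : ℝ) (k : ℕ) : ℝ := ∏ i ∈ Finset.range k, (a + i)

/-- The coefficient `α_t(m,n)` of the weight, for `t ≤ m ≤ n ≤ 2ℓ = N`. -/
def alphaCoeff (N t m n : ℕ) : ℝ :=
  ((N : ℝ) + 1) / ((n : ℝ) + 1)
    * (((N - m).factorial : ℝ) * (m.factorial : ℝ) / (N.factorial : ℝ))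
    * (-1) ^ (m - t)
    * (pochhammer ((n : ℝ) - N) (m - t) / pochhammer ((n : ℝ) + 2) (m - t))
    * (pochhammer ((N : ℝ) + 2 - t) t / (t.factorial : ℝ))

/-- The expression for the `(n,m)` entry of the weight, valid for `m ≤ n`; here `U_k` is the
Chebyshev polynomial of the second kind. -/
def weightEntry (N n m : ℕ) (x : ℝ) : ℝ :=
  √(1 - x ^ 2) * ∑ t ∈ Finset.range (m + 1),
    alphaCoeff N t m n * (Polynomial.Chebyshev.U ℝ ((n : ℤ) + m - 2 * t)).eval x

/-- The weight matrix `W(x)` on `[-1,1]`. -/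
def weightW (N : ℕ) (x : ℝ) : Mat N :=
  Matrix.of fun n m =>
    ((if m ≤ n then weightEntry N n m x else weightEntry N m n x : ℝ) : ℂ)

/-- The weight matrix `Z(u) = W(1 - 2u)` on `[0,1]`. -/
def weightZ (N : ℕ) (u : ℝ) : Mat N := weightW N (1 - 2 * u)

/-- The matrix-valued inner product `∫_a^b P(x) V(x) Q(x)^* dx`, integrated entrywise. -/
def matInner {N : ℕ} (V : ℝ → Mat N) (a b : ℝ) (P Q : MatPoly N) : Mat N :=
  Matrix.of fun i j => ∫ x in a..b, (P.at (x : ℂ) * V x * (Q.at (x : ℂ)).conjTranspose) i j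

/-- `(P_n)` is the sequence of monic matrix-valued orthogonal polynomials for the weight `V` on
`[a,b]`: `P_n` has degree `n` and leading coefficient `I`, and `⟨P_n, P_m⟩ = δ_{nm} H_n` with
`H_n` positive definite. -/
structure IsMonicOrthogonal {N : ℕ} (V : ℝ → Mat N) (a b : ℝ) (P : ℕ → MatPoly N) : Prop where
  natDegree_eq : ∀ n, (P n).natDegree = n
  coeff_self : ∀ n, (P n).coeff n = 1
  inner_eq_zero : ∀ n m, n ≠ m → matInner V a b (P n) (P m) = 0
  inner_posDef : ∀ n, (matInner V a b (P n) (P n)).PosDef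

/-- `R_n(u) = (-1)^n 2^{-n} P_n(1 - 2u)`, as a matrix-valued polynomial in `u`. -/
def rescale {N : ℕ} (P : ℕ → MatPoly N) (n : ℕ) : MatPoly N :=
  ((-1 : ℂ) ^ n * (2 : ℂ)⁻¹ ^ n) • (P n).comp (1 - 2 * Polynomial.X)

/-- The member of index `n - 1` of a sequence of polynomials, with index `-1` giving `0`. -/
def prevPoly {N : ℕ} (P : ℕ → MatPoly N) : ℕ → MatPoly N
  | 0 => 0
  | n + 1 => P n

/-- The matrix unit `E_{i,j}`; it is zero when `i` or `j` is not in `{0, …, 2ℓ}`. -/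
def matUnit (N : ℕ) (i j : ℤ) : Mat N :=
  Matrix.of fun a b => if (a : ℤ) = i ∧ (b : ℤ) = j then 1 else 0

/-- The tridiagonal coefficient matrix `X_n`. -/
def coeffX (N n : ℕ) : Mat N :=
  -∑ i ∈ Finset.range (N + 1),
    (((i : ℂ) ^ 2 / (4 * ((n : ℂ) + i) * ((n : ℂ) + i + 1))) • matUnit N i ((i : ℤ) - 1)
      - (1 / 2 : ℂ) • matUnit N i i
      + (((N : ℂ) - i) ^ 2 / (4 * ((N : ℂ) + n - i) * ((N : ℂ) + n - i + 1)))
          • matUnit N i ((i : ℤ) + 1))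

/-- The diagonal coefficient matrix `Y_n`. -/
def coeffY (N n : ℕ) : Mat N :=
  ∑ i ∈ Finset.range (N + 1),
    ((n : ℂ) ^ 2 * ((N : ℂ) + n + 1) ^ 2 /
      (16 * ((n : ℂ) + i) * ((n : ℂ) + i + 1) * ((N : ℂ) + n - i) * ((N : ℂ) + n - i + 1)))
      • matUnit N i i

end

/-! Put N = 2ℓ and W = √(1 - x²) V with V a polynomial matrix, let e, f, h be the sl₂ matrices
`raiseMat`, `lowerMat`, `cartanMat`, and set T = e - f - xh, K = xN - e - f, F = hT - (N + 2)(e +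
f). Contiguity relations of the α_t give two algebraic facts: TV + VTᵗ = 0
(`skewMat_mul_weightMat_add`) and FV = VFᵗ (`symMat_mul_weightMat`).

A solution M of TM + MTᵗ = 0 is determined by its first column (`eq_zero_of_skewMat`), and the first
column of V consists of multiples of the U_n. This rigidity is used twice: for the Pearson equation
2(1 - x²)V' + KV + VKᵗ = 0 (`two_mul_derivMat_weightMat`), and for V = ΦΦ* with Φ an invertible
Krawtchouk-type matrix on (-1, 1) (`exists_weightMat_eval_eq`). The factorization makes the inner
product positive, so Gram-Schmidt gives existence and uniqueness of the P_n.

The Pearson equation, together with the divisibility of TV and KV - VKᵗ by 1 - x², makes a first and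
a second order differential operator symmetric (`weightForm_firstOrderOp`,
`weightForm_secondOrderOp`). Their coefficients act on the right and they do not raise degrees, so
P_n is an eigenfunction of both, with diagonal matrix eigenvalues acting on the left. Comparing
powers of x yields the coefficient of x^{n-1} in P_n (`IsOrthMonic.coeff_eq_subCoeff`) and the
diagonal of that of x^{n-2} (`IsOrthMonic.coeff_X_mul_diag`).

In the three-term recurrence the coefficient of P_n is a difference of two subleading coefficients.
The coefficient of P_{n-1} commutes with h because the squared norms do (`IsOrthMonic.commute`), so
it is diagonal, and its diagonal comes from a rational identity (`diag_identity`). The substitution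
x = 1 - 2u transports everything to Z. -/

/-! ### The sl₂ matrices and the commutators of T, K and F. -/

section SlTwo

variable {R : Type*} [CommRing R]

/-- The raising matrix of the `(N + 1)`-dimensional representation of `sl₂`. -/
def raiseMat (N : ℕ) (R : Type*) [CommRing R] : Matrix (Fin (N + 1)) (Fin (N + 1)) R :=
  Matrix.of fun i j => if (j : ℕ) = i + 1 then (N : R) - (i : ℕ) else 0

/-- The lowering matrix of the `(N + 1)`-dimensional representation of `sl₂`. -/
def lowerMat (N : ℕ) (R : Type*) [CommRing R] : Matrix (Fin (N + 1)) (Fin (N + 1)) R :=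
  Matrix.of fun i j => if (i : ℕ) = j + 1 then ((i : ℕ) : R) else 0

/-- The Cartan element, the diagonal matrix with entries `N - 2 i`. -/
def cartanMat (N : ℕ) (R : Type*) [CommRing R] : Matrix (Fin (N + 1)) (Fin (N + 1)) R :=
  Matrix.diagonal fun i => (N : R) - 2 * (i : ℕ)

theorem sum_raiseMat_mul (N : ℕ) (f : ℕ → R) (i : Fin (N + 1)) :
    ∑ j, raiseMat N R i j * f j = ((N : R) - (i : ℕ)) * f (i + 1) := by
  simp only [raiseMat, Matrix.of_apply, ite_mul, zero_mul]
  rw [Fin.sum_univ_eq_sum_range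
    (fun j => if j = (i : ℕ) + 1 then ((N : R) - (i : ℕ)) * f j else 0) (N + 1)]
  rw [Finset.sum_ite_eq']
  split_ifs with h
  · rfl
  · have : (i : ℕ) = N := by
      have := i.2
      simp only [Finset.mem_range] at h
      omega
    simp [this]

theorem sum_lowerMat_mul (N : ℕ) (f : ℕ → R) (i : Fin (N + 1)) :
    ∑ j, lowerMat N R i j * f j = ((i : ℕ) : R) * f (i - 1) := by
  simp only [lowerMat, Matrix.of_apply, ite_mul, zero_mul]
  rw [Fin.sum_univ_eq_sum_range
    (fun j => if (i : ℕ) = j + 1 then ((i : ℕ) : R) * f j else 0) (N + 1)]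
  rcases Nat.eq_zero_or_pos (i : ℕ) with h | h
  · simp [h]
  · rw [Finset.sum_eq_single ((i : ℕ) - 1)]
    · rw [if_pos (by omega)]
    · intro b _ hb
      rw [if_neg (by omega)]
    · intro hb
      have := i.2
      simp only [Finset.mem_range] at hb
      omega

theorem raiseMat_mul_apply (N : ℕ) (f : ℕ → ℕ → R) (i j : Fin (N + 1)) :
    (raiseMat N R * Matrix.of fun a b : Fin (N + 1) => f a b) i j
      = ((N : R) - (i : ℕ)) * f (i + 1) j := by
  rw [Matrix.mul_apply]
  exact sum_raiseMat_mul N (fun a => f a j) i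

theorem lowerMat_mul_apply (N : ℕ) (f : ℕ → ℕ → R) (i j : Fin (N + 1)) :
    (lowerMat N R * Matrix.of fun a b : Fin (N + 1) => f a b) i j
      = ((i : ℕ) : R) * f (i - 1) j := by
  rw [Matrix.mul_apply]
  exact sum_lowerMat_mul N (fun a => f a j) i

theorem cartanMat_mul_apply (N : ℕ) (M : Matrix (Fin (N + 1)) (Fin (N + 1)) R)
    (i j : Fin (N + 1)) :
    (cartanMat N R * M) i j = ((N : R) - 2 * (i : ℕ)) * M i j := by
  simp [cartanMat, Matrix.diagonal_mul]

theorem mul_cartanMat_apply (N : ℕ) (M : Matrix (Fin (N + 1)) (Fin (N + 1)) R)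
    (i j : Fin (N + 1)) :
    (M * cartanMat N R) i j = M i j * ((N : R) - 2 * (j : ℕ)) := by
  simp [cartanMat, Matrix.mul_diagonal]

theorem cartanMat_transpose (N : ℕ) : (cartanMat N R).transpose = cartanMat N R := by
  simp [cartanMat]

/-- Every matrix indexed by `Fin (N + 1)` is the restriction of a function on `ℕ × ℕ`. -/
theorem exists_nat_extension (N : ℕ) (M : Matrix (Fin (N + 1)) (Fin (N + 1)) R) :
    ∃ f : ℕ → ℕ → R, M = Matrix.of fun a b : Fin (N + 1) => f a b := by
  refine ⟨fun a b => if h : a < N + 1 ∧ b < N + 1 then M ⟨a, h.1⟩ ⟨b, h.2⟩ else 0, ?_⟩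
  ext a b
  simp only [Matrix.of_apply]
  rw [dif_pos ⟨a.2, b.2⟩]

theorem raiseMat_mul_lowerMat_sub (N : ℕ) :
    raiseMat N R * lowerMat N R = lowerMat N R * raiseMat N R + cartanMat N R := by
  ext i j
  have h1 := raiseMat_mul_apply N (fun a b => if a = b + 1 then (a : R) else 0) i j
  have h2 := lowerMat_mul_apply N (fun a b => if b = a + 1 then (N : R) - a else 0) i j
  rw [Matrix.add_apply]
  refine h1.trans ?_
  refine Eq.trans ?_ (congrArg (· + _) h2.symm)
  simp only [cartanMat, Matrix.diagonal_apply, Fin.ext_iff]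
  by_cases hij : (i : ℕ) = j
  · rcases Nat.eq_zero_or_pos (i : ℕ) with h | h
    · simp [← hij, h]
    · rw [if_pos (by omega), if_pos (by omega), if_pos hij, Nat.cast_sub h]
      push_cast
      ring
  · rw [if_neg (by omega), if_neg hij]
    rcases Nat.eq_zero_or_pos (i : ℕ) with h | h
    · simp [h]
    · rw [if_neg (by omega)]
      simp

theorem cartanMat_mul_raiseMat (N : ℕ) :
    cartanMat N R * raiseMat N R = raiseMat N R * cartanMat N R + 2 * raiseMat N R := by
  ext i j
  rw [Matrix.add_apply, cartanMat_mul_apply, mul_cartanMat_apply, two_mul (raiseMat N R),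
    Matrix.add_apply]
  simp only [raiseMat, Matrix.of_apply]
  split_ifs with h
  · rw [h]; push_cast; ring
  · simp

theorem cartanMat_mul_lowerMat (N : ℕ) :
    cartanMat N R * lowerMat N R = lowerMat N R * cartanMat N R - 2 * lowerMat N R := by
  ext i j
  rw [Matrix.sub_apply, cartanMat_mul_apply, mul_cartanMat_apply, two_mul (lowerMat N R),
    Matrix.add_apply]
  simp only [lowerMat, Matrix.of_apply]
  split_ifs with h
  · rw [h]; push_cast; ring
  · simp

/-- The matrix `T(x)`, with respect to which the polynomial part of the weight is skew. -/
def skewMat (N : ℕ) (x : R) : Matrix (Fin (N + 1)) (Fin (N + 1)) R :=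
  raiseMat N R - lowerMat N R - x • cartanMat N R

/-- The matrix `K(x)` in the Pearson equation of the weight. -/
def pearsonMat (N : ℕ) (x : R) : Matrix (Fin (N + 1)) (Fin (N + 1)) R :=
  (x * N) • (1 : Matrix (Fin (N + 1)) (Fin (N + 1)) R) - raiseMat N R - lowerMat N R

/-- The matrix `F(x)`, with respect to which the polynomial part of the weight is symmetric. -/
def symMat (N : ℕ) (x : R) : Matrix (Fin (N + 1)) (Fin (N + 1)) R :=
  cartanMat N R * skewMat N x - ((N : R) + 2) • (raiseMat N R + lowerMat N R)

theorem skewMat_mul_apply (N : ℕ) (x : R) (f : ℕ → ℕ → R) (i j : Fin (N + 1)) :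
    (skewMat N x * Matrix.of fun a b : Fin (N + 1) => f a b) i j
      = ((N : R) - (i : ℕ)) * f (i + 1) j - ((i : ℕ) : R) * f (i - 1) j
        - x * (((N : R) - 2 * (i : ℕ)) * f i j) := by
  rw [skewMat, sub_mul, sub_mul, Matrix.sub_apply, Matrix.sub_apply, Matrix.smul_mul,
    Matrix.smul_apply, raiseMat_mul_apply, lowerMat_mul_apply, cartanMat_mul_apply]
  simp

theorem mul_skewMat_transpose_apply (N : ℕ) (x : R) (f : ℕ → ℕ → R) (i j : Fin (N + 1)) :
    ((Matrix.of fun a b : Fin (N + 1) => f a b) * (skewMat N x).transpose) i j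
      = ((N : R) - (j : ℕ)) * f i (j + 1) - ((j : ℕ) : R) * f i (j - 1)
        - x * (((N : R) - 2 * (j : ℕ)) * f i j) := by
  rw [← skewMat_mul_apply N x (fun a b => f b a) j i, 
    ← Matrix.transpose_transpose (skewMat N x * _), Matrix.transpose_mul]
  rfl

/-- A solution of `T(x) M + M T(x)ᵀ = 0` is determined by its first column. -/
theorem eq_zero_of_skewMat [IsDomain R] [CharZero R] (N : ℕ) (x : R)
    (M : Matrix (Fin (N + 1)) (Fin (N + 1)) R)
    (hM : skewMat N x * M + M * (skewMat N x).transpose = 0) (h0 : ∀ i, M i 0 = 0) : M = 0 := by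
  obtain ⟨f, rfl⟩ := exists_nat_extension N M
  have key : ∀ m : ℕ, ∀ m' ≤ m, m' ≤ N → ∀ n ≤ N, f n m' = 0 := by
    intro m
    induction m with
    | zero =>
      intro m' hm' _ n hn
      obtain rfl : m' = 0 := by omega
      exact h0 ⟨n, by omega⟩
    | succ m ih =>
      intro m' hm' hmN n hn
      rcases Nat.lt_or_ge m' (m + 1) with h | h
      · exact ih m' (by omega) hmN n hn
      obtain rfl : m' = m + 1 := by omega
      -- Entry (n, m) of the equation expresses (N - m) f n (m + 1) through columns m and m - 1, and
      -- N - m ≠ 0 because m + 1 ≤ N.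
      have e := congrFun (congrFun hM ⟨n, by omega⟩) ⟨m, by omega⟩
      rw [Matrix.add_apply, skewMat_mul_apply, mul_skewMat_transpose_apply] at e
      simp only [Matrix.zero_apply] at e
      rw [ih m le_rfl (by omega) n hn, ih m le_rfl (by omega) (n - 1) (by omega),
        ih (m - 1) (by omega) (by omega) n hn] at e
      -- For n = N the value f (N + 1) m lies outside the matrix and is arbitrary, but its factor
      -- vanishes.
      have e1 : ((N : R) - n) * f (n + 1) m = 0 := by
        rcases Nat.lt_or_ge n N with h' | h'
        · rw [ih m le_rfl (by omega) (n + 1) (by omega), mul_zero]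
        · rw [show n = N by omega, sub_self, zero_mul]
      rw [e1] at e
      have hne : (N : R) - m ≠ 0 := by
        rw [sub_ne_zero, Ne, Nat.cast_inj]
        omega
      have : ((N : R) - m) * f n (m + 1) = 0 := by linear_combination e
      exact (mul_eq_zero.mp this).resolve_left hne
  ext i j
  exact key j j le_rfl (by omega) i (by omega)

/-- Only the sl₂ relations are used. The term in h is what cancels T' = -h when TV + VTᵗ = 0 is
differentiated. -/
theorem skewMat_mul_pearsonMat (N : ℕ) (x : R) :
    skewMat N x * pearsonMat N x = pearsonMat N x * skewMat N x + (2 * x) • skewMat N x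
      - (2 * (1 - x ^ 2)) • cartanMat N R := by
  have h1 := raiseMat_mul_lowerMat_sub (R := R) N
  have h2 := cartanMat_mul_raiseMat (R := R) N
  have h3 := cartanMat_mul_lowerMat (R := R) N
  simp only [skewMat, pearsonMat]
  simp only [mul_sub, sub_mul, Matrix.smul_mul, Matrix.mul_smul, mul_one, one_mul, h1, h2, h3,
    smul_add, smul_sub, two_mul, add_smul, sub_smul, smul_smul]
  module

theorem skewMat_mul_cartanMat (N : ℕ) (x : R) :
    skewMat N x * cartanMat N R = cartanMat N R * skewMat N x
      - (2 : R) • (raiseMat N R + lowerMat N R) := by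
  have h2 := cartanMat_mul_raiseMat (R := R) N
  have h3 := cartanMat_mul_lowerMat (R := R) N
  simp only [skewMat, mul_sub, sub_mul, Matrix.smul_mul, Matrix.mul_smul, h2, h3, two_mul]
  module

theorem skewMat_mul_raiseMat_add_lowerMat (N : ℕ) (x : R) :
    skewMat N x * (raiseMat N R + lowerMat N R) = (raiseMat N R + lowerMat N R) * skewMat N x
      + (2 * (1 - x ^ 2)) • cartanMat N R - (2 * x) • skewMat N x := by
  have h1 := raiseMat_mul_lowerMat_sub (R := R) N
  have h2 := cartanMat_mul_raiseMat (R := R) N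
  have h3 := cartanMat_mul_lowerMat (R := R) N
  simp only [skewMat, mul_sub, sub_mul, mul_add, add_mul, Matrix.smul_mul, Matrix.mul_smul,
    h1, h2, h3, two_mul, add_smul, sub_smul]
  module

/-- Since T is skew and F symmetric for V, the product [T, F]V is a symmetric matrix; this formula
turns that remark into information on KTV. -/
theorem skewMat_mul_symMat (N : ℕ) (x : R) :
    skewMat N x * symMat N x - symMat N x * skewMat N x
      = (2 : R) • (pearsonMat N x * skewMat N x + (2 * x) • skewMat N x
        - (((N : R) + 2) * (1 - x ^ 2)) • cartanMat N R) := by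
  rw [symMat, mul_sub, ← mul_assoc, skewMat_mul_cartanMat, Matrix.mul_smul,
    skewMat_mul_raiseMat_add_lowerMat, pearsonMat]
  simp only [sub_mul, add_mul, Matrix.smul_mul, one_mul, smul_add, smul_sub, mul_assoc]
  module

end SlTwo

/-! ### Contiguity relations for the coefficients α_t(m,n), with m = t + s to avoid truncated
subtraction. -/

theorem pochhammer_succ (a : ℝ) (k : ℕ) : pochhammer a (k + 1) = pochhammer a k * (a + k) := by
  rw [pochhammer, Finset.prod_range_succ, pochhammer]

theorem pochhammer_succ' (a : ℝ) (k : ℕ) : pochhammer a (k + 1) = a * pochhammer (a + 1) k := by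
  rw [pochhammer, Finset.prod_range_succ', pochhammer, mul_comm]
  congr 1
  · simp
  · refine Finset.prod_congr rfl fun i _ => ?_
    push_cast
    ring

theorem pochhammer_pos {a : ℝ} (ha : 0 < a) (k : ℕ) : 0 < pochhammer a k :=
  Finset.prod_pos fun i _ => by positivity

theorem alphaCoeff_add (N t s n : ℕ) :
    alphaCoeff N t (t + s) n = ((N : ℝ) + 1) / ((n : ℝ) + 1)
      * (((N - (t + s)).factorial : ℝ) * ((t + s).factorial : ℝ) / (N.factorial : ℝ))
      * (-1) ^ s * (pochhammer ((n : ℝ) - N) s / pochhammer ((n : ℝ) + 2) s)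
      * (pochhammer ((N : ℝ) + 2 - t) t / (t.factorial : ℝ)) := by
  simp [alphaCoeff]

theorem pochhammer_div_factorial_succ (N t : ℕ) :
    pochhammer ((N : ℝ) + 2 - (t + 1 : ℕ)) (t + 1) / ((t + 1).factorial : ℝ) * (t + 1)
      = ((N : ℝ) + 1 - t) * (pochhammer ((N : ℝ) + 2 - t) t / (t.factorial : ℝ)) := by
  rw [pochhammer_succ', Nat.factorial_succ]
  have : (t.factorial : ℝ) ≠ 0 := by positivity
  have h : (N : ℝ) + 2 - (t + 1 : ℕ) + 1 = N + 2 - t := by push_cast; ring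
  rw [h]
  push_cast
  field_simp
  ring

/-- Contiguity in `n`. -/
theorem alphaCoeff_succ_right (N t s n : ℕ) :
    ((N : ℝ) - n) * alphaCoeff N t (t + s) (n + 1)
      = alphaCoeff N t (t + s) n * ((n + 1) * (N - n - s) / (n + 2 + s)) := by
  rw [alphaCoeff_add, alphaCoeff_add]
  have h1 : pochhammer ((n : ℝ) + 2) s ≠ 0 := (pochhammer_pos (by positivity) s).ne'
  have h2 : pochhammer ((n : ℝ) + 2 + 1) s ≠ 0 := (pochhammer_pos (by positivity) s).ne'
  have e1 : ((n : ℝ) + 2) * pochhammer ((n : ℝ) + 2 + 1) s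
      = pochhammer ((n : ℝ) + 2) s * (n + 2 + s) := by
    rw [← pochhammer_succ', pochhammer_succ]
  have e2 : ((n : ℝ) - N) * pochhammer ((n : ℝ) - N + 1) s
      = pochhammer ((n : ℝ) - N) s * (n - N + s) := by
    rw [← pochhammer_succ', pochhammer_succ]
  have e3 : ((n + 1 : ℕ) : ℝ) + 2 = n + 2 + 1 := by push_cast; ring
  have e4 : ((n + 1 : ℕ) : ℝ) - N = n - N + 1 := by push_cast; ring
  have e5 : pochhammer ((n : ℝ) + 2 + 1) s = pochhammer ((n : ℝ) + 2) s * (n + 2 + s) / (n + 2) := by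
    field_simp
    linear_combination e1
  rw [e3, e4, e5]
  have h3 : (n : ℝ) + 2 + s ≠ 0 := by positivity
  push_cast
  rw [show (n : ℝ) + 1 + 1 = n + 2 by ring]
  generalize pochhammer ((N : ℝ) + 2 - t) t / (t.factorial : ℝ) = c
  generalize ((N - (t + s)).factorial : ℝ) * ((t + s).factorial : ℝ) / (N.factorial : ℝ) = c'
  generalize pochhammer ((n : ℝ) + 2) s = d at *
  field_simp
  linear_combination (-c * c') * e2

/-- Contiguity in `t`. -/
theorem alphaCoeff_succ_left (N t s n : ℕ) :
    alphaCoeff N t (t + (s + 1)) n * ((n + 2 + s) * (N + 1 - t))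
      = alphaCoeff N (t + 1) (t + 1 + s) n * ((N - n - s) * (t + 1)) := by
  rw [alphaCoeff_add, alphaCoeff_add, show t + (s + 1) = t + 1 + s by ring]
  have h1 : pochhammer ((n : ℝ) + 2) s ≠ 0 := (pochhammer_pos (by positivity) s).ne'
  have e := pochhammer_div_factorial_succ N t
  rw [pochhammer_succ, pochhammer_succ, pow_succ]
  generalize pochhammer ((N : ℝ) + 2 - t) t / (t.factorial : ℝ) = c at *
  generalize pochhammer ((N : ℝ) + 2 - (t + 1 : ℕ)) (t + 1) / ((t + 1).factorial : ℝ) = d at *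
  generalize ((N - (t + 1 + s)).factorial : ℝ) * ((t + 1 + s).factorial : ℝ) / (N.factorial : ℝ)
    = c' at *
  have h3 : (n : ℝ) + 2 + s ≠ 0 := by positivity
  field_simp
  linear_combination (c' * pochhammer ((n : ℝ) - N) s * (n - N + s)) * e

/-- Contiguity in `m`. -/
theorem alphaCoeff_succ_mid {N t s : ℕ} (n : ℕ) (h : t + s < N) :
    ((N : ℝ) - (t + s)) * alphaCoeff N t (t + (s + 1)) n
      = alphaCoeff N t (t + s) n * ((t + s + 1) * (N - n - s) / (n + 2 + s)) := by
  rw [alphaCoeff_add, alphaCoeff_add]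
  have h1 : pochhammer ((n : ℝ) + 2) s ≠ 0 := (pochhammer_pos (by positivity) s).ne'
  have h3 : (n : ℝ) + 2 + s ≠ 0 := by positivity
  obtain ⟨k, rfl⟩ : ∃ k, N = t + s + 1 + k := ⟨N - (t + s + 1), by omega⟩
  rw [show t + s + 1 + k - (t + (s + 1)) = k by omega,
    show t + s + 1 + k - (t + s) = k + 1 by omega, show t + (s + 1) = t + s + 1 by ring,
    Nat.factorial_succ (t + s), Nat.factorial_succ k, pochhammer_succ, pochhammer_succ, pow_succ]
  generalize pochhammer (((t + s + 1 + k : ℕ) : ℝ) + 2 - t) t / (t.factorial : ℝ) = c at *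
  generalize pochhammer ((n : ℝ) + 2) s = d at *
  generalize pochhammer ((n : ℝ) - (t + s + 1 + k : ℕ)) s = d' at *
  have : (((t + s + 1 + k).factorial : ℕ) : ℝ) ≠ 0 := by positivity
  push_cast
  field_simp
  ring

/-- Contiguity in `n` and `t`. -/
theorem alphaCoeff_succ_left_right (N t s n : ℕ) :
    ((n : ℝ) + 1) * alphaCoeff N t (t + (s + 1)) n * (N + 1 - t)
      = alphaCoeff N (t + 1) (t + 1 + s) (n + 1) * ((N - n) * (t + 1)) := by
  rw [alphaCoeff_add, alphaCoeff_add, show t + (s + 1) = t + 1 + s by ring]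
  have h2 : pochhammer ((n : ℝ) + 2 + 1) s ≠ 0 := (pochhammer_pos (by positivity) s).ne'
  have e := pochhammer_div_factorial_succ N t
  rw [pochhammer_succ', pochhammer_succ', pow_succ]
  have e3 : ((n + 1 : ℕ) : ℝ) + 2 = n + 2 + 1 := by push_cast; ring
  have e4 : ((n + 1 : ℕ) : ℝ) - N = n - N + 1 := by push_cast; ring
  rw [e3, e4]
  generalize pochhammer ((N : ℝ) + 2 - t) t / (t.factorial : ℝ) = c at *
  generalize pochhammer ((N : ℝ) + 2 - (t + 1 : ℕ)) (t + 1) / ((t + 1).factorial : ℝ) = d at *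
  generalize ((N - (t + 1 + s)).factorial : ℝ) * ((t + 1 + s).factorial : ℝ) / (N.factorial : ℝ)
    = c' at *
  generalize pochhammer ((n : ℝ) + 2 + 1) s = d1 at *
  generalize pochhammer ((n : ℝ) - N + 1) s = d2 at *
  push_cast
  rw [show (n : ℝ) + 1 + 1 = n + 2 by ring]
  field_simp
  linear_combination (c' * d2 * (n - N)) * e

/-- Contiguity in `m` and `t`. -/
theorem alphaCoeff_succ_left_mid {N t s : ℕ} (n : ℕ) (h : t + s < N) :
    ((t : ℝ) + s + 1) * alphaCoeff N t (t + s) n * (N + 1 - t)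
      = alphaCoeff N (t + 1) (t + 1 + s) n * ((N - (t + s)) * (t + 1)) := by
  rw [alphaCoeff_add, alphaCoeff_add]
  have e := pochhammer_div_factorial_succ N t
  obtain ⟨k, rfl⟩ : ∃ k, N = t + s + 1 + k := ⟨N - (t + s + 1), by omega⟩
  rw [show t + s + 1 + k - (t + 1 + s) = k by omega,
    show t + s + 1 + k - (t + s) = k + 1 by omega, show t + 1 + s = t + s + 1 by ring,
    Nat.factorial_succ (t + s), Nat.factorial_succ k]
  generalize pochhammer (((t + s + 1 + k : ℕ) : ℝ) + 2 - t) t / (t.factorial : ℝ) = c at *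
  generalize pochhammer (((t + s + 1 + k : ℕ) : ℝ) + 2 - (t + 1 : ℕ)) (t + 1)
    / ((t + 1).factorial : ℝ) = d at *
  generalize pochhammer ((n : ℝ) + 2) s = d1 at *
  generalize pochhammer ((n : ℝ) - (t + s + 1 + k : ℕ)) s = d2 at *
  have : (((t + s + 1 + k).factorial : ℕ) : ℝ) ≠ 0 := by positivity
  push_cast at *
  by_cases hd : d1 = 0
  · simp [hd]
  field_simp
  linear_combination (-((k : ℝ) + 1) * d2) * e

theorem alphaCoeff_self_succ_right (N m n : ℕ) :
    ((n : ℝ) + 2) * alphaCoeff N m m (n + 1) = (n + 1) * alphaCoeff N m m n := by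
  have h1 := alphaCoeff_add N m 0 n
  have h2 := alphaCoeff_add N m 0 (n + 1)
  simp only [add_zero, pochhammer, Finset.prod_range_zero] at h1 h2
  rw [h1, h2]
  push_cast
  rw [show (n : ℝ) + 1 + 1 = n + 2 by ring]
  field_simp

theorem alphaCoeff_zero_zero (N n : ℕ) : alphaCoeff N 0 0 n = ((N : ℝ) + 1) / (n + 1) := by
  simp [alphaCoeff, pochhammer]
  field_simp

/-! ### Chebyshev sums and the entrywise relations of the weight. -/

open Polynomial in
/-- The finite Chebyshev sum `∑_{t < M} f(t) U_{k - 2t}`. -/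
noncomputable def chebSum (f : ℕ → ℝ) (k : ℤ) (M : ℕ) : Polynomial ℝ :=
  ∑ t ∈ Finset.range M, C (f t) * Polynomial.Chebyshev.U ℝ (k - 2 * t)

section ChebSum

open Polynomial

theorem chebSum_add (f g : ℕ → ℝ) (k : ℤ) (M : ℕ) :
    chebSum (fun t => f t + g t) k M = chebSum f k M + chebSum g k M := by
  simp [chebSum, add_mul, Finset.sum_add_distrib]

theorem chebSum_mul (c : ℝ) (f : ℕ → ℝ) (k : ℤ) (M : ℕ) :
    chebSum (fun t => c * f t) k M = C c * chebSum f k M := by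
  simp [chebSum, Finset.mul_sum, mul_assoc]

theorem two_mul_X_mul_chebSum (f : ℕ → ℝ) (k : ℤ) (M : ℕ) :
    2 * X * chebSum f k M = chebSum f (k + 1) M + chebSum f (k - 1) M := by
  simp only [chebSum, Finset.mul_sum, ← Finset.sum_add_distrib]
  refine Finset.sum_congr rfl fun t _ => ?_
  have h := Polynomial.Chebyshev.U_add_one ℝ (k - 2 * t)
  rw [show k + 1 - 2 * (t : ℤ) = k - 2 * t + 1 by ring,
    show k - 1 - 2 * (t : ℤ) = k - 2 * t - 1 by ring, h]
  ring

/-- Collects the coefficients of each U_{k-2t}: the sums based at k - 2 are shifted by one index, so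
t = 0 meets only a and c, t = m + 1 only b and c, and all four meet in between. -/
theorem chebSum_combine_eq_zero (a b c d : ℕ → ℝ) (k : ℤ) (m : ℕ) (h0 : a 0 + c 0 = 0)
    (h1 : ∀ t < m, a (t + 1) + b t + c (t + 1) + d t = 0) (h2 : b m + c (m + 1) = 0) :
    chebSum a k (m + 1) + chebSum b (k - 2) (m + 1) + chebSum c k (m + 2)
      + chebSum d (k - 2) m = 0 := by
  have e0 : C (a 0) + C (c 0) = (0 : ℝ[X]) := by rw [← C_add, h0, C_0]
  have e2 : C (b m) + C (c (m + 1)) = (0 : ℝ[X]) := by rw [← C_add, h2, C_0]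
  have e1 : ∑ t ∈ Finset.range m, (C (a (t + 1)) + C (b t) + C (c (t + 1)) + C (d t))
      * Polynomial.Chebyshev.U ℝ (k - 2 * (t + 1 : ℕ)) = 0 := by
    refine Finset.sum_eq_zero fun t ht => ?_
    rw [← C_add, ← C_add, ← C_add, h1 t (Finset.mem_range.mp ht), C_0, zero_mul]
  simp only [add_mul, Finset.sum_add_distrib] at e1
  have hk : ∀ t : ℕ, k - 2 - 2 * (t : ℤ) = k - 2 * (t + 1 : ℕ) := fun t => by push_cast; ring
  simp only [chebSum, hk]
  rw [Finset.sum_range_succ' (fun t => C (a t) * _), Finset.sum_range_succ (fun t => C (b t) * _),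
    Finset.sum_range_succ (fun t => C (c t) * _), Finset.sum_range_succ' (fun t => C (c t) * _)]
  linear_combination e1 + e0 * Polynomial.Chebyshev.U ℝ (k - 2 * (0 : ℕ))
    + e2 * Polynomial.Chebyshev.U ℝ (k - 2 * (m + 1 : ℕ))

/-- The polynomial part of the `(n, m)` entry of the weight, for `m ≤ n`. -/
noncomputable def weightPoly (N n m : ℕ) : ℝ[X] :=
  chebSum (fun t => alphaCoeff N t m n) ((n : ℤ) + m) (m + 1)

theorem natCast_mul_weightPoly_pred (N n m : ℕ) :
    (m : ℝ[X]) * weightPoly N n (m - 1)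
      = C (m : ℝ) * chebSum (fun t => alphaCoeff N t (m - 1) n) ((n : ℤ) + m - 1) m := by
  rcases m with _ | m
  · simp
  · rw [weightPoly, Nat.add_sub_cancel]
    push_cast
    simp [add_sub_assoc]

/-- The six-term linear relation satisfied by the Chebyshev coefficients of two contiguity
relations of the weight. -/
theorem alphaCoeff_contiguity {N k t s : ℕ} (hk : k < N) (hs : t + 1 + s ≤ k) :
    ∃ b d e : ℝ, d = (k : ℝ) + 3 + s ∧ e = (N : ℝ) + 1 - t ∧ d ≠ 0 ∧ e ≠ 0 ∧
      ((N : ℝ) - (k + 1)) * alphaCoeff N (t + 1) (t + 1 + s) (k + 2)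
        = b * ((k + 2) * (N - (k + 1) - s) / d) ∧
      alphaCoeff N (t + 1) (t + 1 + s) (k + 1) = b ∧
      alphaCoeff N t (t + 1 + s) (k + 1) = b * ((N - (k + 1) - s) * (t + 1) / (d * e)) ∧
      ((k : ℝ) + 1) * alphaCoeff N t (t + 1 + s) k = b * ((N - k) * (t + 1) / e) ∧
      ((N : ℝ) - (t + 1 + s)) * alphaCoeff N (t + 1) (t + 1 + s + 1) (k + 1)
        = b * ((t + s + 2) * (N - (k + 1) - s) / d) ∧
      ((t : ℝ) + 1 + s) * alphaCoeff N t (t + s) (k + 1) = b * ((N - (t + s)) * (t + 1) / e) := by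
  have hd : (k : ℝ) + 3 + s ≠ 0 := by positivity
  have he : (N : ℝ) + 1 - t ≠ 0 := by
    have : (t : ℝ) ≤ N := by exact_mod_cast (by omega : t ≤ N)
    intro h
    linarith
  refine ⟨alphaCoeff N (t + 1) (t + 1 + s) (k + 1), _, _, rfl, rfl, hd, he, ?_, rfl, ?_, ?_, ?_, ?_⟩
  · have h := alphaCoeff_succ_right N (t + 1) s (k + 1)
    push_cast at h
    rw [h]
    ring
  · have h := alphaCoeff_succ_left N t s (k + 1)
    push_cast at h
    rw [show t + (s + 1) = t + 1 + s by ring] at h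
    field_simp
    linear_combination h
  · have h := alphaCoeff_succ_left_right N t s k
    rw [show t + (s + 1) = t + 1 + s by ring] at h
    field_simp
    linear_combination h
  · have h := alphaCoeff_succ_mid (N := N) (t := t + 1) (s := s) (k + 1) (by omega)
    push_cast at h
    rw [show t + 1 + (s + 1) = t + 1 + s + 1 by ring] at h
    rw [h]
    ring
  · have h := alphaCoeff_succ_left_mid (N := N) (t := t) (s := s) (k + 1) (by omega)
    field_simp
    linear_combination h

/-- Entry (k + 1, m) of TV + VTᵗ, strictly below the diagonal. After doubling and expanding 2xU_j =
U_{j+1} + U_{j-1}, each Chebyshev coefficient vanishes by contiguity. -/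
theorem weightPoly_skew {N k m : ℕ} (hk : k < N) (hm : m ≤ k) :
    ((N : ℝ[X]) - (k + 1)) * weightPoly N (k + 2) m - (k + 1) * weightPoly N k m
      - (X : ℝ[X]) * ((2 * N - 2 * (k + 1) - 2 * m) * weightPoly N (k + 1) m)
      + (N - m) * weightPoly N (k + 1) (m + 1) - m * weightPoly N (k + 1) (m - 1) = 0 := by
  rw [natCast_mul_weightPoly_pred]
  have hX := two_mul_X_mul_chebSum (fun t => alphaCoeff N t m (k + 1)) ((k : ℤ) + 1 + m) (m + 1)
  set K : ℤ := (k : ℤ) + m + 2 with hK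
  have key := chebSum_combine_eq_zero
    (fun t => 2 * (N - (k + 1)) * alphaCoeff N t m (k + 2)
      + -(2 * N - 2 * (k + 1) - 2 * m) * alphaCoeff N t m (k + 1))
    (fun t => -2 * (k + 1) * alphaCoeff N t m k
      + -(2 * N - 2 * (k + 1) - 2 * m) * alphaCoeff N t m (k + 1))
    (fun t => 2 * (N - m) * alphaCoeff N t (m + 1) (k + 1))
    (fun t => -2 * m * alphaCoeff N t (m - 1) (k + 1)) K m ?_ ?_ ?_
  · simp only [chebSum_add, chebSum_mul] at key
    simp only [weightPoly]
    push_cast at hX ⊢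
    rw [show (k : ℤ) + 2 + m = K by ring, show (k : ℤ) + m = K - 2 by ring,
      show (k : ℤ) + 1 + (m + 1) = K by ring, show (k : ℤ) + 1 + m - 1 = K - 2 by ring]
    rw [show (k : ℤ) + 1 + m - 1 = K - 2 by ring, show (k : ℤ) + 1 + m + 1 = K by ring] at hX
    simp only [map_neg, map_mul, map_sub, map_add, map_natCast, map_one, map_ofNat] at key ⊢
    have h2 : (2 : ℝ[X]) ≠ 0 := two_ne_zero
    refine mul_left_cancel₀ h2 ?_
    linear_combination key - (2 * (N : ℝ[X]) - 2 * (k + 1) - 2 * m) * hX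
  · have h1 := alphaCoeff_succ_right N 0 m (k + 1)
    have h2 := alphaCoeff_succ_mid (N := N) (t := 0) (s := m) (k + 1) (by omega)
    simp only [zero_add] at h1 h2
    push_cast at h1 h2
    have hd : (k : ℝ) + 3 + m ≠ 0 := by positivity
    have hd' : (k : ℝ) + 1 + 2 + m ≠ 0 := by positivity
    field_simp at h1 h2
    refine mul_right_cancel₀ hd ?_
    linear_combination 2 * h1 + 2 * h2
  · intro t ht
    obtain ⟨s, rfl⟩ : ∃ s, m = t + 1 + s := ⟨m - (t + 1), by omega⟩
    obtain ⟨b, d, e, hd, he, hd0, he0, h1, h2, h3, h4, h5, h6⟩ := alphaCoeff_contiguity hk hm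
    rw [show t + 1 + s - 1 = t + s by omega]
    push_cast
    rw [h2, h3]
    -- All six coefficients are rational multiples of the single value b, so the relation reduces to
    -- an identity of rational functions.
    have : 2 * (b * ((k + 2) * (N - (k + 1) - s) / d))
        - (2 * N - 2 * (k + 1) - 2 * (t + 1 + s)) * b
        - 2 * (b * ((N - k) * (t + 1) / e))
        - (2 * N - 2 * (k + 1) - 2 * (t + 1 + s)) * (b * ((N - (k + 1) - s) * (t + 1) / (d * e)))
        + 2 * (b * ((t + s + 2) * (N - (k + 1) - s) / d))
        - 2 * (b * ((N - (t + s)) * (t + 1) / e)) = 0 := by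
      field_simp
      rw [hd, he]
      ring
    linear_combination this + 2 * h1 - 2 * h4 + 2 * h5 - 2 * h6
  · have h1 := alphaCoeff_self_succ_right N m k
    have h2 := alphaCoeff_succ_left_mid (N := N) (t := m) (s := 0) (k + 1) (by omega)
    have h3 := alphaCoeff_self_succ_right N m k
    simp only [add_zero, Nat.cast_zero] at h2
    have hm1 : (m : ℝ) + 1 ≠ 0 := by positivity
    refine mul_right_cancel₀ hm1 ?_
    linear_combination 2 * (m + 1) * h1 - 2 * h2

/-- Entry (k + 1, m) of FV - (FV)ᵗ. Skewness of TV merges the two contributions of hTV, which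
produces the factor 2N - 2(k + 1) - 2m. -/
theorem weightPoly_symm {N k m : ℕ} (hk : k < N) (hm : m ≤ k) :
    (2 * (N : ℝ[X]) - 2 * (k + 1) - 2 * m) * (((N : ℝ[X]) - (k + 1)) * weightPoly N (k + 2) m
      - (k + 1) * weightPoly N k m - (X : ℝ[X]) * ((N - 2 * (k + 1)) * weightPoly N (k + 1) m))
      = (N + 2) * ((N - (k + 1)) * weightPoly N (k + 2) m + (k + 1) * weightPoly N k m
        - (N - m) * weightPoly N (k + 1) (m + 1) - m * weightPoly N (k + 1) (m - 1)) := by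
  rw [natCast_mul_weightPoly_pred]
  have hX := two_mul_X_mul_chebSum (fun t => alphaCoeff N t m (k + 1)) ((k : ℤ) + 1 + m) (m + 1)
  set K : ℤ := (k : ℤ) + m + 2 with hK
  have key := chebSum_combine_eq_zero
    (fun t => (2 * (2 * N - 2 * (k + 1) - 2 * m) - 2 * (N + 2)) * (N - (k + 1))
        * alphaCoeff N t m (k + 2)
      + -(2 * N - 2 * (k + 1) - 2 * m) * (N - 2 * (k + 1)) * alphaCoeff N t m (k + 1))
    (fun t => (-2 * (2 * N - 2 * (k + 1) - 2 * m) - 2 * (N + 2)) * (k + 1) * alphaCoeff N t m k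
      + -(2 * N - 2 * (k + 1) - 2 * m) * (N - 2 * (k + 1)) * alphaCoeff N t m (k + 1))
    (fun t => 2 * (N + 2) * (N - m) * alphaCoeff N t (m + 1) (k + 1))
    (fun t => 2 * (N + 2) * m * alphaCoeff N t (m - 1) (k + 1)) K m ?_ ?_ ?_
  · simp only [chebSum_add, chebSum_mul] at key
    simp only [weightPoly]
    push_cast at hX ⊢
    rw [show (k : ℤ) + 2 + m = K by ring, show (k : ℤ) + m = K - 2 by ring,
      show (k : ℤ) + 1 + (m + 1) = K by ring, show (k : ℤ) + 1 + m - 1 = K - 2 by ring]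
    rw [show (k : ℤ) + 1 + m - 1 = K - 2 by ring, show (k : ℤ) + 1 + m + 1 = K by ring] at hX
    simp only [map_neg, map_mul, map_sub, map_add, map_natCast, map_one, map_ofNat] at key ⊢
    have h2 : (2 : ℝ[X]) ≠ 0 := two_ne_zero
    refine mul_left_cancel₀ h2 ?_
    linear_combination key
      - (2 * (N : ℝ[X]) - 2 * (k + 1) - 2 * m) * (N - 2 * (k + 1)) * hX
  · have h1 := alphaCoeff_succ_right N 0 m (k + 1)
    have h2 := alphaCoeff_succ_mid (N := N) (t := 0) (s := m) (k + 1) (by omega)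
    simp only [zero_add] at h1 h2
    push_cast at h1 h2
    have hd : (k : ℝ) + 3 + m ≠ 0 := by positivity
    have hd' : (k : ℝ) + 1 + 2 + m ≠ 0 := by positivity
    field_simp at h1 h2
    refine mul_right_cancel₀ hd ?_
    linear_combination (2 * (2 * (N : ℝ) - 2 * (k + 1) - 2 * m) - 2 * (N + 2)) * h1
      + 2 * ((N : ℝ) + 2) * h2
  · intro t ht
    obtain ⟨s, rfl⟩ : ∃ s, m = t + 1 + s := ⟨m - (t + 1), by omega⟩
    obtain ⟨b, d, e, hd, he, hd0, he0, h1, h2, h3, h4, h5, h6⟩ := alphaCoeff_contiguity hk hm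
    rw [show t + 1 + s - 1 = t + s by omega]
    push_cast
    rw [h2, h3]
    have : (2 * (2 * N - 2 * (k + 1) - 2 * (t + 1 + s)) - 2 * (N + 2))
          * (b * ((k + 2) * (N - (k + 1) - s) / d))
        - (2 * N - 2 * (k + 1) - 2 * (t + 1 + s)) * (N - 2 * (k + 1)) * b
        + (-2 * (2 * N - 2 * (k + 1) - 2 * (t + 1 + s)) - 2 * (N + 2))
          * (b * ((N - k) * (t + 1) / e))
        - (2 * N - 2 * (k + 1) - 2 * (t + 1 + s)) * (N - 2 * (k + 1))
          * (b * ((N - (k + 1) - s) * (t + 1) / (d * e)))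
        + 2 * (N + 2) * (b * ((t + s + 2) * (N - (k + 1) - s) / d))
        + 2 * (N + 2) * (b * ((N - (t + s)) * (t + 1) / e)) = 0 := by
      field_simp
      rw [hd, he]
      ring
    linear_combination this
      + (2 * (2 * N - 2 * (k + 1) - 2 * (t + 1 + s)) - 2 * ((N : ℝ) + 2)) * h1
      + (-2 * (2 * N - 2 * (k + 1) - 2 * (t + 1 + s)) - 2 * ((N : ℝ) + 2)) * h4
      + 2 * ((N : ℝ) + 2) * h5 + 2 * ((N : ℝ) + 2) * h6
  · have h1 := alphaCoeff_self_succ_right N m k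
    have h2 := alphaCoeff_succ_left_mid (N := N) (t := m) (s := 0) (k + 1) (by omega)
    simp only [add_zero, Nat.cast_zero] at h2
    have hm1 : (m : ℝ) + 1 ≠ 0 := by positivity
    refine mul_right_cancel₀ hm1 ?_
    linear_combination
      (2 * (2 * (N : ℝ) - 2 * (k + 1) - 2 * m) + 2 * (N + 2)) * (m + 1) * h1
      - 2 * ((N : ℝ) + 2) * h2

theorem weightPoly_zero (N n : ℕ) :
    weightPoly N n 0 = C (((N : ℝ) + 1) / (n + 1)) * Polynomial.Chebyshev.U ℝ n := by
  simp [weightPoly, chebSum, alphaCoeff_zero_zero]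

end ChebSum

/-! ### The matrix V: skewness, symmetry and the Pearson equation. -/

section WeightMatrix

open Polynomial

theorem weightPoly_skew_diag {N n : ℕ} (hn : n ≤ N) :
    ((N : ℝ[X]) - n) * weightPoly N (n + 1) n - n * weightPoly N n (n - 1)
      - (X : ℝ[X]) * ((N - 2 * n) * weightPoly N n n) = 0 := by
  rw [natCast_mul_weightPoly_pred]
  have hX := two_mul_X_mul_chebSum (fun t => alphaCoeff N t n n) ((n : ℤ) + n) (n + 1)
  set K : ℤ := (n : ℤ) + n + 1 with hK
  have key := chebSum_combine_eq_zero
    (fun t => 2 * (N - n) * alphaCoeff N t n (n + 1) + -(N - 2 * n) * alphaCoeff N t n n)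
    (fun t => -(N - 2 * n) * alphaCoeff N t n n)
    -- On the diagonal the last coefficient has no partner. It multiplies U_{-1} = 0, so a term at t
    -- = n + 1 can be added at no cost to balance it.
    (fun t => if t = n + 1 then (N - 2 * n) * alphaCoeff N n n n else 0)
    (fun t => -2 * n * alphaCoeff N t (n - 1) n) K n ?_ ?_ ?_
  · have hc : chebSum (fun t => if t = n + 1 then (N - 2 * n) * alphaCoeff N n n n else 0) K (n + 2)
        = 0 := by
      rw [chebSum]
      refine Finset.sum_eq_zero fun t _ => ?_
      split_ifs with h
      · rw [h, show K - 2 * ((n + 1 : ℕ) : ℤ) = -1 by push_cast; ring,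
          Polynomial.Chebyshev.U_neg_one, mul_zero]
      · simp
    rw [hc] at key
    simp only [chebSum_add, chebSum_mul] at key
    simp only [weightPoly]
    push_cast at hX ⊢
    rw [show (n : ℤ) + 1 + n = K by ring, show (n : ℤ) + n - 1 = K - 2 by ring]
    rw [show (n : ℤ) + n - 1 = K - 2 by ring] at hX
    simp only [map_neg, map_mul, map_sub, map_natCast, map_ofNat] at key ⊢
    have h2 : (2 : ℝ[X]) ≠ 0 := two_ne_zero
    refine mul_left_cancel₀ h2 ?_
    linear_combination key - ((N : ℝ[X]) - 2 * n) * hX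
  · have h1 := alphaCoeff_succ_right N 0 n n
    simp only [zero_add] at h1
    have hd : (n : ℝ) + 2 + n ≠ 0 := by positivity
    field_simp at h1
    rw [if_neg (by omega)]
    have hd1 : (n : ℝ) + 1 ≠ 0 := by positivity
    refine mul_right_cancel₀ hd1 ?_
    linear_combination h1
  · intro t ht
    obtain ⟨s, rfl⟩ : ∃ s, n = t + 1 + s := ⟨n - (t + 1), by omega⟩
    have hd : ((t + 1 + s : ℕ) : ℝ) + 2 + s ≠ 0 := by positivity
    have he : (N : ℝ) + 1 - t ≠ 0 := by
      have : (t : ℝ) ≤ N := by exact_mod_cast (by omega : t ≤ N)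
      intro h
      linarith
    have h1 := alphaCoeff_succ_right N (t + 1) s (t + 1 + s)
    have h2 := alphaCoeff_succ_left N t s (t + 1 + s)
    have h3 := alphaCoeff_succ_left_mid (N := N) (t := t) (s := s) (t + 1 + s) (by omega)
    rw [show t + (s + 1) = t + 1 + s by ring] at h2
    rw [← eq_div_iff (mul_ne_zero hd he)] at h2
    rw [← eq_div_iff he] at h3
    rw [show t + 1 + s - 1 = t + s by omega, if_neg (by omega), h2]
    push_cast at *
    generalize alphaCoeff N (t + 1) (t + 1 + s) (t + 1 + s) = b at *
    have : 2 * (b * ((t + 1 + s + 1) * (N - (t + 1 + s) - s) / (t + 1 + s + 2 + s)))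
        - (N - 2 * (t + 1 + s)) * b - (N - 2 * (t + 1 + s)) *
          (b * ((N - (t + 1 + s) - s) * (t + 1)) / ((t + 1 + s + 2 + s) * (N + 1 - t)))
        - 2 * (b * ((N - (t + s)) * (t + 1)) / (N + 1 - t)) = 0 := by
      field_simp
      ring
    linear_combination this + 2 * h1 - 2 * h3
  · simp only [if_pos]
    ring

/-- The polynomial part of the `(n, m)` entry of the weight. -/
noncomputable def weightSym (N n m : ℕ) : ℝ[X] :=
  if m ≤ n then weightPoly N n m else weightPoly N m n

theorem weightSym_of_le {N n m : ℕ} (h : m ≤ n) : weightSym N n m = weightPoly N n m := if_pos h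

theorem weightSym_of_ge {N n m : ℕ} (h : n ≤ m) : weightSym N n m = weightPoly N m n := by
  rcases h.eq_or_lt with rfl | h
  · exact if_pos le_rfl
  · exact if_neg (by omega)

theorem weightSym_comm (N n m : ℕ) : weightSym N n m = weightSym N m n := by
  rcases le_total n m with h | h
  · rw [weightSym_of_ge h, weightSym_of_le h]
  · rw [weightSym_of_le h, weightSym_of_ge h]

/-- The polynomial matrix `V` with `W(x) = √(1 - x²) V(x)`. -/
noncomputable def weightMat (N : ℕ) : Matrix (Fin (N + 1)) (Fin (N + 1)) ℝ[X] :=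
  Matrix.of fun n m : Fin (N + 1) => weightSym N n m

theorem weightMat_transpose (N : ℕ) : (weightMat N).transpose = weightMat N := by
  ext1 i j
  exact weightSym_comm N j i

theorem skewMat_mul_weightMat_apply (N : ℕ) (i j : Fin (N + 1)) :
    (skewMat N (X : ℝ[X]) * weightMat N) i j
      = ((N : ℝ[X]) - (i : ℕ)) * weightSym N (i + 1) j - ((i : ℕ) : ℝ[X]) * weightSym N (i - 1) j
        - (X : ℝ[X]) * (((N : ℝ[X]) - 2 * (i : ℕ)) * weightSym N i j) :=
  skewMat_mul_apply N X (weightSym N) i j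

theorem natCast_mul_weightSym_pred {N n m : ℕ} (h : m ≤ n) :
    (m : ℝ[X]) * weightSym N (m - 1) n = m * weightPoly N n (m - 1) := by
  rw [weightSym_of_ge (by omega)]

theorem skewMat_mul_weightMat_add_lt (N : ℕ) (i j : Fin (N + 1)) (hij : (j : ℕ) < i) :
    (skewMat N (X : ℝ[X]) * weightMat N) i j + (skewMat N (X : ℝ[X]) * weightMat N) j i = 0 := by
  obtain ⟨k, hk⟩ : ∃ k, (i : ℕ) = k + 1 := ⟨i - 1, by omega⟩
  have hkN : k < N := by have := i.2; omega
  have h := weightPoly_skew hkN (show (j : ℕ) ≤ k by omega)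
  rw [skewMat_mul_weightMat_apply, skewMat_mul_weightMat_apply, natCast_mul_weightSym_pred hij.le,
    weightSym_of_le (show (j : ℕ) ≤ i + 1 by omega),
    weightSym_of_le (show (j : ℕ) ≤ i - 1 by omega), weightSym_of_le hij.le,
    weightSym_of_ge hij.le, weightSym_of_ge (show (j : ℕ) + 1 ≤ i by omega), hk,
    Nat.add_sub_cancel]
  push_cast
  linear_combination h

theorem skewMat_mul_weightMat_diag (N : ℕ) (i : Fin (N + 1)) :
    (skewMat N (X : ℝ[X]) * weightMat N) i i = 0 := by
  have h := weightPoly_skew_diag (show (i : ℕ) ≤ N by omega)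
  rw [skewMat_mul_weightMat_apply, natCast_mul_weightSym_pred le_rfl,
    weightSym_of_le (show (i : ℕ) ≤ i + 1 by omega), weightSym_of_le le_rfl]
  exact h

theorem skewMat_mul_weightMat_add (N : ℕ) :
    skewMat N (X : ℝ[X]) * weightMat N + weightMat N * (skewMat N (X : ℝ[X])).transpose = 0 := by
  have e : weightMat N * (skewMat N (X : ℝ[X])).transpose = (skewMat N (X : ℝ[X]) * weightMat N).transpose := by
    rw [Matrix.transpose_mul, weightMat_transpose]
  rw [e]
  ext1 i j
  rw [Matrix.add_apply, Matrix.transpose_apply, Matrix.zero_apply]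
  rcases lt_trichotomy (i : ℕ) j with h | h | h
  · rw [add_comm]
    exact skewMat_mul_weightMat_add_lt N j i h
  · obtain rfl : i = j := Fin.ext h
    rw [skewMat_mul_weightMat_diag, add_zero]
  · exact skewMat_mul_weightMat_add_lt N i j h

theorem symMat_mul_weightMat_apply (N : ℕ) (i j : Fin (N + 1)) :
    (symMat N (X : ℝ[X]) * weightMat N) i j
      = ((N : ℝ[X]) - 2 * (i : ℕ)) * (skewMat N (X : ℝ[X]) * weightMat N) i j
        - ((N : ℝ[X]) + 2) * (((N : ℝ[X]) - (i : ℕ)) * weightSym N (i + 1) j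
          + ((i : ℕ) : ℝ[X]) * weightSym N (i - 1) j) := by
  rw [symMat, sub_mul, Matrix.sub_apply, mul_assoc, cartanMat_mul_apply, Matrix.smul_mul,
    Matrix.smul_apply, add_mul, Matrix.add_apply, weightMat, raiseMat_mul_apply,
    lowerMat_mul_apply, smul_eq_mul]

theorem symMat_mul_weightMat_lt (N : ℕ) (i j : Fin (N + 1)) (hij : (j : ℕ) < i) :
    (symMat N (X : ℝ[X]) * weightMat N) i j = (symMat N (X : ℝ[X]) * weightMat N) j i := by
  have hskew := skewMat_mul_weightMat_add_lt N i j hij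
  obtain ⟨k, hk⟩ : ∃ k, (i : ℕ) = k + 1 := ⟨i - 1, by omega⟩
  have hkN : k < N := by have := i.2; omega
  have h := weightPoly_symm hkN (show (j : ℕ) ≤ k by omega)
  have e := skewMat_mul_weightMat_apply N i j
  rw [symMat_mul_weightMat_apply, symMat_mul_weightMat_apply, natCast_mul_weightSym_pred hij.le,
    weightSym_of_ge (show (j : ℕ) + 1 ≤ i by omega)]
  generalize (skewMat N (X : ℝ[X]) * weightMat N) j i = B at *
  obtain rfl : B = -(skewMat N (X : ℝ[X]) * weightMat N) i j := by linear_combination hskew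
  rw [e]
  rw [weightSym_of_le (show (j : ℕ) ≤ i + 1 by omega),
    weightSym_of_le (show (j : ℕ) ≤ i - 1 by omega), weightSym_of_le hij.le, hk,
    Nat.add_sub_cancel]
  push_cast
  linear_combination h

theorem symMat_mul_weightMat (N : ℕ) :
    symMat N (X : ℝ[X]) * weightMat N = weightMat N * (symMat N (X : ℝ[X])).transpose := by
  have e : weightMat N * (symMat N (X : ℝ[X])).transpose = (symMat N (X : ℝ[X]) * weightMat N).transpose := by
    rw [Matrix.transpose_mul, weightMat_transpose]
  rw [e]
  ext1 i j
  rw [Matrix.transpose_apply]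
  rcases lt_trichotomy (i : ℕ) j with h | h | h
  · exact (symMat_mul_weightMat_lt N j i h).symm
  · obtain rfl : i = j := Fin.ext h
    rfl
  · exact symMat_mul_weightMat_lt N i j h

/-- Entrywise derivative of a polynomial matrix. -/
noncomputable def derivMat {K n : Type*} [CommRing K] (M : Matrix n n K[X]) : Matrix n n K[X] :=
  M.map derivative

section DerivMat

variable {K n : Type*} [CommRing K]

theorem derivMat_apply (A : Matrix n n K[X]) (i j : n) :
    derivMat A i j = derivative (A i j) := rfl

theorem derivMat_add (A B : Matrix n n K[X]) : derivMat (A + B) = derivMat A + derivMat B := by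
  ext1 i j
  simp [derivMat_apply]

theorem derivMat_sub (A B : Matrix n n K[X]) : derivMat (A - B) = derivMat A - derivMat B := by
  ext1 i j
  simp [derivMat_apply]

theorem derivMat_smul (f : K[X]) (A : Matrix n n K[X]) :
    derivMat (f • A) = derivative f • A + f • derivMat A := by
  ext1 i j
  simp [derivMat_apply]

theorem derivMat_mul [Fintype n] (A B : Matrix n n K[X]) :
    derivMat (A * B) = derivMat A * B + A * derivMat B := by
  ext1 i j
  simp only [derivMat_apply, Matrix.mul_apply, Matrix.add_apply, derivative_sum, derivative_mul,
    Finset.sum_add_distrib]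

theorem derivMat_transpose (A : Matrix n n K[X]) :
    derivMat A.transpose = (derivMat A).transpose := rfl

end DerivMat

theorem derivMat_raiseMat (N : ℕ) : derivMat (raiseMat N ℝ[X]) = 0 := by
  ext1 i j
  simp only [derivMat_apply, raiseMat, Matrix.of_apply]
  split_ifs <;> simp

theorem derivMat_lowerMat (N : ℕ) : derivMat (lowerMat N ℝ[X]) = 0 := by
  ext1 i j
  simp only [derivMat_apply, lowerMat, Matrix.of_apply]
  split_ifs <;> simp

theorem derivMat_cartanMat (N : ℕ) : derivMat (cartanMat N ℝ[X]) = 0 := by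
  ext1 i j
  simp only [derivMat_apply, cartanMat, Matrix.diagonal_apply]
  split_ifs <;> simp

theorem derivMat_skewMat (N : ℕ) : derivMat (skewMat N (X : ℝ[X])) = -cartanMat N ℝ[X] := by
  rw [skewMat, derivMat_sub, derivMat_sub, derivMat_smul, derivMat_raiseMat, derivMat_lowerMat,
    derivMat_cartanMat]
  simp

/-- The Pearson equation for the polynomial part of the weight. -/
theorem two_mul_derivMat_weightMat (N : ℕ) :
    (2 * (1 - X ^ 2) : ℝ[X]) • derivMat (weightMat N) + pearsonMat N (X : ℝ[X]) * weightMat N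
      + weightMat N * (pearsonMat N (X : ℝ[X])).transpose = 0 := by
  have hskew := skewMat_mul_weightMat_add N
  have hd : derivMat (skewMat N (X : ℝ[X])) * weightMat N + skewMat N (X : ℝ[X]) * derivMat (weightMat N)
      + (derivMat (weightMat N) * (skewMat N (X : ℝ[X])).transpose
        + weightMat N * (derivMat (skewMat N (X : ℝ[X]))).transpose) = 0 := by
    have h := congrArg derivMat hskew
    rw [derivMat_add, derivMat_mul, derivMat_mul, derivMat_transpose] at h
    rw [h]
    ext1 i j
    simp [derivMat_apply]
  have hcomm := skewMat_mul_pearsonMat N (X : ℝ[X])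
  -- The left side L of the Pearson equation satisfies TL + LTᵗ = 0: differentiating the skewness of
  -- V gives hV + Vh, which the h-terms of [T, K] and its transpose cancel. Only the first column of
  -- L remains.
  refine eq_zero_of_skewMat N (X : ℝ[X]) _ ?_ ?_
  · have hcommT := congrArg Matrix.transpose hcomm
    simp only [Matrix.transpose_mul, Matrix.transpose_add, Matrix.transpose_sub,
      Matrix.transpose_smul, cartanMat_transpose] at hcommT
    have hV : weightMat N * (skewMat N (X : ℝ[X])).transpose = -(skewMat N (X : ℝ[X]) * weightMat N) :=
      (neg_eq_of_add_eq_zero_right hskew).symm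
    rw [derivMat_skewMat, Matrix.transpose_neg, cartanMat_transpose] at hd
    have e1 : skewMat N (X : ℝ[X]) * derivMat (weightMat N)
        = cartanMat N ℝ[X] * weightMat N + weightMat N * cartanMat N ℝ[X]
          - derivMat (weightMat N) * (skewMat N (X : ℝ[X])).transpose := by
      rw [← sub_eq_zero, ← hd]
      simp only [neg_mul, mul_neg]
      abel
    have e2 : skewMat N (X : ℝ[X]) * (pearsonMat N (X : ℝ[X]) * weightMat N)
        = pearsonMat N (X : ℝ[X]) * (skewMat N (X : ℝ[X]) * weightMat N) + (2 * X : ℝ[X]) • (skewMat N (X : ℝ[X]) * weightMat N)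
          - (2 * (1 - X ^ 2) : ℝ[X]) • (cartanMat N ℝ[X] * weightMat N) := by
      rw [← mul_assoc, hcomm]
      simp only [sub_mul, add_mul, Matrix.smul_mul, mul_assoc]
    have e3 : weightMat N * (pearsonMat N (X : ℝ[X])).transpose * (skewMat N (X : ℝ[X])).transpose
        = weightMat N * (skewMat N (X : ℝ[X])).transpose * (pearsonMat N (X : ℝ[X])).transpose
          + (2 * X : ℝ[X]) • (weightMat N * (skewMat N (X : ℝ[X])).transpose)
          - (2 * (1 - X ^ 2) : ℝ[X]) • (weightMat N * cartanMat N ℝ[X]) := by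
      rw [mul_assoc, hcommT]
      simp only [mul_sub, mul_add, Matrix.mul_smul, mul_assoc]
    rw [mul_add, mul_add, add_mul, add_mul, Matrix.mul_smul, Matrix.smul_mul, e1, e2, e3,
      mul_assoc (pearsonMat N (X : ℝ[X])), hV]
    simp only [mul_neg, neg_mul, mul_assoc]
    module
  · intro i
    -- The first column of V is (N + 1)/(i + 1) U_i, so its Pearson equation is the classical
    -- formula for U_i'.
    have hc := Polynomial.Chebyshev.add_one_mul_T_eq_poly_in_U (R := ℝ) (i : ℕ)
    have hT := Polynomial.Chebyshev.T_eq_X_mul_U_sub_U ℝ ((i : ℕ) - 1)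
    rw [show ((i : ℕ) : ℤ) - 1 + 2 = (i : ℕ) + 1 by ring, sub_add_cancel] at hT
    rw [hT] at hc
    have hsk := congrFun (congrFun hskew i) 0
    have e : weightMat N * (skewMat N (X : ℝ[X])).transpose = (skewMat N (X : ℝ[X]) * weightMat N).transpose := by
      rw [Matrix.transpose_mul, weightMat_transpose]
    have e' : weightMat N * (pearsonMat N (X : ℝ[X])).transpose
        = (pearsonMat N (X : ℝ[X]) * weightMat N).transpose := by
      rw [Matrix.transpose_mul, weightMat_transpose]
    have hK : ∀ a b : Fin (N + 1), (pearsonMat N (X : ℝ[X]) * weightMat N) a b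
        = (X : ℝ[X]) * N * weightSym N a b - (N - (a : ℕ)) * weightSym N (a + 1) b
          - (a : ℕ) * weightSym N (a - 1) b := by
      intro a b
      rw [pearsonMat, sub_mul, sub_mul, Matrix.sub_apply, Matrix.sub_apply, Matrix.smul_mul,
        one_mul, Matrix.smul_apply, smul_eq_mul, weightMat, raiseMat_mul_apply,
        lowerMat_mul_apply]
      rfl
    rw [e, Matrix.add_apply, Matrix.transpose_apply, skewMat_mul_weightMat_apply,
      skewMat_mul_weightMat_apply] at hsk
    rw [e', Matrix.add_apply, Matrix.add_apply, Matrix.transpose_apply, hK, hK,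
      Matrix.smul_apply, derivMat_apply]
    have hV : weightMat N i 0 = weightPoly N i 0 := weightSym_of_le (Nat.zero_le _)
    have hi : ∀ k : ℕ, weightSym N k (0 : Fin (N + 1)) = weightPoly N k 0 := 
      fun k => weightSym_of_le (Nat.zero_le _)
    have hi' : weightSym N (0 : Fin (N + 1)) i = weightPoly N i 0 :=
      weightSym_of_ge (Nat.zero_le _)
    rw [hV]
    simp only [hi, hi'] at hsk ⊢
    have hlow : ((i : ℕ) : ℝ[X]) * weightPoly N (i - 1) 0
        = C ((N : ℝ) + 1) * Polynomial.Chebyshev.U ℝ ((i : ℕ) - 1) := by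
      rcases Nat.eq_zero_or_pos (i : ℕ) with h | h
      · simp [h]
      · obtain ⟨k, hk⟩ : ∃ k, (i : ℕ) = k + 1 := ⟨i - 1, by omega⟩
        rw [hk, weightPoly_zero, ← C_eq_natCast, ← mul_assoc, ← C_mul]
        have hk1 : (k : ℝ) + 1 ≠ 0 := by positivity
        rw [Nat.add_sub_cancel]
        push_cast
        rw [mul_div_cancel₀ _ hk1, add_sub_cancel_right]
    have hi1 : (C (((N : ℝ) + 1) / ((i : ℕ) + 1)) : ℝ[X]) * ((i : ℕ) + 1) = C ((N : ℝ) + 1) := by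
      have hk1 : ((i : ℕ) : ℝ) + 1 ≠ 0 := by positivity
      rw [show ((i : ℕ) : ℝ[X]) + 1 = C (((i : ℕ) : ℝ) + 1) by simp, ← C_mul,
        div_mul_cancel₀ _ hk1]
    have hW := weightPoly_zero N i
    have hdW : derivative (weightPoly N i 0)
        = C (((N : ℝ) + 1) / ((i : ℕ) + 1)) * derivative (Polynomial.Chebyshev.U ℝ (i : ℕ)) := by
      rw [hW, derivative_C_mul]
    simp only [Fin.val_zero, Nat.cast_zero, smul_eq_mul, Matrix.zero_apply] at hsk ⊢
    push_cast at hc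
    rw [hdW]
    rw [hW] at hsk ⊢
    linear_combination -hsk - 2 * hlow + 2 * C (((N : ℝ) + 1) / ((i : ℕ) + 1)) * hc
      + 2 * Polynomial.Chebyshev.U ℝ ((i : ℕ) - 1) * hi1

end WeightMatrix

/-! ### Divisibility of TV and KV - VKᵗ by 1 - x². -/

section Divisibility

open Polynomial

theorem weightMat_mul_skewMat_transpose (N : ℕ) :
    weightMat N * (skewMat N (X : ℝ[X])).transpose = -(skewMat N (X : ℝ[X]) * weightMat N) :=
  (neg_eq_of_add_eq_zero_right (skewMat_mul_weightMat_add N)).symm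

/-- This is the symmetry of [T, F]V, with `skewMat_mul_symMat` inserted and VTᵗ replaced by -TV. -/
theorem pearsonMat_mul_skewMat_mul_weightMat (N : ℕ) :
    pearsonMat N (X : ℝ[X]) * (skewMat N (X : ℝ[X]) * weightMat N)
        + (4 * X : ℝ[X]) • (skewMat N (X : ℝ[X]) * weightMat N)
      = weightMat N * ((skewMat N (X : ℝ[X])).transpose * (pearsonMat N (X : ℝ[X])).transpose)
        + (((N : ℝ[X]) + 2) * (1 - X ^ 2)) •
          (cartanMat N ℝ[X] * weightMat N - weightMat N * cartanMat N ℝ[X]) := by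
  have hcomm := skewMat_mul_symMat N (X : ℝ[X])
  have hcommT := congrArg Matrix.transpose hcomm
  simp only [Matrix.transpose_mul, Matrix.transpose_add, Matrix.transpose_sub,
    Matrix.transpose_smul, cartanMat_transpose] at hcommT
  have hF := symMat_mul_weightMat N
  have hT := weightMat_mul_skewMat_transpose N
  have h1 := congrArg (· * weightMat N) hcomm
  have h2 := congrArg (weightMat N * ·) hcommT
  have e : (skewMat N (X : ℝ[X]) * symMat N (X : ℝ[X])
        - symMat N (X : ℝ[X]) * skewMat N (X : ℝ[X])) * weightMat N
      = weightMat N * ((symMat N (X : ℝ[X])).transpose * (skewMat N (X : ℝ[X])).transpose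
        - (skewMat N (X : ℝ[X])).transpose * (symMat N (X : ℝ[X])).transpose) := by
    have h3 : skewMat N (X : ℝ[X]) * (symMat N (X : ℝ[X]) * weightMat N)
        = -(weightMat N * ((skewMat N (X : ℝ[X])).transpose * (symMat N (X : ℝ[X])).transpose)) := by
      rw [hF, ← mul_assoc, ← mul_assoc, hT, neg_mul, neg_neg]
    have h4 : symMat N (X : ℝ[X]) * (skewMat N (X : ℝ[X]) * weightMat N)
        = -(weightMat N * ((symMat N (X : ℝ[X])).transpose * (skewMat N (X : ℝ[X])).transpose)) := by
      rw [← mul_assoc (weightMat N), ← hF, mul_assoc, hT, mul_neg, neg_neg]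
    rw [sub_mul, mul_assoc, mul_assoc, h3, h4, mul_sub]
    abel
  rw [h1, h2] at e
  simp only [Matrix.smul_mul, Matrix.mul_smul, sub_mul, add_mul, mul_sub, mul_add, hT,
    mul_assoc] at e
  have h20 : (2 : ℝ[X]) ≠ 0 := two_ne_zero
  have e' := smul_right_injective (Matrix (Fin (N + 1)) (Fin (N + 1)) ℝ[X]) h20 e
  rw [← sub_eq_zero] at e' ⊢
  rw [← e']
  module

/-- In 2(1 - x²)(TV)' one uses T' = -h and the Pearson equation, commutes T past K, and removes KTV
by the preceding identity. -/
theorem derivMat_skewMat_mul_weightMat (N : ℕ) :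
    (2 : ℝ[X]) • ((1 - X ^ 2 : ℝ[X]) • derivMat (skewMat N (X : ℝ[X]) * weightMat N)
      - (X : ℝ[X]) • (skewMat N (X : ℝ[X]) * weightMat N))
      = -((((N : ℝ[X]) + 2) * (1 - X ^ 2)) •
          (cartanMat N ℝ[X] * weightMat N - weightMat N * cartanMat N ℝ[X])) := by
  have hG := pearsonMat_mul_skewMat_mul_weightMat N
  have hV := congrArg (skewMat N (X : ℝ[X]) * ·) (two_mul_derivMat_weightMat N)
  have hT := weightMat_mul_skewMat_transpose N
  have hcomm := congrArg (· * weightMat N) (skewMat_mul_pearsonMat N (X : ℝ[X]))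
  simp only [sub_mul, add_mul, Matrix.smul_mul, mul_assoc] at hcomm
  simp only [mul_add, Matrix.mul_smul, mul_zero] at hV
  rw [hcomm, ← mul_assoc (skewMat N (X : ℝ[X])) (weightMat N) _, ← neg_neg (skewMat N (X : ℝ[X]) * weightMat N),
    ← hT, neg_mul, mul_assoc] at hV
  rw [derivMat_mul, derivMat_skewMat, neg_mul]
  simp only [hT, neg_neg] at hV
  rw [← sub_eq_zero] at hG ⊢
  rw [← sub_zero (0 : Matrix (Fin (N + 1)) (Fin (N + 1)) ℝ[X])]
  nth_rewrite 1 [← hV]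
  nth_rewrite 1 [← hG]
  module

/-- The equation shows that 1 - x² divides Xf, and it is coprime to X. Differentiating (1 - x²)s
then changes the coefficient -x into -3x. -/
theorem one_sub_X_sq_dvd {f g : ℝ[X]} (h : (1 - X ^ 2) * derivative f - X * f = (1 - X ^ 2) * g) :
    ∃ s : ℝ[X], f = (1 - X ^ 2) * s ∧ (1 - X ^ 2) * derivative s - 3 * X * s = g := by
  have hcop : IsCoprime (1 - X ^ 2 : ℝ[X]) X := ⟨1, X, by ring⟩
  obtain ⟨s, rfl⟩ : (1 - X ^ 2 : ℝ[X]) ∣ f := by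
    refine hcop.dvd_of_dvd_mul_left ⟨derivative f - g, ?_⟩
    linear_combination -h
  refine ⟨s, rfl, ?_⟩
  have h0 : (1 - X ^ 2 : ℝ[X]) ≠ 0 := by
    intro h0
    have := congrArg (eval 0) h0
    simp at this
  refine mul_left_cancel₀ h0 ?_
  rw [← h, derivative_mul]
  simp only [derivative_sub, derivative_one, derivative_X_pow]
  simp only [Nat.cast_ofNat, map_ofNat]
  ring

theorem exists_skewMat_mul_weightMat_eq (N : ℕ) :
    ∃ S : Matrix (Fin (N + 1)) (Fin (N + 1)) ℝ[X],
      skewMat N (X : ℝ[X]) * weightMat N = (1 - X ^ 2 : ℝ[X]) • S ∧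
      (1 - X ^ 2 : ℝ[X]) • derivMat S - (3 * X : ℝ[X]) • S
        = (-C (((N : ℝ) + 2) / 2)) •
          (cartanMat N ℝ[X] * weightMat N - weightMat N * cartanMat N ℝ[X]) := by
  have hE : ∀ i j, ∃ s : ℝ[X], (skewMat N (X : ℝ[X]) * weightMat N) i j = (1 - X ^ 2) * s ∧
      (1 - X ^ 2) * derivative s - 3 * X * s = ((-C (((N : ℝ) + 2) / 2)) •
          (cartanMat N ℝ[X] * weightMat N - weightMat N * cartanMat N ℝ[X])) i j := by
    intro i j
    refine one_sub_X_sq_dvd ?_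
    have h := congrFun (congrFun (derivMat_skewMat_mul_weightMat N) i) j
    have h20 : (2 : ℝ[X]) ≠ 0 := two_ne_zero
    refine mul_left_cancel₀ h20 ?_
    have hC : (2 : ℝ[X]) * C (((N : ℝ) + 2) / 2) = N + 2 := by
      rw [show (2 : ℝ[X]) = C (2 : ℝ) from (map_ofNat C 2).symm, ← C_mul, mul_div_cancel₀ _ (two_ne_zero)]
      simp [map_ofNat]
    simp only [Matrix.smul_apply, Matrix.neg_apply, Matrix.sub_apply (_ • derivMat _),
      smul_eq_mul, derivMat_apply] at h ⊢
    rw [h]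
    linear_combination ((1 - X ^ 2) * (cartanMat N ℝ[X] * weightMat N
      - weightMat N * cartanMat N ℝ[X]) i j) * hC
  choose s hs1 hs2 using hE
  refine ⟨Matrix.of s, ?_, ?_⟩
  · ext1 i j
    exact hs1 i j
  · ext1 i j
    exact hs2 i j

/-- Expanding FV = VFᵗ gives (N + 2)(KV - VKᵗ) = -(hTV + TVh), so divisibility is inherited from TV;
and h[h, V] + [h, V]h = h²V - Vh². -/
theorem exists_pearsonMat_mul_weightMat_eq (N : ℕ) :
    ∃ S : Matrix (Fin (N + 1)) (Fin (N + 1)) ℝ[X],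
      pearsonMat N (X : ℝ[X]) * weightMat N - weightMat N * (pearsonMat N (X : ℝ[X])).transpose
        = (1 - X ^ 2 : ℝ[X]) • S ∧
      (1 - X ^ 2 : ℝ[X]) • derivMat S - (3 * X : ℝ[X]) • S
        = C (1 / 2 : ℝ) • (cartanMat N ℝ[X] * cartanMat N ℝ[X] * weightMat N
          - weightMat N * (cartanMat N ℝ[X] * cartanMat N ℝ[X])) := by
  obtain ⟨S, hS1, hS2⟩ := exists_skewMat_mul_weightMat_eq N
  have hN : (N : ℝ) + 2 ≠ 0 := by positivity
  have hc : ((N : ℝ[X]) + 2) * C (1 / ((N : ℝ) + 2)) = 1 := by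
    rw [show (N : ℝ[X]) + 2 = C ((N : ℝ) + 2) by simp [map_ofNat], ← C_mul, mul_one_div_cancel hN, C_1]
  have hc' : C (1 / ((N : ℝ) + 2)) * C (((N : ℝ) + 2) / 2) = C (1 / 2 : ℝ) := by
    rw [← C_mul]
    congr 1
    field_simp
  have hT := weightMat_mul_skewMat_transpose N
  refine ⟨(-C (1 / ((N : ℝ) + 2))) • (cartanMat N ℝ[X] * S + S * cartanMat N ℝ[X]), ?_, ?_⟩
  · have hN' : (N : ℝ[X]) + 2 ≠ 0 := by
      intro h0
      rw [h0, zero_mul] at hc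
      exact zero_ne_one hc
    refine smul_right_injective (Matrix (Fin (N + 1)) (Fin (N + 1)) ℝ[X]) hN' ?_
    have hF := symMat_mul_weightMat N
    simp only [symMat, Matrix.transpose_sub, Matrix.transpose_mul, cartanMat_transpose,
      Matrix.transpose_smul, sub_mul, mul_sub, ← mul_assoc (weightMat N), hT] at hF
    rw [mul_assoc, hS1] at hF
    simp only [pearsonMat, Matrix.transpose_sub, Matrix.transpose_smul, Matrix.transpose_one,
      Matrix.transpose_add, sub_mul, mul_sub, Matrix.smul_mul, Matrix.mul_smul, mul_one, one_mul,
      smul_sub, add_mul, mul_add, smul_add, neg_mul] at hF ⊢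
    have e : ∀ M : Matrix (Fin (N + 1)) (Fin (N + 1)) ℝ[X],
        ((N : ℝ[X]) + 2) • (1 - X ^ 2 : ℝ[X]) • (-C (1 / ((N : ℝ) + 2))) • M
          = -((1 - X ^ 2 : ℝ[X]) • M) := by
      intro M
      rw [smul_smul, smul_smul, ← neg_smul]
      congr 1
      linear_combination (-(1 - X ^ 2 : ℝ[X])) * hc
    rw [e, e]
    rw [← sub_eq_zero] at hF ⊢
    rw [← hF]
    module
  · have h1 : derivMat (C (1 / ((N : ℝ) + 2)) • (cartanMat N ℝ[X] * S + S * cartanMat N ℝ[X]))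
        = C (1 / ((N : ℝ) + 2)) •
          (cartanMat N ℝ[X] * derivMat S + derivMat S * cartanMat N ℝ[X]) := by
      rw [derivMat_smul, derivMat_add, derivMat_mul, derivMat_mul, derivMat_cartanMat]
      simp
    have h1' : derivMat ((-C (1 / ((N : ℝ) + 2))) • (cartanMat N ℝ[X] * S + S * cartanMat N ℝ[X]))
        = (-C (1 / ((N : ℝ) + 2))) •
          (cartanMat N ℝ[X] * derivMat S + derivMat S * cartanMat N ℝ[X]) := by
      rw [← C_neg, derivMat_smul, derivMat_add, derivMat_mul, derivMat_mul, derivMat_cartanMat]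
      simp
    have h2 := congrArg (cartanMat N ℝ[X] * ·) hS2
    have h3 := congrArg (· * cartanMat N ℝ[X]) hS2
    simp only [mul_sub, sub_mul, Matrix.mul_smul, Matrix.smul_mul, ← mul_assoc] at h2 h3
    have h4 : (1 - X ^ 2 : ℝ[X]) • (cartanMat N ℝ[X] * derivMat S + derivMat S * cartanMat N ℝ[X])
        - (3 * X : ℝ[X]) • (cartanMat N ℝ[X] * S + S * cartanMat N ℝ[X])
        = (-C (((N : ℝ) + 2) / 2)) • (cartanMat N ℝ[X] * cartanMat N ℝ[X] * weightMat N
          - weightMat N * (cartanMat N ℝ[X] * cartanMat N ℝ[X])) := by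
      have := congrArg₂ (· + ·) h2 h3
      rw [← sub_eq_zero] at this ⊢
      rw [← this, ← mul_assoc]
      module
    rw [h1', ← hc', smul_comm (1 - X ^ 2 : ℝ[X]), smul_comm (3 * X : ℝ[X]), ← smul_sub, h4,
      smul_smul]
    congr 1
    ring

end Divisibility

/-! ### The factorization V = ΦΦ* on the open interval. -/

section Factorization

open Polynomial

theorem skewMat_map {R S : Type*} [CommRing R] [CommRing S] (f : R →+* S) (N : ℕ) (x : R) :
    (skewMat N x).map f = skewMat N (f x) := by
  ext1 i j
  simp only [skewMat, Matrix.map_apply, Matrix.sub_apply, Matrix.smul_apply, raiseMat, lowerMat,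
    cartanMat, Matrix.of_apply, Matrix.diagonal_apply, smul_eq_mul, map_sub, map_mul]
  congr 1
  · congr 1 <;> split_ifs <;> simp
  · split_ifs <;> simp [map_ofNat]

/-- The polynomial `(q + r z)^a (r + q z)^b`. -/
noncomputable def binomProd (q r : ℂ) (a b : ℕ) : ℂ[X] :=
  (C q + C r * X) ^ a * (C r + C q * X) ^ b

theorem natDegree_binomProd_le (q r : ℂ) (a b : ℕ) : (binomProd q r a b).natDegree ≤ a + b := by
  have h1 : ∀ u v : ℂ, (C u + C v * X : ℂ[X]).natDegree ≤ 1 := fun u v => by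
    rw [add_comm]
    exact natDegree_linear_le
  refine natDegree_mul_le.trans (add_le_add ?_ ?_)
  · exact (natDegree_pow_le_of_le a (h1 q r)).trans (by omega)
  · exact (natDegree_pow_le_of_le b (h1 r q)).trans (by omega)

/-- T acts on the products (q + rz)^(N-k) (r + qz)^k as a multiple of the Euler operator 2z d/dz -
N, which is diagonal on monomials. Hence the coefficients in z diagonalize T. -/
theorem binomProd_contiguity {q r : ℂ} (hqr : q * r = 1) (a b : ℕ) :
    (a : ℂ[X]) * binomProd q r (a - 1) (b + 1) - (b : ℂ[X]) * binomProd q r (a + 1) (b - 1)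
      - C ((q ^ 2 + r ^ 2) / 2) * (((a : ℂ[X]) - (b : ℂ[X])) * binomProd q r a b)
      = C ((q ^ 2 - r ^ 2) / 2) * (2 * (X : ℂ[X]) * derivative (binomProd q r a b)
        - ((a : ℂ[X]) + (b : ℂ[X])) * binomProd q r a b) := by
  have hqr' : (C q : ℂ[X]) * C r = 1 := by rw [← C_mul, hqr, C_1]
  have h2 : (C (1 / 2 : ℂ) : ℂ[X]) * 2 = 1 := by
    rw [← map_ofNat C 2, ← C_mul]
    norm_num
  rw [div_eq_mul_one_div (q ^ 2 + r ^ 2), div_eq_mul_one_div (q ^ 2 - r ^ 2)]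
  simp only [C_mul, C_add, C_sub, C_pow]
  generalize (C (1 / 2 : ℂ) : ℂ[X]) = t at *
  simp only [binomProd, derivative_mul, derivative_pow, derivative_add, derivative_C, zero_add,
    derivative_X, C_eq_natCast, zero_mul, mul_one]
  generalize (C q : ℂ[X]) = Q at *
  generalize (C r : ℂ[X]) = S at *
  set A := Q + S * X with hA
  set B := S + Q * X with hB
  have e1 : B - S ^ 2 * A - (Q ^ 2 - S ^ 2) * S * X = 0 := by
    rw [hA, hB]
    linear_combination (-S - Q * X) * hqr'
  have e2 : Q ^ 2 * B - A - (Q ^ 2 - S ^ 2) * Q * X = 0 := by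
    rw [hA, hB]
    linear_combination (Q + S * X) * hqr'
  have ha : (a : ℂ[X]) * A ^ a = a * A ^ (a - 1) * A := by
    rcases a with _ | a
    · simp
    · rw [Nat.add_sub_cancel, pow_succ, mul_assoc]
  have hb : (b : ℂ[X]) * B ^ b = b * B ^ (b - 1) * B := by
    rcases b with _ | b
    · simp
    · rw [Nat.add_sub_cancel, pow_succ, mul_assoc]
  rw [pow_succ A a, pow_succ B b]
  linear_combination a * A ^ (a - 1) * B ^ b * e1 + b * A ^ a * B ^ (b - 1) * e2
    + (t * (-(Q ^ 2 + S ^ 2) + (Q ^ 2 - S ^ 2)) * B ^ b) * ha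
    + (t * ((Q ^ 2 + S ^ 2) + (Q ^ 2 - S ^ 2)) * A ^ a) * hb
    + (-S ^ 2 * a * A ^ (a - 1) * A * B ^ b + Q ^ 2 * b * A ^ a * B ^ (b - 1) * B
      - (Q ^ 2 - S ^ 2) * X * (a * A ^ (a - 1) * S * B ^ b + A ^ a * (b * B ^ (b - 1) * Q))) * h2

theorem coeff_X_mul_derivative' (p : ℂ[X]) (j : ℕ) : (X * derivative p).coeff j = j * p.coeff j := by
  rcases j with _ | j
  · simp
  · rw [coeff_X_mul, coeff_derivative]
    push_cast
    ring

/-- The matrix of normalized coefficients of `(q + r z)^(N - k) (r + q z)^k`. -/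
noncomputable def krawtchoukMat (N : ℕ) (q r : ℂ) : Mat N :=
  Matrix.of fun k j : Fin (N + 1) => (binomProd q r (N - k) k).coeff j / (N.choose j : ℂ)

theorem skewMat_mul_krawtchoukMat (N : ℕ) {q r : ℂ} (hqr : q * r = 1) :
    skewMat N ((q ^ 2 + r ^ 2) / 2) * krawtchoukMat N q r
      = (-(q ^ 2 - r ^ 2) / 2) • (krawtchoukMat N q r * cartanMat N ℂ) := by
  ext1 k j
  rw [krawtchoukMat, skewMat_mul_apply N _
    (fun k j => (binomProd q r (N - k) k).coeff j / (N.choose j : ℂ)), Matrix.smul_apply,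
    mul_cartanMat_apply, Matrix.of_apply, smul_eq_mul]
  have h := congrArg (fun p => coeff p j) (binomProd_contiguity hqr (N - k) k)
  have hk : (k : ℕ) ≤ N := by omega
  have h1 : N - (k : ℕ) - 1 = N - (k + 1) := by omega
  have h2 : ((k : ℕ) : ℂ[X]) * binomProd q r (N - k + 1) (k - 1)
      = (k : ℕ) * binomProd q r (N - (k - 1)) (k - 1) := by
    rcases Nat.eq_zero_or_pos (k : ℕ) with h | h
    · simp [h]
    · rw [show N - (k : ℕ) + 1 = N - (k - 1) by omega]
  rw [h1, h2, mul_assoc (2 : ℂ[X]) X] at h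
  simp only [← C_eq_natCast, ← map_ofNat C 2, ← C_sub, ← C_add, coeff_sub, coeff_C_mul,
    coeff_X_mul_derivative'] at h
  push_cast [Nat.cast_sub hk] at h
  linear_combination h / (N.choose j : ℂ)

/-- A vanishing combination of the products (q + rz)^(N-k) (r + qz)^k becomes, after dividing by (q
+ rz)^N, a polynomial in w = (r + qz)/(q + rz) with the same coefficients and infinitely many roots.
-/
theorem eq_zero_of_vecMul_krawtchoukMat (N : ℕ) {q r : ℂ} (hqr : q * r = 1) (hs : q ^ 2 ≠ r ^ 2)
    (c : Fin (N + 1) → ℂ) (hc : Matrix.vecMul c (krawtchoukMat N q r) = 0) : c = 0 := by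
  have h0 : ∑ k : Fin (N + 1), C (c k) * binomProd q r (N - k) k = 0 := by
    ext j
    rw [finsetSum_coeff, coeff_zero]
    simp only [coeff_C_mul]
    rcases Nat.lt_or_ge j (N + 1) with hj | hj
    · have h := congrFun hc ⟨j, hj⟩
      simp only [Matrix.vecMul, dotProduct, krawtchoukMat, Matrix.of_apply, Pi.zero_apply,
        ← mul_div_assoc] at h
      rw [← Finset.sum_div, div_eq_zero_iff] at h
      refine h.resolve_right ?_
      exact_mod_cast (Nat.choose_pos (show j ≤ N by omega)).ne'
    · refine Finset.sum_eq_zero fun k _ => ?_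
      rw [coeff_eq_zero_of_natDegree_lt, mul_zero]
      have := natDegree_binomProd_le q r (N - k) k
      omega
  have hr : r ≠ 0 := right_ne_zero_of_mul_eq_one hqr
  have hp : ∑ k : Fin (N + 1), C (c k) * (X : ℂ[X]) ^ (k : ℕ) = 0 := by
    refine eq_zero_of_infinite_isRoot _ ?_
    refine Set.Infinite.mono (s := {q / r}ᶜ) ?_ (Set.finite_singleton _).infinite_compl
    intro w hw
    have hD : q - w * r ≠ 0 := by
      intro h
      apply hw
      rw [Set.mem_singleton_iff, eq_div_iff hr]
      linear_combination -h
    -- This is the z with (r + qz)/(q + rz) = w; the excluded value w = q/r would make its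
    -- denominator zero.
    have h := congrArg (eval ((w * q - r) / (q - w * r))) h0
    have hA : q + r * ((w * q - r) / (q - w * r)) = (q ^ 2 - r ^ 2) / (q - w * r) := by
      rw [eq_div_iff hD, add_mul, mul_assoc r, div_mul_cancel₀ _ hD]
      ring
    have hB : r + q * ((w * q - r) / (q - w * r)) = w * ((q ^ 2 - r ^ 2) / (q - w * r)) := by
      rw [← mul_div_assoc w, eq_div_iff hD, add_mul, mul_assoc q, div_mul_cancel₀ _ hD]
      ring
    have hA0 : (q ^ 2 - r ^ 2) / (q - w * r) ≠ 0 := div_ne_zero (sub_ne_zero.mpr hs) hD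
    simp only [binomProd, eval_finsetSum, eval_mul, eval_pow, eval_add, eval_C, eval_X, hA, hB,
      eval_zero] at h
    have h' : ((q ^ 2 - r ^ 2) / (q - w * r)) ^ N * ∑ k : Fin (N + 1), c k * w ^ (k : ℕ) = 0 := by
      rw [← h, Finset.mul_sum]
      refine Finset.sum_congr rfl fun k _ => ?_
      have hk : (k : ℕ) ≤ N := by omega
      rw [mul_pow]
      nth_rewrite 1 [← Nat.sub_add_cancel hk]
      rw [pow_add]
      ring
    simp only [Set.mem_ofPred_eq, IsRoot.def, eval_finsetSum, eval_mul, eval_C, eval_pow, eval_X]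
    exact (mul_eq_zero.mp h').resolve_left (pow_ne_zero _ hA0)
  ext k
  have h := congrArg (fun p => coeff p k) hp
  simp only [finsetSum_coeff, coeff_C_mul, coeff_X_pow, coeff_zero] at h
  rw [Finset.sum_eq_single k] at h
  · simpa using h
  · intro b _ hb
    rw [if_neg, mul_zero]
    exact fun e => hb (Fin.ext e.symm)
  · simp

theorem factorial_mul_prod_add (j k : ℕ) :
    (j.factorial : ℂ) * ∏ i ∈ Finset.range k, ((j : ℂ) + 1 + i) = ((j + k).factorial : ℂ) := by
  induction k with
  | zero => simp
  | succ k ih =>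
    rw [Finset.prod_range_succ, ← mul_assoc, ih, ← add_assoc, Nat.factorial_succ]
    push_cast
    ring

theorem integral_pow_mul_one_sub_pow (j k : ℕ) :
    ((j + k : ℕ) + 1 : ℂ) * ∫ y : ℝ in (0 : ℝ)..1, (y : ℂ) ^ j * (1 - (y : ℂ)) ^ k
      = 1 / ((j + k).choose j : ℂ) := by
  have h := Complex.betaIntegral_eval_nat_add_one_right (u := (j : ℂ) + 1)
    (by simp; positivity) k
  have e : Complex.betaIntegral ((j : ℂ) + 1) (k + 1)
      = ∫ y : ℝ in (0 : ℝ)..1, (y : ℂ) ^ j * (1 - (y : ℂ)) ^ k := by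
    rw [Complex.betaIntegral]
    simp only [add_sub_cancel_right, Complex.cpow_natCast]
  rw [← e, h]
  have h1 := factorial_mul_prod_add j (k + 1)
  have h2 : ((j + k).choose j : ℂ) * (j.factorial * k.factorial) = (j + k).factorial := by
    have h := Nat.choose_mul_factorial_mul_factorial (Nat.le_add_right j k)
    rw [Nat.add_sub_cancel_left] at h
    rw [← mul_assoc]
    exact_mod_cast h
  rw [← add_assoc, Nat.factorial_succ] at h1
  have hj : (j.factorial : ℂ) ≠ 0 := by exact_mod_cast j.factorial_ne_zero
  have hjk : ((j + k).factorial : ℂ) ≠ 0 := by exact_mod_cast (j + k).factorial_ne_zero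
  have hc : ((j + k).choose j : ℂ) ≠ 0 := by
    exact_mod_cast (Nat.choose_pos (Nat.le_add_right j k)).ne'
  have hjk1 : ((j + k : ℕ) : ℂ) + 1 ≠ 0 := by exact_mod_cast (j + k).succ_ne_zero
  have hP : ∏ i ∈ Finset.range (k + 1), ((j : ℂ) + 1 + i) ≠ 0 := by
    intro h0
    rw [h0, mul_zero] at h1
    push_cast at h1
    push_cast at hjk1
    exact mul_ne_zero hjk1 hjk h1.symm
  rw [← mul_div_assoc, div_eq_div_iff hP hc]
  refine mul_left_cancel₀ hj ?_
  push_cast at *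
  linear_combination ((j : ℂ) + k + 1) * h2 - h1

theorem integral_linear_pow {a s : ℂ} (hs : s ≠ 0) (n : ℕ) :
    ∫ y : ℝ in (0 : ℝ)..1, (a + s * (y : ℂ)) ^ n
      = ((a + s) ^ (n + 1) - a ^ (n + 1)) / (s * (n + 1)) := by
  have hn : (n : ℂ) + 1 ≠ 0 := by exact_mod_cast n.succ_ne_zero
  have hd : ∀ y : ℝ, HasDerivAt (fun y : ℝ => (a + s * (y : ℂ)) ^ (n + 1) / (s * (n + 1)))
      ((a + s * (y : ℂ)) ^ n) y := by
    intro y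
    have h1 : HasDerivAt (fun y : ℝ => (y : ℂ)) 1 y := Complex.ofRealCLM.hasDerivAt
    have h2 := (((h1.const_mul s).const_add a).fun_pow (n + 1)).div_const (s * (n + 1))
    refine h2.congr_deriv ?_
    rw [Nat.add_sub_cancel]
    push_cast
    field_simp
  rw [intervalIntegral.integral_eq_sub_of_hasDerivAt (fun y _ => hd y)]
  · push_cast
    simp only [mul_one, mul_zero, add_zero]
    ring
  · refine Continuous.intervalIntegrable ?_ _ _
    fun_prop

/-- The Beta integral replaces 1/C(N, j) by (N + 1)∫ y^j (1 - y)^(N-j), so the sum becomes the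
integral of a homogenized product. Its first factor is qr(1 - y) + rqy = 1 and its second is r² +
(q² - r²)y. -/
theorem sum_binomProd_coeff {N n : ℕ} (hn : n ≤ N) {q r : ℂ} (hqr : q * r = 1)
    (hs : q ^ 2 ≠ r ^ 2) :
    ∑ j ∈ Finset.range (N + 1), (binomProd q r (N - n) n).coeff j / (N.choose j : ℂ)
        * (q ^ j * r ^ (N - j))
      = (N + 1) * (((q ^ 2) ^ (n + 1) - (r ^ 2) ^ (n + 1)) / ((q ^ 2 - r ^ 2) * (n + 1))) := by
  have hr : r ≠ 0 := right_ne_zero_of_mul_eq_one hqr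
  have h1 : ∀ j ∈ Finset.range (N + 1), (binomProd q r (N - n) n).coeff j / (N.choose j : ℂ)
      * (q ^ j * r ^ (N - j)) = ((N : ℂ) + 1) * ∫ y : ℝ in (0 : ℝ)..1,
        (binomProd q r (N - n) n).coeff j * (q ^ j * r ^ (N - j))
          * ((y : ℂ) ^ j * (1 - (y : ℂ)) ^ (N - j)) := by
    intro j hj
    have hjN : j ≤ N := by
      rw [Finset.mem_range] at hj
      omega
    have h := integral_pow_mul_one_sub_pow j (N - j)
    rw [Nat.add_sub_cancel' hjN] at h
    rw [intervalIntegral.integral_const_mul]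
    linear_combination (-(binomProd q r (N - n) n).coeff j * (q ^ j * r ^ (N - j))) * h
  rw [Finset.sum_congr rfl h1, ← Finset.mul_sum, ← intervalIntegral.integral_finsetSum]
  · congr 1
    have h2 : ∫ y : ℝ in (0 : ℝ)..1, ∑ j ∈ Finset.range (N + 1),
        (binomProd q r (N - n) n).coeff j * (q ^ j * r ^ (N - j))
          * ((y : ℂ) ^ j * (1 - (y : ℂ)) ^ (N - j))
        = ∫ y : ℝ in (0 : ℝ)..1, (r ^ 2 + (q ^ 2 - r ^ 2) * (y : ℂ)) ^ n := by
      refine intervalIntegral.integral_congr_ae ?_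
      -- Dehomogenizing divides by r(1 - y), hence the endpoint is discarded.
      have hae : ∀ᵐ y : ℝ, y ≠ 1 := by simp [MeasureTheory.ae_iff]
      filter_upwards [hae] with y hy _
      have hY : r * (1 - (y : ℂ)) ≠ 0 := by
        refine mul_ne_zero hr (sub_ne_zero.mpr ?_)
        exact_mod_cast hy.symm
      have hev := eval_eq_sum_range' (p := binomProd q r (N - n) n) (n := N + 1)
        (by have := natDegree_binomProd_le q r (N - n) n; omega) (q * y / (r * (1 - (y : ℂ))))
      have hA : q + r * (q * y / (r * (1 - (y : ℂ)))) = 1 / (r * (1 - (y : ℂ))) := by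
        rw [eq_div_iff hY, add_mul, mul_assoc r, div_mul_cancel₀ _ hY]
        linear_combination hqr
      have hB : r + q * (q * y / (r * (1 - (y : ℂ))))
          = (r ^ 2 + (q ^ 2 - r ^ 2) * (y : ℂ)) / (r * (1 - (y : ℂ))) := by
        rw [eq_div_iff hY, add_mul, mul_assoc q, div_mul_cancel₀ _ hY]
        ring
      have h3 : (r * (1 - (y : ℂ))) ^ N
          * eval (q * y / (r * (1 - (y : ℂ)))) (binomProd q r (N - n) n)
          = (r ^ 2 + (q ^ 2 - r ^ 2) * (y : ℂ)) ^ n := by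
        simp only [binomProd, eval_mul, eval_pow, eval_add, eval_C, eval_X, hA, hB]
        rw [← Nat.sub_add_cancel hn, pow_add, Nat.sub_add_cancel hn, div_pow, div_pow, one_pow]
        field_simp
      rw [← h3, hev, Finset.mul_sum]
      refine Finset.sum_congr rfl fun j hj => ?_
      have hjN : j ≤ N := by
        rw [Finset.mem_range] at hj
        omega
      rw [← Nat.sub_add_cancel hjN, pow_add (r * (1 - (y : ℂ))), Nat.sub_add_cancel hjN, div_pow]
      have e : (binomProd q r (N - n) n).coeff j * (q ^ j * r ^ (N - j))
          * ((y : ℂ) ^ j * (1 - (y : ℂ)) ^ (N - j))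
          = (binomProd q r (N - n) n).coeff j * (q * y) ^ j * (r * (1 - (y : ℂ))) ^ (N - j) := by
        rw [mul_pow, mul_pow]
        ring
      rw [e]
      generalize r * (1 - (y : ℂ)) = Y at *
      field_simp
    rw [h2, integral_linear_pow (sub_ne_zero.mpr hs)]
    congr 2
    ring
  · intro j _
    refine Continuous.intervalIntegrable ?_ _ _
    fun_prop

open Matrix in
theorem skewMat_ofReal_conjTranspose (N : ℕ) (x : ℝ) :
    (skewMat N (x : ℂ))ᴴ = (skewMat N (x : ℂ))ᵀ := by
  have h := skewMat_map (algebraMap ℝ ℂ) N x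
  rw [show (x : ℂ) = algebraMap ℝ ℂ x from rfl, ← h]
  ext1 i j
  simp [Matrix.conjTranspose_apply]

open Matrix in
-- TΦ = cΦh with c purely imaginary, since q and r are conjugate; the two terms are therefore cΦhΦ*
-- and its negative.
theorem krawtchoukMat_mul_conjTranspose_skew (N : ℕ) {q r : ℂ} {x : ℝ} (hqr : q * r = 1)
    (hq : star q = r) (hx : (q ^ 2 + r ^ 2) / 2 = x) :
    skewMat N (x : ℂ) * (krawtchoukMat N q r * (krawtchoukMat N q r)ᴴ)
      + krawtchoukMat N q r * (krawtchoukMat N q r)ᴴ * (skewMat N (x : ℂ))ᵀ = 0 := by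
  have h := skewMat_mul_krawtchoukMat N hqr
  rw [hx] at h
  have hr : star r = q := by rw [← hq, star_star]
  have hh : (cartanMat N ℂ)ᴴ = cartanMat N ℂ := by
    ext1 i j
    simp only [cartanMat, Matrix.conjTranspose_apply, Matrix.diagonal_apply]
    by_cases hij : i = j
    · subst hij
      simp
    · rw [if_neg hij, if_neg (Ne.symm hij), star_zero]
  have h' := congrArg Matrix.conjTranspose h
  rw [Matrix.conjTranspose_mul, Matrix.conjTranspose_smul, Matrix.conjTranspose_mul, hh,
    skewMat_ofReal_conjTranspose] at h'
  have hstar : star (-(q ^ 2 - r ^ 2) / 2) = -(-(q ^ 2 - r ^ 2) / 2) := by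
    simp only [star_div₀, star_neg, star_sub, star_pow, hq, hr, star_ofNat]
    ring
  rw [← mul_assoc, h, mul_assoc (krawtchoukMat N q r), h', hstar]
  simp only [Matrix.smul_mul, Matrix.mul_smul, mul_assoc]
  module

open Matrix in
/-- On the open interval the polynomial part of the weight is `Φ Φ*` with `Φ` invertible. -/
theorem exists_weightMat_eval_eq (N : ℕ) {x : ℝ} (hx1 : -1 < x) (hx2 : x < 1) :
    ∃ Φ : Mat N, (weightMat N).map (fun p => ((p.eval x : ℝ) : ℂ)) = Φ * Φᴴ ∧
      ∀ c, Matrix.vecMul c Φ = 0 → c = 0 := by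
  set θ : ℝ := Real.arccos x with hθ
  have hcos : Real.cos θ = x := Real.cos_arccos hx1.le hx2.le
  have hsin : Real.sin θ ≠ 0 := by
    rw [hθ, Real.sin_arccos]
    exact (Real.sqrt_pos.mpr (by nlinarith)).ne'
  set q : ℂ := Complex.exp (((θ / 2 : ℝ) : ℂ) * Complex.I) with hq
  set r : ℂ := Complex.exp (-(((θ / 2 : ℝ) : ℂ) * Complex.I)) with hr
  have hqr : q * r = 1 := by rw [hq, hr, ← Complex.exp_add, add_neg_cancel, Complex.exp_zero]
  have hstar : star q = r := by
    rw [hq, hr]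
    change (starRingEnd ℂ) _ = _
    rw [← Complex.exp_conj, map_mul, Complex.conj_ofReal, Complex.conj_I, mul_neg]
  have hqn : ∀ n : ℕ, (q ^ 2) ^ n = Complex.exp ((n : ℂ) * θ * Complex.I) := by
    intro n
    rw [hq, ← pow_mul, ← Complex.exp_nat_mul]
    congr 1
    push_cast
    ring
  have hrn : ∀ n : ℕ, (r ^ 2) ^ n = Complex.exp (-((n : ℂ) * θ) * Complex.I) := by
    intro n
    rw [hr, ← pow_mul, ← Complex.exp_nat_mul]
    congr 1
    push_cast
    ring
  have hq2 := hqn 1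
  have hr2 := hrn 1
  rw [pow_one, Nat.cast_one, one_mul] at hq2 hr2
  rw [Complex.exp_mul_I] at hq2
  rw [Complex.exp_mul_I, Complex.cos_neg, Complex.sin_neg] at hr2
  have hcosC : Complex.cos (θ : ℂ) = (x : ℂ) := by rw [← Complex.ofReal_cos, hcos]
  have hsinC : Complex.sin (θ : ℂ) ≠ 0 := by
    rw [← Complex.ofReal_sin]
    exact_mod_cast hsin
  have hx : (q ^ 2 + r ^ 2) / 2 = x := by
    rw [hq2, hr2, hcosC]
    ring
  have hsd : q ^ 2 - r ^ 2 = 2 * Complex.sin (θ : ℂ) * Complex.I := by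
    rw [hq2, hr2]
    ring
  have hs : q ^ 2 ≠ r ^ 2 := by
    rw [← sub_ne_zero, hsd]
    exact mul_ne_zero (mul_ne_zero two_ne_zero hsinC) Complex.I_ne_zero
  refine ⟨krawtchoukMat N q r, ?_, fun c hc => eq_zero_of_vecMul_krawtchoukMat N hqr hs c hc⟩
  rw [← sub_eq_zero]
  -- V and ΦΦ* both solve the skewness equation, so it suffices to compare first columns. With q² =
  -- e^{iθ} the sum of `sum_binomProd_coeff` is (N + 1)/(n + 1) · sin((n + 1)θ)/sin θ.
  refine eq_zero_of_skewMat N (x : ℂ) _ ?_ ?_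
  · have h1 := krawtchoukMat_mul_conjTranspose_skew N hqr hstar hx
    let f : ℝ[X] →+* ℂ := (algebraMap ℝ ℂ).comp (evalRingHom x)
    have h2 := congrArg (fun M : Matrix (Fin (N + 1)) (Fin (N + 1)) ℝ[X] => M.map f)
      (skewMat_mul_weightMat_add N)
    have hf : ((weightMat N).map fun p => ((p.eval x : ℝ) : ℂ)) = (weightMat N).map f := rfl
    have hfX : f X = (x : ℂ) := by simp [f]
    simp only [Matrix.map_add f (map_add f), Matrix.map_mul, Matrix.transpose_map, skewMat_map,
      hfX, Matrix.map_zero f (map_zero f)] at h2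
    rw [hf, mul_sub, sub_mul]
    rw [← sub_eq_zero] at h1
    rw [← sub_self (0 : Mat N)]
    nth_rewrite 1 [← h2]
    rw [← h1]
    abel
  · intro n
    have hn : (n : ℕ) ≤ N := by omega
    have hV : weightMat N n 0 = weightPoly N n 0 := weightSym_of_le (Nat.zero_le _)
    have h1 := sum_binomProd_coeff hn hqr hs
    have hU := Polynomial.Chebyshev.U_complex_cos (θ : ℂ) (n : ℕ)
    have hΦ : (krawtchoukMat N q r * (krawtchoukMat N q r)ᴴ) n 0
        = ∑ j ∈ Finset.range (N + 1), (binomProd q r (N - n) n).coeff j / (N.choose j : ℂ)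
          * (q ^ j * r ^ (N - j)) := by
      rw [Matrix.mul_apply, ← Fin.sum_univ_eq_sum_range (fun j =>
        (binomProd q r (N - n) n).coeff j / (N.choose j : ℂ) * (q ^ j * r ^ (N - j)))]
      refine Finset.sum_congr rfl fun j _ => ?_
      have hjN : (j : ℕ) ≤ N := by omega
      rw [Matrix.conjTranspose_apply]
      simp only [krawtchoukMat, Matrix.of_apply, Fin.val_zero, Nat.sub_zero]
      congr 1
      have hch : (N.choose j : ℂ) ≠ 0 := by exact_mod_cast (Nat.choose_pos hjN).ne'
      have hco : (binomProd q r N 0).coeff j = r ^ (j : ℕ) * q ^ (N - j) * (N.choose j : ℂ) := by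
        have e : (C q + C r * X : ℂ[X]) = C r * (X + C (q ^ 2)) := by
          have hqr' : (C q : ℂ[X]) * C r = 1 := by rw [← C_mul, hqr, C_1]
          rw [C_pow]
          linear_combination (-C q) * hqr'
        have e2 : r ^ N * (q ^ 2) ^ (N - (j : ℕ)) = r ^ (j : ℕ) * q ^ (N - (j : ℕ)) := by
          nth_rewrite 1 [← Nat.sub_add_cancel hjN]
          rw [pow_add, pow_right_comm]
          have : (q * r) ^ (N - (j : ℕ)) = 1 := by rw [hqr, one_pow]
          rw [mul_pow] at this
          linear_combination (r ^ (j : ℕ) * q ^ (N - (j : ℕ))) * this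
        rw [binomProd, pow_zero, mul_one, e, mul_pow, ← C_pow, coeff_C_mul, coeff_X_add_C_pow,
          ← mul_assoc, e2]
      rw [hco, mul_div_cancel_right₀ _ hch, star_mul', star_pow, star_pow, hstar, ← hstar,
        star_star]
    rw [Matrix.sub_apply, hΦ, h1, Matrix.map_apply, hV, weightPoly_zero, eval_mul, eval_C]
    push_cast
    rw [hqn, hrn, hsd, ← hcosC]
    have hdiff : Complex.exp (((n : ℕ) + 1 : ℕ) * θ * Complex.I)
        - Complex.exp (-(((n : ℕ) + 1 : ℕ) * (θ : ℂ)) * Complex.I)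
        = 2 * Complex.sin ((((n : ℕ) : ℂ) + 1) * θ) * Complex.I := by
      rw [Complex.exp_mul_I, Complex.exp_mul_I, Complex.cos_neg, Complex.sin_neg]
      push_cast
      ring
    rw [hdiff]
    push_cast at hU
    rw [← hU]
    have hn1 : ((n : ℕ) : ℂ) + 1 ≠ 0 := by exact_mod_cast (n : ℕ).succ_ne_zero
    have hI := Complex.I_ne_zero
    field_simp
    ring

end Factorization

/-! ### Integration against the semicircle density. -/

section Functional

open Polynomial

/-- Integration against `√(1 - x²)` on `[-1, 1]`, on polynomials. -/
noncomputable def semicircle : ℂ[X] →ₗ[ℂ] ℂ where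
  toFun p := ∫ x in (-1 : ℝ)..1, ((√(1 - x ^ 2) : ℝ) : ℂ) * p.eval (x : ℂ)
  map_add' p q := by
    simp only [eval_add, mul_add]
    refine intervalIntegral.integral_add ?_ ?_ <;>
    · refine Continuous.intervalIntegrable ?_ _ _
      fun_prop
  map_smul' c p := by
    simp only [eval_smul, smul_eq_mul, RingHom.id_apply, mul_left_comm _ c]
    exact intervalIntegral.integral_const_mul _ _

theorem semicircle_apply (p : ℂ[X]) :
    semicircle p = ∫ x in (-1 : ℝ)..1, ((√(1 - x ^ 2) : ℝ) : ℂ) * p.eval (x : ℂ) := rfl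

/-- √(1 - x²) times the argument is the derivative of (1 - x²)^{3/2} p, which vanishes at ±1. -/
theorem semicircle_deriv (p : ℂ[X]) :
    semicircle ((1 - X ^ 2) * derivative p - 3 * X * p) = 0 := by
  have h := intervalIntegral.integral_eq_sub_of_hasDerivAt_of_le (a := -1) (b := 1)
    (f := fun x : ℝ => ((√(1 - x ^ 2) : ℝ) : ℂ) * ((1 - X ^ 2) * p : ℂ[X]).eval (x : ℂ))
    (f' := fun x : ℝ => ((√(1 - x ^ 2) : ℝ) : ℂ)
      * ((1 - X ^ 2) * derivative p - 3 * X * p : ℂ[X]).eval (x : ℂ)) (by norm_num)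
    (Continuous.continuousOn (by fun_prop)) ?_
    (Continuous.intervalIntegrable (by fun_prop) _ _)
  · rw [semicircle_apply, h]
    simp
  · intro x hx
    have hpos : 0 < 1 - x ^ 2 := by nlinarith [hx.1, hx.2]
    have h1 : HasDerivAt (fun x : ℝ => √(1 - x ^ 2)) (-x / √(1 - x ^ 2)) x := by
      have := (((hasDerivAt_id x).pow 2).const_sub 1).sqrt hpos.ne'
      refine this.congr_deriv ?_
      simp
      ring
    have h2 : HasDerivAt (fun x : ℝ => ((1 - X ^ 2) * p : ℂ[X]).eval (x : ℂ))
        ((derivative ((1 - X ^ 2) * p : ℂ[X])).eval (x : ℂ)) x :=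
      (Polynomial.hasDerivAt _ _).comp_ofReal
    refine (h1.ofReal_comp.mul h2).congr_deriv ?_
    have hs : ((√(1 - x ^ 2) : ℝ) : ℂ) ≠ 0 := by
      exact_mod_cast (Real.sqrt_pos.mpr hpos).ne'
    have hsq : ((√(1 - x ^ 2) : ℝ) : ℂ) * (√(1 - x ^ 2) : ℝ) = 1 - (x : ℂ) ^ 2 := by
      rw [← Complex.ofReal_mul, Real.mul_self_sqrt hpos.le]
      push_cast
      ring
    push_cast
    simp only [derivative_mul, derivative_sub, derivative_one, derivative_X_pow, eval_sub,
      eval_mul, eval_add, eval_one, eval_pow, eval_X, eval_ofNat]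
    rw [← hsq]
    push_cast
    simp only [map_ofNat, eval_ofNat, eval_zero]
    field_simp
    ring

theorem semicircle_map_conj (p : ℂ[X]) :
    semicircle (p.map (starRingEnd ℂ)) = star (semicircle p) := by
  rw [semicircle_apply, semicircle_apply]
  change _ = (starRingEnd ℂ) _
  rw [intervalIntegral.integral_of_le (by norm_num), intervalIntegral.integral_of_le (by norm_num),
    ← integral_conj]
  refine MeasureTheory.integral_congr_ae (Filter.Eventually.of_forall fun x => ?_)
  simp only [map_mul, Complex.conj_ofReal]
  congr 1
  rw [← Polynomial.eval₂_at_apply, Polynomial.eval_map, Complex.conj_ofReal]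

theorem semicircle_pos {p : ℂ[X]}
    (h0 : ∀ x ∈ Set.Ioo (-1 : ℝ) 1, 0 ≤ p.eval (x : ℂ))
    (h1 : ∃ x ∈ Set.Ioo (-1 : ℝ) 1, 0 < p.eval (x : ℂ)) : 0 < semicircle p := by
  have e : semicircle p
      = ((∫ x in (-1 : ℝ)..1, √(1 - x ^ 2) * (p.eval (x : ℂ)).re : ℝ) : ℂ) := by
    rw [semicircle_apply, ← intervalIntegral.integral_ofReal]
    refine intervalIntegral.integral_congr fun x hx => ?_
    rw [Set.uIcc_of_le (by norm_num)] at hx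
    by_cases hxx : x ∈ Set.Ioo (-1 : ℝ) 1
    · have := (Complex.nonneg_iff.mp (h0 x hxx)).2
      rw [Complex.ofReal_mul]
      congr 1
      exact Complex.ext rfl (by rw [← this]; simp)
    · have : 1 - x ^ 2 = 0 := by
        rw [Set.mem_Ioo, not_and_or, not_lt, not_lt] at hxx
        rcases hxx with h | h
        · rw [le_antisymm h hx.1]
          ring
        · rw [le_antisymm hx.2 h]
          ring
      rw [this]
      simp
  rw [e, Complex.zero_lt_real]
  refine intervalIntegral.integral_pos (by norm_num) (Continuous.continuousOn (by fun_prop)) ?_ ?_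
  · intro x hx
    by_cases hx1 : x = 1
    · simp [hx1]
    · have := (Complex.nonneg_iff.mp (h0 x ⟨hx.1, lt_of_le_of_ne hx.2 hx1⟩)).1
      positivity
  · obtain ⟨x, hx, hp⟩ := h1
    refine ⟨x, ⟨hx.1.le, hx.2.le⟩, mul_pos (Real.sqrt_pos.mpr ?_) (Complex.pos_iff.mp hp).1⟩
    nlinarith [hx.1, hx.2]

end Functional

/-! ### Lagrange identities for the two symmetric differential operators. -/

section SymmetricOperators

open Polynomial

variable {N : ℕ}

/-- The coefficient embedding `ℝ[X] → ℂ[X]`. -/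
noncomputable abbrev polyOfReal : ℝ[X] →+* ℂ[X] := mapRingHom (algebraMap ℝ ℂ)

/-- The polynomial part of the weight over `ℂ[X]`. -/
noncomputable def weightMatC (N : ℕ) : Matrix (Fin (N + 1)) (Fin (N + 1)) ℂ[X] :=
  (weightMat N).map polyOfReal

theorem smul_map_ringHom {R S n : Type*} [CommRing R] [CommRing S] (f : R →+* S) (a : R)
    (M : Matrix n n R) : (a • M).map f = f a • M.map f := by
  ext1 i j
  simp

theorem neg_map_ringHom {R S n : Type*} [CommRing R] [CommRing S] (f : R →+* S)
    (M : Matrix n n R) : (-M).map f = -M.map f := by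
  ext1 i j
  simp

theorem derivMat_map_polyOfReal (M : Matrix (Fin (N + 1)) (Fin (N + 1)) ℝ[X]) :
    (derivMat M).map polyOfReal = derivMat (M.map polyOfReal) := by
  ext1 i j
  simp [derivMat_apply]

theorem raiseMat_map {R S : Type*} [CommRing R] [CommRing S] (f : R →+* S) (N : ℕ) :
    (raiseMat N R).map f = raiseMat N S := by
  ext1 i j
  simp only [raiseMat, Matrix.map_apply, Matrix.of_apply]
  split_ifs <;> simp

theorem lowerMat_map {R S : Type*} [CommRing R] [CommRing S] (f : R →+* S) (N : ℕ) :
    (lowerMat N R).map f = lowerMat N S := by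
  ext1 i j
  simp only [lowerMat, Matrix.map_apply, Matrix.of_apply]
  split_ifs <;> simp

theorem cartanMat_map {R S : Type*} [CommRing R] [CommRing S] (f : R →+* S) (N : ℕ) :
    (cartanMat N R).map f = cartanMat N S := by
  ext1 i j
  simp only [cartanMat, Matrix.map_apply, Matrix.diagonal_apply]
  split_ifs <;> simp [map_ofNat]

theorem pearsonMat_map {R S : Type*} [CommRing R] [CommRing S] (f : R →+* S) (N : ℕ) (x : R) :
    (pearsonMat N x).map f = pearsonMat N (f x) := by
  rw [pearsonMat, Matrix.map_sub f (map_sub f), Matrix.map_sub f (map_sub f), smul_map_ringHom,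
    raiseMat_map, lowerMat_map, Matrix.map_one f (map_zero f) (map_one f), map_mul, map_natCast,
    pearsonMat]

theorem weightMat_map_polyOfReal (N : ℕ) :
    (weightMat N).map polyOfReal = weightMatC N := rfl

theorem weightMatC_transpose (N : ℕ) : (weightMatC N).transpose = weightMatC N := by
  rw [weightMatC, ← Matrix.transpose_map, weightMat_transpose]

theorem weightMatC_mul_skewMat_transpose (N : ℕ) :
    weightMatC N * (skewMat N (X : ℂ[X])).transpose
      = -(skewMat N (X : ℂ[X]) * weightMatC N) := by
  have h := congrArg (fun M : Matrix (Fin (N + 1)) (Fin (N + 1)) ℝ[X] => M.map polyOfReal)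
    (weightMat_mul_skewMat_transpose N)
  simp only [Matrix.map_mul, Matrix.transpose_map, neg_map_ringHom, skewMat_map,
    weightMat_map_polyOfReal] at h
  simpa using h

theorem exists_skewMat_mul_weightMatC_eq (N : ℕ) :
    ∃ S : Matrix (Fin (N + 1)) (Fin (N + 1)) ℂ[X],
      skewMat N (X : ℂ[X]) * weightMatC N = (1 - X ^ 2 : ℂ[X]) • S ∧
      (1 - X ^ 2 : ℂ[X]) • derivMat S - (3 * X : ℂ[X]) • S
        = (-C (((N : ℂ) + 2) / 2)) •
          (cartanMat N ℂ[X] * weightMatC N - weightMatC N * cartanMat N ℂ[X]) := by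
  obtain ⟨S, h1, h2⟩ := exists_skewMat_mul_weightMat_eq N
  refine ⟨S.map polyOfReal, ?_, ?_⟩
  · have h := congrArg (fun M : Matrix (Fin (N + 1)) (Fin (N + 1)) ℝ[X] => M.map polyOfReal) h1
    simp only [Matrix.map_mul, smul_map_ringHom, skewMat_map,
      weightMat_map_polyOfReal] at h
    simpa using h
  · have h := congrArg (fun M : Matrix (Fin (N + 1)) (Fin (N + 1)) ℝ[X] => M.map polyOfReal) h2
    simp only [Matrix.map_sub polyOfReal (map_sub polyOfReal), Matrix.map_mul, smul_map_ringHom,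
      derivMat_map_polyOfReal, cartanMat_map,
      weightMat_map_polyOfReal] at h
    simpa [map_ofNat] using h

theorem exists_pearsonMat_mul_weightMatC_eq (N : ℕ) :
    ∃ S : Matrix (Fin (N + 1)) (Fin (N + 1)) ℂ[X],
      pearsonMat N (X : ℂ[X]) * weightMatC N - weightMatC N * (pearsonMat N (X : ℂ[X])).transpose
        = (1 - X ^ 2 : ℂ[X]) • S ∧
      (1 - X ^ 2 : ℂ[X]) • derivMat S - (3 * X : ℂ[X]) • S
        = C (1 / 2 : ℂ) • (cartanMat N ℂ[X] * cartanMat N ℂ[X] * weightMatC N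
          - weightMatC N * (cartanMat N ℂ[X] * cartanMat N ℂ[X])) := by
  obtain ⟨S, h1, h2⟩ := exists_pearsonMat_mul_weightMat_eq N
  refine ⟨S.map polyOfReal, ?_, ?_⟩
  · have h := congrArg (fun M : Matrix (Fin (N + 1)) (Fin (N + 1)) ℝ[X] => M.map polyOfReal) h1
    simp only [Matrix.map_sub polyOfReal (map_sub polyOfReal), Matrix.map_mul,
      Matrix.transpose_map, smul_map_ringHom, pearsonMat_map,
      weightMat_map_polyOfReal] at h
    simpa using h
  · have h := congrArg (fun M : Matrix (Fin (N + 1)) (Fin (N + 1)) ℝ[X] => M.map polyOfReal) h2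
    simp only [Matrix.map_sub polyOfReal (map_sub polyOfReal), Matrix.map_mul, smul_map_ringHom,
      derivMat_map_polyOfReal, cartanMat_map,
      weightMat_map_polyOfReal] at h
    simpa [map_ofNat] using h

theorem two_mul_derivMat_weightMatC (N : ℕ) :
    (2 * (1 - X ^ 2) : ℂ[X]) • derivMat (weightMatC N) + pearsonMat N (X : ℂ[X]) * weightMatC N
      + weightMatC N * (pearsonMat N (X : ℂ[X])).transpose = 0 := by
  have h := congrArg (fun M : Matrix (Fin (N + 1)) (Fin (N + 1)) ℝ[X] => M.map polyOfReal)
    (two_mul_derivMat_weightMat N)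
  simp only [Matrix.map_add polyOfReal (map_add polyOfReal), Matrix.map_mul,
    Matrix.transpose_map, smul_map_ringHom, pearsonMat_map, derivMat_map_polyOfReal,
    weightMat_map_polyOfReal] at h
  simpa [map_ofNat] using h

/-- The operation `M ↦ (1 - x²) M' - 3 x M`, whose image is annihilated by `semicircle`. -/
noncomputable def weightedDeriv (M : Matrix (Fin (N + 1)) (Fin (N + 1)) ℂ[X]) :
    Matrix (Fin (N + 1)) (Fin (N + 1)) ℂ[X] :=
  (1 - X ^ 2 : ℂ[X]) • derivMat M - (3 * X : ℂ[X]) • M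

theorem semicircle_weightedDeriv (M : Matrix (Fin (N + 1)) (Fin (N + 1)) ℂ[X]) :
    (weightedDeriv M).map semicircle = 0 := by
  ext1 i j
  simp only [weightedDeriv, Matrix.map_apply, Matrix.sub_apply, Matrix.smul_apply, smul_eq_mul,
    derivMat_apply, Matrix.zero_apply]
  exact semicircle_deriv _

/-- With TV = (1 - x²)S and VTᵗ = -(1 - x²)S, the primitive is M = ASb; the zeroth order terms
contribute -(N + 2)/2 · A[h, V]b, exactly the defect in the equation for S. -/
theorem firstOrder_symmetric_aux (A b : Matrix (Fin (N + 1)) (Fin (N + 1)) ℂ[X]) :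
    ∃ M, (derivMat A * skewMat N (X : ℂ[X]) + A * ((-C (((N : ℂ) + 2) / 2)) • cartanMat N ℂ[X]))
        * weightMatC N * b
      - A * weightMatC N * ((skewMat N (X : ℂ[X])).transpose * derivMat b
        + ((-C (((N : ℂ) + 2) / 2)) • cartanMat N ℂ[X]) * b) = weightedDeriv M := by
  obtain ⟨S, h1, h2⟩ := exists_skewMat_mul_weightMatC_eq N
  refine ⟨A * S * b, ?_⟩
  have hT := weightMatC_mul_skewMat_transpose N
  have e1 := congrArg (fun M => derivMat A * M * b) h1
  have e2 := congrArg (fun M => A * M * derivMat b) (hT.trans (congrArg Neg.neg h1))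
  have e3 := congrArg (fun M => A * M * b) h2
  simp only [weightedDeriv, derivMat_mul, mul_add, add_mul, mul_sub, sub_mul, Matrix.mul_smul,
    Matrix.smul_mul, mul_assoc, mul_neg, neg_mul, smul_add] at e1 e2 e3 ⊢
  rw [e1, e2]
  linear_combination (norm := module) -e3

/-- The primitive is A'Vb - AVb' - ½ASb, where (1 - x²)S = KV - VKᵗ. The Pearson equation controls
KV + VKᵗ and S the difference. -/
theorem secondOrder_symmetric_aux (A b : Matrix (Fin (N + 1)) (Fin (N + 1)) ℂ[X]) :
    ∃ M, ((1 - X ^ 2 : ℂ[X]) • derivMat (derivMat A)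
          + derivMat A * (-pearsonMat N (X : ℂ[X]) - (3 * X : ℂ[X]) • 1)
          + A * (C (-1 / 4 : ℂ) • (cartanMat N ℂ[X] * cartanMat N ℂ[X]))) * weightMatC N * b
      - A * weightMatC N * ((1 - X ^ 2 : ℂ[X]) • derivMat (derivMat b)
          + (-(pearsonMat N (X : ℂ[X])).transpose - (3 * X : ℂ[X]) • 1) * derivMat b
          + (C (-1 / 4 : ℂ) • (cartanMat N ℂ[X] * cartanMat N ℂ[X])) * b) = weightedDeriv M := by
  obtain ⟨S, h1, h2⟩ := exists_pearsonMat_mul_weightMatC_eq N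
  have hd := two_mul_derivMat_weightMatC N
  refine ⟨derivMat A * weightMatC N * b - A * weightMatC N * derivMat b
    - C (1 / 2 : ℂ) • (A * S * b), ?_⟩
  have h4 : (C (-1 / 4 : ℂ) : ℂ[X]) = -(C (1 / 2) * C (1 / 2)) := by
    rw [← C_mul, ← C_neg]
    norm_num
  have hhalf : (C (1 / 2 : ℂ) : ℂ[X]) * 2 = 1 := by
    rw [← map_ofNat C 2, ← C_mul]
    norm_num
  have e1 := congrArg (fun M => (C (1 / 2 : ℂ) : ℂ[X]) • (derivMat A * M * b)) hd
  have e2 := congrArg (fun M => (C (1 / 2 : ℂ) : ℂ[X]) • (A * M * derivMat b)) hd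
  have e3 := congrArg (fun M => (C (1 / 2 : ℂ) : ℂ[X]) • (derivMat A * M * b)) h1
  have e4 := congrArg (fun M => (C (1 / 2 : ℂ) : ℂ[X]) • (A * M * derivMat b)) h1
  have e5 := congrArg (fun M => (C (1 / 2 : ℂ) : ℂ[X]) • (A * M * b)) h2
  rw [h4]
  have hdC : derivative (C (1 / 2 : ℂ)) = 0 := derivative_C
  generalize (C (1 / 2 : ℂ) : ℂ[X]) = t at *
  simp only [weightedDeriv, derivMat_mul, derivMat_sub, derivMat_smul, hdC,
    zero_smul, zero_add, mul_add, add_mul, mul_sub, sub_mul, Matrix.mul_smul, one_mul, mul_one,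
    Matrix.smul_mul, mul_assoc, mul_neg, neg_mul, smul_add, smul_sub, mul_zero, zero_mul,
    smul_zero, smul_smul] at e1 e2 e3 e4 e5 ⊢
  have hc : t * (2 * (1 - X ^ 2)) = 1 - X ^ 2 := by linear_combination (1 - X ^ 2) * hhalf
  rw [← mul_assoc t 2, hhalf, one_mul] at e1 e2
  -- K-terms are halved so that one half is treated by the Pearson equation and the other by S.
  have hsplit : ∀ M : Matrix (Fin (N + 1)) (Fin (N + 1)) ℂ[X], M = t • M + t • M := by
    intro M
    rw [← two_smul ℂ[X] (t • M), smul_smul, mul_comm, hhalf, one_smul]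
  rw [hsplit (derivMat A * (pearsonMat N (X : ℂ[X]) * (weightMatC N * b))),
    hsplit (A * (weightMatC N * ((pearsonMat N (X : ℂ[X])).transpose * derivMat b)))]
  linear_combination (norm := module) -e1 + e2 - e3 - e4 + e5

end SymmetricOperators

/-! ### Matrix-valued polynomials, positivity of the inner product, symmetry of the operators. -/

section PolynomialMatrices

open Polynomial Matrix

variable {N : ℕ}

/-- A matrix-valued polynomial as a matrix of polynomials. -/
noncomputable def MatPoly.entries (P : MatPoly N) : Matrix (Fin (N + 1)) (Fin (N + 1)) ℂ[X] :=
  matPolyEquiv.symm P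

theorem MatPoly.entries_add (P Q : MatPoly N) : (P + Q).entries = P.entries + Q.entries :=
  map_add _ _ _

theorem MatPoly.entries_sub (P Q : MatPoly N) : (P - Q).entries = P.entries - Q.entries :=
  map_sub _ _ _

theorem MatPoly.entries_mul (P Q : MatPoly N) : (P * Q).entries = P.entries * Q.entries :=
  map_mul _ _ _

theorem MatPoly.entries_C (A : Mat N) : MatPoly.entries (C A) = A.map C :=
  matPolyEquiv_symm_C A

theorem MatPoly.entries_X_mul (P : MatPoly N) :
    MatPoly.entries (X * P) = (X : ℂ[X]) • P.entries := by
  rw [MatPoly.entries_mul, Matrix.smul_eq_diagonal_mul]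
  congr 1
  exact matPolyEquiv_symm_X

theorem MatPoly.entries_coeff (P : MatPoly N) (i j : Fin (N + 1)) (k : ℕ) :
    (P.entries i j).coeff k = P.coeff k i j :=
  matPolyEquiv_symm_apply_coeff P i j k

theorem MatPoly.entries_derivative (P : MatPoly N) :
    MatPoly.entries (derivative P) = derivMat P.entries := by
  ext i j k
  rw [derivMat_apply, coeff_derivative, MatPoly.entries_coeff, MatPoly.entries_coeff,
    coeff_derivative]
  have : (P.coeff (k + 1) * ((k : Mat N) + 1)) = ((k : ℂ) + 1) • P.coeff (k + 1) := by
    rw [mul_add, mul_one, add_smul, one_smul]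
    congr 1
    rw [Nat.cast_smul_eq_nsmul, nsmul_eq_mul, Nat.cast_comm]
  rw [this, Matrix.smul_apply, smul_eq_mul, mul_comm]

theorem MatPoly.at_eq_map_eval (P : MatPoly N) (x : ℂ) : P.at x = P.entries.map (eval x) := by
  rw [MatPoly.entries, matPolyEquiv_symm_map_eval, eval_eq_sum_range, MatPoly.at]
  refine Finset.sum_congr rfl fun k _ => ?_
  rw [← map_pow, Matrix.scalar_apply, ← Matrix.smul_eq_mul_diagonal]

theorem MatPoly.at_add (P Q : MatPoly N) (x : ℂ) : (P + Q).at x = P.at x + Q.at x := by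
  simp only [MatPoly.at_eq_map_eval, MatPoly.entries_add]
  ext1 i j
  simp

theorem MatPoly.at_mul (P Q : MatPoly N) (x : ℂ) : (P * Q).at x = P.at x * Q.at x := by
  simp only [MatPoly.at_eq_map_eval, MatPoly.entries_mul]
  exact Matrix.map_mul (f := evalRingHom x)

theorem MatPoly.at_C (A : Mat N) (x : ℂ) : MatPoly.at (C A) x = A := by
  rw [MatPoly.at_eq_map_eval, MatPoly.entries_C]
  ext1 i j
  simp

theorem MatPoly.at_X_mul (P : MatPoly N) (x : ℂ) : MatPoly.at (X * P) x = x • P.at x := by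
  rw [MatPoly.at_eq_map_eval, MatPoly.entries_X_mul, MatPoly.at_eq_map_eval]
  ext1 i j
  simp

theorem MatPoly.at_zero (x : ℂ) : MatPoly.at (0 : MatPoly N) x = 0 := by
  simp [MatPoly.at]

/-- The adjoint of a polynomial matrix, `x` being real. -/
noncomputable def polyAdjoint (M : Matrix (Fin (N + 1)) (Fin (N + 1)) ℂ[X]) :
    Matrix (Fin (N + 1)) (Fin (N + 1)) ℂ[X] :=
  (M.map (mapRingHom (starRingEnd ℂ)))ᵀ

theorem polyAdjoint_add (A B : Matrix (Fin (N + 1)) (Fin (N + 1)) ℂ[X]) :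
    polyAdjoint (A + B) = polyAdjoint A + polyAdjoint B := by
  rw [polyAdjoint, Matrix.map_add _ (map_add _), Matrix.transpose_add]
  rfl

theorem polyAdjoint_mul (A B : Matrix (Fin (N + 1)) (Fin (N + 1)) ℂ[X]) :
    polyAdjoint (A * B) = polyAdjoint B * polyAdjoint A := by
  rw [polyAdjoint, Matrix.map_mul, Matrix.transpose_mul]
  rfl

theorem polyAdjoint_smul (f : ℂ[X]) (A : Matrix (Fin (N + 1)) (Fin (N + 1)) ℂ[X]) :
    polyAdjoint (f • A) = mapRingHom (starRingEnd ℂ) f • polyAdjoint A := by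
  rw [polyAdjoint, smul_map_ringHom, Matrix.transpose_smul]
  rfl

theorem polyAdjoint_polyAdjoint (A : Matrix (Fin (N + 1)) (Fin (N + 1)) ℂ[X]) :
    polyAdjoint (polyAdjoint A) = A := by
  ext i j k
  simp [polyAdjoint]

theorem polyAdjoint_derivMat (A : Matrix (Fin (N + 1)) (Fin (N + 1)) ℂ[X]) :
    polyAdjoint (derivMat A) = derivMat (polyAdjoint A) := by
  ext1 i j
  simp [polyAdjoint, derivMat_apply]

theorem polyAdjoint_weightMatC : polyAdjoint (weightMatC N) = weightMatC N := by
  rw [← weightMatC_transpose, polyAdjoint, Matrix.transpose_map, Matrix.transpose_transpose,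
    weightMatC_transpose]
  ext i j k
  simp [weightMatC]

theorem polyAdjoint_skewMat : polyAdjoint (skewMat N (X : ℂ[X])) = (skewMat N (X : ℂ[X]))ᵀ := by
  rw [polyAdjoint, skewMat_map]
  simp

theorem polyAdjoint_pearsonMat :
    polyAdjoint (pearsonMat N (X : ℂ[X])) = (pearsonMat N (X : ℂ[X]))ᵀ := by
  rw [polyAdjoint, pearsonMat_map]
  simp

theorem polyAdjoint_cartanMat : polyAdjoint (cartanMat N ℂ[X]) = cartanMat N ℂ[X] := by
  rw [polyAdjoint, cartanMat_map, cartanMat_transpose]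

theorem polyAdjoint_one :
    polyAdjoint (1 : Matrix (Fin (N + 1)) (Fin (N + 1)) ℂ[X]) = 1 := by
  rw [polyAdjoint, Matrix.map_one _ (map_zero _) (map_one _), Matrix.transpose_one]

theorem map_semicircle_polyAdjoint (A : Matrix (Fin (N + 1)) (Fin (N + 1)) ℂ[X]) :
    (polyAdjoint A).map semicircle = (A.map semicircle)ᴴ := by
  ext1 i j
  simp only [polyAdjoint, Matrix.map_apply, Matrix.transpose_apply, Matrix.conjTranspose_apply]
  exact semicircle_map_conj _

theorem polyAdjoint_map_eval (A : Matrix (Fin (N + 1)) (Fin (N + 1)) ℂ[X]) (x : ℝ) :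
    (polyAdjoint A).map (eval (x : ℂ)) = (A.map (eval (x : ℂ)))ᴴ := by
  ext1 i j
  simp only [polyAdjoint, Matrix.map_apply, Matrix.transpose_apply, Matrix.conjTranspose_apply,
    coe_mapRingHom]
  change _ = (starRingEnd ℂ) _
  rw [← Polynomial.eval₂_at_apply, Polynomial.eval_map, Complex.conj_ofReal]

theorem weightMatC_map_eval (x : ℝ) :
    (weightMatC N).map (eval (x : ℂ)) = (weightMat N).map fun p => ((p.eval x : ℝ) : ℂ) := by
  ext1 i j
  simp only [weightMatC, Matrix.map_apply, coe_mapRingHom, Polynomial.eval_map]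
  exact Polynomial.eval₂_at_apply (algebraMap ℝ ℂ) x

/-- The matrix-valued inner product of the weight `W`, computed on polynomial matrices. -/
noncomputable def weightForm (P Q : MatPoly N) : Mat N :=
  (P.entries * weightMatC N * polyAdjoint Q.entries).map semicircle

theorem weightForm_add_left (P P' Q : MatPoly N) :
    weightForm (P + P') Q = weightForm P Q + weightForm P' Q := by
  rw [weightForm, MatPoly.entries_add, add_mul, add_mul, Matrix.map_add _ (map_add _)]
  rfl

theorem weightForm_C_mul (A : Mat N) (P Q : MatPoly N) :
    weightForm (C A * P) Q = A * weightForm P Q := by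
  rw [weightForm, MatPoly.entries_mul, MatPoly.entries_C, mul_assoc, mul_assoc, ← mul_assoc P.entries]
  ext1 i j
  rw [Matrix.map_apply, Matrix.mul_apply, Matrix.mul_apply, map_sum]
  refine Finset.sum_congr rfl fun k _ => ?_
  rw [Matrix.map_apply, ← smul_eq_C_mul, map_smul]
  rfl

theorem weightForm_conj (P Q : MatPoly N) : weightForm Q P = (weightForm P Q)ᴴ := by
  rw [weightForm, weightForm, ← map_semicircle_polyAdjoint, polyAdjoint_mul, polyAdjoint_mul,
    polyAdjoint_weightMatC, polyAdjoint_polyAdjoint, mul_assoc]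

theorem weightForm_X_mul (P Q : MatPoly N) : weightForm (X * P) Q = weightForm P (X * Q) := by
  rw [weightForm, weightForm, MatPoly.entries_X_mul, MatPoly.entries_X_mul, polyAdjoint_smul]
  simp

/-- At each x in (-1, 1) the integrand is |u|² with u = (PΦ)*c, which is zero only if c*P(x) = 0, as
Φ has no left kernel. -/
theorem weightForm_pos (P : MatPoly N) (c : Fin (N + 1) → ℂ) (k : ℕ)
    (hk : Matrix.vecMul (star c) (P.coeff k) ≠ 0) :
    0 < star c ⬝ᵥ (weightForm P P *ᵥ c) := by
  set M := P.entries * weightMatC N * polyAdjoint P.entries with hM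
  set F : ℂ[X] := ∑ i, ∑ j, (star c i * c j) • M i j with hF
  have hΛ : ∀ Λ : ℂ[X] →ₗ[ℂ] ℂ, Λ F = star c ⬝ᵥ (M.map Λ *ᵥ c) := by
    intro Λ
    simp only [hF, map_sum, map_smul, dotProduct, mulVec, Finset.mul_sum, Matrix.map_apply,
      smul_eq_mul]
    refine Finset.sum_congr rfl fun i _ => Finset.sum_congr rfl fun j _ => ?_
    ring
  have hev : ∀ x : ℝ, F.eval (x : ℂ)
      = star c ⬝ᵥ ((P.entries.map (eval (x : ℂ)) * (weightMatC N).map (eval (x : ℂ))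
        * (P.entries.map (eval (x : ℂ)))ᴴ) *ᵥ c) := by
    intro x
    have h := hΛ (leval (x : ℂ))
    rw [leval_apply] at h
    rw [h, ← polyAdjoint_map_eval]
    congr 2
    change M.map (evalRingHom (x : ℂ)) = _
    rw [hM, Matrix.map_mul, Matrix.map_mul]
    rfl
  have key : ∀ x ∈ Set.Ioo (-1 : ℝ) 1, ∃ u : Fin (N + 1) → ℂ, F.eval (x : ℂ) = star u ⬝ᵥ u ∧
      (u = 0 → Matrix.vecMul (star c) (P.entries.map (eval (x : ℂ))) = 0) := by
    intro x hx
    obtain ⟨Φ, h1, h2⟩ := exists_weightMat_eval_eq N hx.1 hx.2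
    refine ⟨(P.entries.map (eval (x : ℂ)) * Φ)ᴴ *ᵥ c, ?_, ?_⟩
    · rw [hev, weightMatC_map_eval, h1, Matrix.star_mulVec, Matrix.conjTranspose_conjTranspose,
        ← Matrix.dotProduct_mulVec, Matrix.mulVec_mulVec, Matrix.conjTranspose_mul]
      simp only [mul_assoc]
    · intro h
      have h' := congrArg star h
      rw [Matrix.star_mulVec, Matrix.conjTranspose_conjTranspose, star_zero,
        ← Matrix.vecMul_vecMul] at h'
      exact h2 _ h'
  change 0 < star c ⬝ᵥ (M.map semicircle *ᵥ c)
  rw [← hΛ semicircle]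
  refine semicircle_pos ?_ ?_
  · intro x hx
    obtain ⟨u, hu, -⟩ := key x hx
    rw [hu]
    exact dotProduct_star_self_nonneg u
  -- Some entry of the row c*P is a nonzero polynomial, so it has a non-root in the interval.
  · obtain ⟨j, hj⟩ := Function.ne_iff.mp hk
    set f : ℂ[X] := ∑ i, C (star c i) * P.entries i j with hf
    have hf0 : f ≠ 0 := by
      intro h0
      apply hj
      have h := congrArg (fun p => coeff p k) h0
      simpa only [hf, finsetSum_coeff, coeff_C_mul, MatPoly.entries_coeff, coeff_zero, Matrix.vecMul,
        dotProduct, Pi.zero_apply] using h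
    have hfin : {x : ℝ | f.IsRoot (x : ℂ)}.Finite :=
      (f.finite_setOfPred_isRoot hf0).preimage Complex.ofReal_injective.injOn
    obtain ⟨x, hx, hxf⟩ := ((Set.Ioo_infinite (show (-1 : ℝ) < 1 by norm_num)).sdiff hfin).nonempty
    refine ⟨x, hx, ?_⟩
    obtain ⟨u, hu, hu0⟩ := key x hx
    rw [hu, dotProduct_star_self_pos_iff]
    intro h
    apply hxf
    have h' := congrFun (hu0 h) j
    change eval (x : ℂ) f = 0
    rw [hf, eval_finsetSum]
    simpa [Matrix.vecMul, dotProduct] using h'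

theorem matInner_weightW (P Q : MatPoly N) :
    matInner (weightW N) (-1) 1 P Q = weightForm P Q := by
  ext1 i j
  rw [matInner, Matrix.of_apply, weightForm, Matrix.map_apply, semicircle_apply]
  refine intervalIntegral.integral_congr fun x _ => ?_
  have hW : weightW N x = ((√(1 - x ^ 2) : ℝ) : ℂ) • (weightMatC N).map (eval (x : ℂ)) := by
    rw [weightMatC_map_eval]
    ext1 n m
    have he : ∀ a b : ℕ, weightEntry N a b x = √(1 - x ^ 2) * (weightPoly N a b).eval x := by
      intro a b
      rw [weightEntry, weightPoly, chebSum, eval_finsetSum]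
      simp only [eval_mul, eval_C]
    simp only [weightW, Matrix.of_apply, Matrix.smul_apply, Matrix.map_apply, weightMat, weightSym,
      he, smul_eq_mul]
    split_ifs with h1 h2 h2
    · push_cast; rfl
    · exact absurd h1 h2
    · exact absurd h2 h1
    · push_cast; rfl
  simp only [hW, MatPoly.at_eq_map_eval]
  rw [← polyAdjoint_map_eval, Matrix.mul_smul, Matrix.smul_mul, Matrix.smul_apply, smul_eq_mul]
  congr 1
  have e : ((P.entries * weightMatC N * polyAdjoint Q.entries) i j).eval (x : ℂ)
      = (P.entries * weightMatC N * polyAdjoint Q.entries).map (evalRingHom (x : ℂ)) i j := rfl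
  rw [e, Matrix.map_mul, Matrix.map_mul]
  rfl

/-- The first order differential operator that is symmetric for the weight. -/
noncomputable def firstOrderOp (P : MatPoly N) : MatPoly N :=
  derivative P * C (raiseMat N ℂ - lowerMat N ℂ) - X * (derivative P * C (cartanMat N ℂ))
    + P * C ((-(((N : ℂ) + 2) / 2)) • cartanMat N ℂ)

/-- The second order differential operator that is symmetric for the weight. -/
noncomputable def secondOrderOp (P : MatPoly N) : MatPoly N :=
  derivative (derivative P) - X * (X * derivative (derivative P))
    + derivative P * C (raiseMat N ℂ + lowerMat N ℂ)
    - X * (derivative P * C (((N : ℂ) + 3) • (1 : Mat N)))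
    + P * C ((-1 / 4 : ℂ) • (cartanMat N ℂ * cartanMat N ℂ))

theorem entries_firstOrderOp (P : MatPoly N) :
    (firstOrderOp P).entries = derivMat P.entries * skewMat N (X : ℂ[X])
      + P.entries * ((-C (((N : ℂ) + 2) / 2)) • cartanMat N ℂ[X]) := by
  simp only [firstOrderOp, MatPoly.entries_add, MatPoly.entries_sub, MatPoly.entries_mul P,
    MatPoly.entries_X_mul, MatPoly.entries_mul (derivative P), MatPoly.entries_derivative,
    MatPoly.entries_C, Matrix.map_sub C (map_sub C), raiseMat_map, lowerMat_map, cartanMat_map,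
    smul_map_ringHom, map_neg, skewMat, mul_sub, Matrix.mul_smul]

theorem entries_secondOrderOp (P : MatPoly N) :
    (secondOrderOp P).entries = (1 - X ^ 2 : ℂ[X]) • derivMat (derivMat P.entries)
      + derivMat P.entries * (-pearsonMat N (X : ℂ[X]) - (3 * X : ℂ[X]) • 1)
      + P.entries * (C (-1 / 4 : ℂ) • (cartanMat N ℂ[X] * cartanMat N ℂ[X])) := by
  simp only [secondOrderOp, MatPoly.entries_add, MatPoly.entries_sub, MatPoly.entries_mul P,
    MatPoly.entries_X_mul, MatPoly.entries_mul (derivative P), MatPoly.entries_derivative,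
    MatPoly.entries_C, Matrix.map_add C (map_add C), raiseMat_map, lowerMat_map, cartanMat_map,
    smul_map_ringHom, Matrix.map_mul, Matrix.map_one C (map_zero C) (map_one C), pearsonMat]
  simp only [mul_sub, mul_add, Matrix.mul_smul, mul_one, mul_neg, map_add, map_natCast, map_ofNat]
  module

theorem weightForm_firstOrderOp (P Q : MatPoly N) :
    weightForm (firstOrderOp P) Q = weightForm P (firstOrderOp Q) := by
  obtain ⟨M, hM⟩ := firstOrder_symmetric_aux P.entries (polyAdjoint Q.entries)
  rw [← sub_eq_zero, weightForm, weightForm, ← Matrix.map_sub _ (map_sub _), entries_firstOrderOp,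
    entries_firstOrderOp, polyAdjoint_add, polyAdjoint_mul, polyAdjoint_mul, polyAdjoint_smul,
    polyAdjoint_skewMat, polyAdjoint_cartanMat, polyAdjoint_derivMat]
  have hc : mapRingHom (starRingEnd ℂ) (-C (((N : ℂ) + 2) / 2)) = -C (((N : ℂ) + 2) / 2) := by
    simp [map_ofNat]
  rw [hc, hM, semicircle_weightedDeriv]

theorem weightForm_secondOrderOp (P Q : MatPoly N) :
    weightForm (secondOrderOp P) Q = weightForm P (secondOrderOp Q) := by
  obtain ⟨M, hM⟩ := secondOrder_symmetric_aux P.entries (polyAdjoint Q.entries)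
  have hc : mapRingHom (starRingEnd ℂ) (C (-1 / 4 : ℂ)) = C (-1 / 4) := by
    simp [map_ofNat]
  have h1 : polyAdjoint (-pearsonMat N (X : ℂ[X]) - (3 * X : ℂ[X]) • 1)
      = -(pearsonMat N (X : ℂ[X])).transpose - (3 * X : ℂ[X]) • 1 := by
    have e : (-pearsonMat N (X : ℂ[X]) - (3 * X : ℂ[X]) • 1)
        = (-1 : ℂ[X]) • pearsonMat N (X : ℂ[X]) + (-(3 * X) : ℂ[X]) • 1 := by module
    rw [e, polyAdjoint_add, polyAdjoint_smul, polyAdjoint_smul, polyAdjoint_pearsonMat,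
      polyAdjoint_one]
    simp
    module
  have h2 : mapRingHom (starRingEnd ℂ) (1 - X ^ 2) = 1 - X ^ 2 := by simp
  rw [← sub_eq_zero, weightForm, weightForm, ← Matrix.map_sub _ (map_sub _),
    entries_secondOrderOp, entries_secondOrderOp, polyAdjoint_add, polyAdjoint_add,
    polyAdjoint_mul, polyAdjoint_mul, polyAdjoint_smul, polyAdjoint_smul, polyAdjoint_mul,
    polyAdjoint_cartanMat, polyAdjoint_derivMat, polyAdjoint_derivMat, hc, h1, h2, hM,
    semicircle_weightedDeriv]

end PolynomialMatrices

/-! ### Orthogonal polynomials: existence, uniqueness, eigenvalue equations, abstract recurrence. -/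

section OrthogonalPolynomials

open Polynomial Matrix

variable {N : ℕ}

theorem weightForm_add_right (P Q Q' : MatPoly N) :
    weightForm P (Q + Q') = weightForm P Q + weightForm P Q' := by
  rw [weightForm_conj (Q + Q') P, weightForm_add_left, Matrix.conjTranspose_add,
    ← weightForm_conj, ← weightForm_conj]

theorem weightForm_C_mul_right (A : Mat N) (P Q : MatPoly N) :
    weightForm P (C A * Q) = weightForm P Q * Aᴴ := by
  rw [weightForm_conj (C A * Q) P, weightForm_C_mul, Matrix.conjTranspose_mul, ← weightForm_conj]

theorem weightForm_sub_left (P P' Q : MatPoly N) :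
    weightForm (P - P') Q = weightForm P Q - weightForm P' Q := by
  rw [eq_sub_iff_add_eq, ← weightForm_add_left, sub_add_cancel]

theorem weightForm_sub_right (P Q Q' : MatPoly N) :
    weightForm P (Q - Q') = weightForm P Q - weightForm P Q' := by
  rw [eq_sub_iff_add_eq, ← weightForm_add_right, sub_add_cancel]

theorem weightForm_eq_zero_comm {P Q : MatPoly N} (h : weightForm P Q = 0) :
    weightForm Q P = 0 := by
  rw [weightForm_conj, h, Matrix.conjTranspose_zero]

theorem eq_zero_of_weightForm_self {P : MatPoly N} (h : weightForm P P = 0) : P = 0 := by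
  by_contra hP
  obtain ⟨k, hk⟩ : ∃ k, P.coeff k ≠ 0 := by
    by_contra! hc
    exact hP (Polynomial.ext fun k => by rw [hc k, coeff_zero])
  obtain ⟨i, hi⟩ := Function.ne_iff.mp hk
  have h1 := weightForm_pos P (Pi.single i 1) k (by
    rw [Pi.star_single, star_one, Matrix.single_one_vecMul]
    exact hi)
  rw [h, Matrix.zero_mulVec, dotProduct_zero] at h1
  exact lt_irrefl _ h1

theorem weightForm_posDef {P : MatPoly N} {n : ℕ} (hP : P.coeff n = 1) :
    (weightForm P P).PosDef := by
  rw [Matrix.posDef_iff_dotProduct_mulVec]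
  refine ⟨(weightForm_conj P P).symm, fun c hc => weightForm_pos P c n ?_⟩
  rw [hP, Matrix.vecMul_one]
  exact star_ne_zero.mpr hc

/-- All coefficients of `P` of index at least `n` vanish. -/
def DegLT (n : ℕ) (P : MatPoly N) : Prop := ∀ k, n ≤ k → P.coeff k = 0

theorem DegLT.mono {n m : ℕ} {P : MatPoly N} (h : DegLT n P) (hnm : n ≤ m) : DegLT m P :=
  fun k hk => h k (hnm.trans hk)

theorem DegLT.sub {n : ℕ} {P Q : MatPoly N} (hP : DegLT n P) (hQ : DegLT n Q) :
    DegLT n (P - Q) := fun k hk => by rw [coeff_sub, hP k hk, hQ k hk, sub_zero]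

theorem DegLT.add {n : ℕ} {P Q : MatPoly N} (hP : DegLT n P) (hQ : DegLT n Q) :
    DegLT n (P + Q) := fun k hk => by rw [coeff_add, hP k hk, hQ k hk, add_zero]

theorem DegLT.C_mul {n : ℕ} {P : MatPoly N} (hP : DegLT n P) (A : Mat N) :
    DegLT n (C A * P) := fun k hk => by rw [coeff_C_mul, hP k hk, mul_zero]

theorem DegLT.X_mul {n : ℕ} {P : MatPoly N} (hP : DegLT n P) : DegLT (n + 1) (X * P) := by
  intro k hk
  obtain ⟨k, rfl⟩ : ∃ l, k = l + 1 := ⟨k - 1, by omega⟩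
  rw [coeff_X_mul, hP k (by omega)]

theorem DegLT.eq_zero {P : MatPoly N} (hP : DegLT 0 P) : P = 0 :=
  Polynomial.ext fun k => by rw [hP k (Nat.zero_le k), coeff_zero]

theorem DegLT.of_coeff {n : ℕ} {P : MatPoly N} (hP : DegLT (n + 1) P) (h : P.coeff n = 0) :
    DegLT n P := by
  intro k hk
  rcases hk.eq_or_lt with rfl | hk
  · exact h
  · exact hP k hk

/-- `P` is monic of degree `n` and orthogonal to all polynomials of smaller degree. -/
structure IsOrthMonic (n : ℕ) (P : MatPoly N) : Prop where
  coeff_self : P.coeff n = 1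
  degLT : DegLT (n + 1) P
  orth : ∀ R, DegLT n R → weightForm P R = 0

/-- Gram-Schmidt with matrix coefficients: polynomials of degree at most n are those of degree below
n plus left multiples of a monic orthogonal p, and ⟨p, p⟩ is invertible. -/
theorem exists_projection (n : ℕ) (F : MatPoly N) :
    ∃ Q, DegLT n Q ∧ ∀ R, DegLT n R → weightForm (F - Q) R = 0 := by
  induction n generalizing F with
  | zero =>
    refine ⟨0, fun k _ => coeff_zero k, fun R hR => ?_⟩
    rw [hR.eq_zero]
    have h := weightForm_sub_right (F - 0) (0 : MatPoly N) 0
    rwa [sub_self, sub_self] at h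
  | succ n ih =>
    obtain ⟨Q₁, hQ₁, hQ₁'⟩ := ih (X ^ n)
    obtain ⟨Q₀, hQ₀, hQ₀'⟩ := ih F
    set p := X ^ n - Q₁ with hp
    have hpn : p.coeff n = 1 := by
      rw [hp, coeff_sub, hQ₁ n le_rfl, coeff_X_pow_self, sub_zero]
    have hpd : DegLT (n + 1) p := by
      intro k hk
      rw [hp, coeff_sub, hQ₁ k (by omega), coeff_X_pow, if_neg (by omega), sub_zero]
    have hH := (weightForm_posDef hpn).isUnit
    refine ⟨Q₀ + C (weightForm (F - Q₀) p * (weightForm p p)⁻¹) * p,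
      (hQ₀.mono (Nat.le_succ n)).add (hpd.C_mul _), fun R hR => ?_⟩
    have hR' : DegLT n (R - C (R.coeff n) * p) := by
      refine DegLT.of_coeff (hR.sub (hpd.C_mul _)) ?_
      rw [coeff_sub, coeff_C_mul, hpn, mul_one, sub_self]
    have h1 : weightForm (F - (Q₀ + C (weightForm (F - Q₀) p * (weightForm p p)⁻¹) * p)) p = 0 := by
      rw [← sub_sub, weightForm_sub_left, weightForm_C_mul, mul_assoc, Matrix.nonsing_inv_mul _
        ((Matrix.isUnit_iff_isUnit_det _).mp hH), mul_one, sub_self]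
    have h2 : weightForm (F - (Q₀ + C (weightForm (F - Q₀) p * (weightForm p p)⁻¹) * p))
        (R - C (R.coeff n) * p) = 0 := by
      rw [← sub_sub, weightForm_sub_left, weightForm_C_mul, hQ₀' _ hR', hQ₁' _ hR', mul_zero,
        sub_zero]
    rw [weightForm_sub_right, weightForm_C_mul_right, h1, zero_mul, sub_zero] at h2
    exact h2

theorem exists_isOrthMonic (n : ℕ) : ∃ P : MatPoly N, IsOrthMonic n P := by
  obtain ⟨Q, hQ, hQ'⟩ := exists_projection (N := N) n (X ^ n)
  refine ⟨X ^ n - Q, ?_, ?_, hQ'⟩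
  · rw [coeff_sub, hQ n le_rfl, coeff_X_pow_self, sub_zero]
  · intro k hk
    rw [coeff_sub, hQ k (by omega), coeff_X_pow, if_neg (by omega), sub_zero]

theorem IsOrthMonic.eq {n : ℕ} {P Q : MatPoly N} (hP : IsOrthMonic n P) (hQ : IsOrthMonic n Q) :
    P = Q := by
  have hD : DegLT n (P - Q) := by
    refine DegLT.of_coeff (hP.degLT.sub hQ.degLT) ?_
    rw [coeff_sub, hP.coeff_self, hQ.coeff_self, sub_self]
  rw [← sub_eq_zero]
  refine eq_zero_of_weightForm_self ?_
  rw [weightForm_sub_left, hP.orth _ hD, hQ.orth _ hD, sub_self]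

theorem isMonicOrthogonal_iff (P : ℕ → MatPoly N) :
    IsMonicOrthogonal (weightW N) (-1) 1 P ↔ ∀ n, IsOrthMonic n (P n) := by
  constructor
  · intro h n
    have hdeg : ∀ m, DegLT (m + 1) (P m) := fun m k hk =>
      coeff_eq_zero_of_natDegree_lt (by rw [h.natDegree_eq]; omega)
    refine ⟨h.coeff_self n, hdeg n, ?_⟩
    have key : ∀ m ≤ n, ∀ R, DegLT m R → weightForm (P n) R = 0 := by
      intro m
      induction m with
      | zero =>
        intro _ R hR
        rw [hR.eq_zero]
        have h := weightForm_sub_right (P n) (0 : MatPoly N) 0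
        rwa [sub_self, sub_self] at h
      | succ m ih =>
        intro hm R hR
        have hR' : DegLT m (R - C (R.coeff m) * P m) := by
          refine DegLT.of_coeff (hR.sub ((hdeg m).C_mul _)) ?_
          rw [coeff_sub, coeff_C_mul, h.coeff_self, mul_one, sub_self]
        have h2 := ih (by omega) _ hR'
        rwa [weightForm_sub_right, weightForm_C_mul_right, ← matInner_weightW (P n) (P m),
          h.inner_eq_zero n m (by omega), zero_mul, sub_zero] at h2
    exact key n le_rfl
  · intro h
    refine ⟨fun n => ?_, fun n => (h n).coeff_self, fun n m hnm => ?_, fun n => ?_⟩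
    · refine natDegree_eq_of_le_of_coeff_ne_zero ?_ ?_
      · exact natDegree_le_iff_coeff_eq_zero.mpr fun k hk => (h n).degLT k hk
      · rw [(h n).coeff_self]
        exact one_ne_zero
    · rw [matInner_weightW]
      rcases Nat.lt_or_ge m n with hlt | hge
      · exact (h n).orth _ ((h m).degLT.mono hlt)
      · exact weightForm_eq_zero_comm ((h m).orth _ ((h n).degLT.mono (by omega)))
    · rw [matInner_weightW]
      exact weightForm_posDef (h n).coeff_self

/-- A symmetric degree preserving operator acts on orthogonal polynomials by matrix eigenvalues. -/
theorem IsOrthMonic.eigen {n : ℕ} {P : MatPoly N} (hP : IsOrthMonic n P)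
    (op : MatPoly N → MatPoly N)
    (hsymm : ∀ P Q, weightForm (op P) Q = weightForm P (op Q))
    (hdeg : ∀ m R, DegLT m R → DegLT m (op R)) : op P = C ((op P).coeff n) * P := by
  have hD : DegLT n (op P - C ((op P).coeff n) * P) := by
    refine DegLT.of_coeff ((hdeg _ _ hP.degLT).sub (hP.degLT.C_mul _)) ?_
    rw [coeff_sub, coeff_C_mul, hP.coeff_self, mul_one, sub_self]
  rw [← sub_eq_zero]
  refine eq_zero_of_weightForm_self ?_
  rw [weightForm_sub_left, hsymm, weightForm_C_mul, hP.orth _ hD, hP.orth _ (hdeg _ _ hD),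
    mul_zero, sub_zero]

theorem coeff_derivative_matPoly (P : MatPoly N) (k : ℕ) :
    (derivative P).coeff k = ((k : ℂ) + 1) • P.coeff (k + 1) := by
  rw [coeff_derivative, mul_add, mul_one, add_smul, one_smul]
  congr 1
  rw [Nat.cast_smul_eq_nsmul, nsmul_eq_mul, Nat.cast_comm]

theorem coeff_X_mul_derivative_matPoly (P : MatPoly N) (A : Mat N) (k : ℕ) :
    (X * (derivative P * C A)).coeff k = (k : ℂ) • (P.coeff k * A) := by
  rcases k with _ | k
  · simp
  · rw [coeff_X_mul, coeff_mul_C, coeff_derivative_matPoly, Matrix.smul_mul]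
    push_cast
    rfl

theorem coeff_firstOrderOp (P : MatPoly N) (k : ℕ) :
    (firstOrderOp P).coeff k
      = ((k : ℂ) + 1) • (P.coeff (k + 1) * (raiseMat N ℂ - lowerMat N ℂ))
        - ((k : ℂ) + (N + 2) / 2) • (P.coeff k * cartanMat N ℂ) := by
  rw [firstOrderOp, coeff_add, coeff_sub, coeff_mul_C, coeff_mul_C, coeff_derivative_matPoly,
    coeff_X_mul_derivative_matPoly, Matrix.smul_mul, Matrix.mul_smul]
  module

theorem coeff_secondOrderOp (P : MatPoly N) (k : ℕ) :
    (secondOrderOp P).coeff k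
      = (((k : ℂ) + 1) * (k + 2)) • P.coeff (k + 2)
        + ((k : ℂ) + 1) • (P.coeff (k + 1) * (raiseMat N ℂ + lowerMat N ℂ))
        - ((k : ℂ) * (k + N + 2)) • P.coeff k
        - (1 / 4 : ℂ) • (P.coeff k * (cartanMat N ℂ * cartanMat N ℂ)) := by
  have h2 : (X * (X * derivative (derivative P))).coeff k = ((k : ℂ) * (k - 1)) • P.coeff k := by
    rcases k with _ | _ | k
    · simp
    · simp
    · rw [coeff_X_mul, coeff_X_mul, coeff_derivative_matPoly, coeff_derivative_matPoly, smul_smul]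
      congr 1
      push_cast
      ring
  rw [secondOrderOp, coeff_add, coeff_sub, coeff_add, coeff_sub, h2, coeff_mul_C, coeff_mul_C,
    coeff_derivative_matPoly, coeff_derivative_matPoly, coeff_derivative_matPoly,
    coeff_X_mul_derivative_matPoly, Matrix.smul_mul, Matrix.mul_smul, Matrix.mul_smul, mul_one,
    smul_smul]
  push_cast
  module

theorem DegLT.firstOrderOp {n : ℕ} {P : MatPoly N} (h : DegLT n P) : DegLT n (firstOrderOp P) := by
  intro k hk
  rw [coeff_firstOrderOp, h k hk, h (k + 1) (by omega)]
  simp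

theorem DegLT.secondOrderOp {n : ℕ} {P : MatPoly N} (h : DegLT n P) :
    DegLT n (secondOrderOp P) := by
  intro k hk
  rw [coeff_secondOrderOp, h k hk, h (k + 1) (by omega), h (k + 2) (by omega)]
  simp

theorem IsOrthMonic.firstOrderOp {n : ℕ} {P : MatPoly N} (hP : IsOrthMonic n P) :
    firstOrderOp P = C (-(((n : ℂ) + (N + 2) / 2) • cartanMat N ℂ)) * P := by
  have h := hP.eigen _ weightForm_firstOrderOp fun m R hR => hR.firstOrderOp
  rwa [coeff_firstOrderOp, hP.coeff_self, hP.degLT (n + 1) le_rfl, zero_mul, smul_zero, zero_sub,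
    one_mul] at h

theorem IsOrthMonic.secondOrderOp {n : ℕ} {P : MatPoly N} (hP : IsOrthMonic n P) :
    secondOrderOp P = C (-((n : ℂ) * (n + N + 2)) • (1 : Mat N)
      - (1 / 4 : ℂ) • (cartanMat N ℂ * cartanMat N ℂ)) * P := by
  have h := hP.eigen _ weightForm_secondOrderOp fun m R hR => hR.secondOrderOp
  rwa [coeff_secondOrderOp, hP.coeff_self, hP.degLT (n + 1) le_rfl, hP.degLT (n + 2) (by omega),
    zero_mul, smul_zero, smul_zero, zero_add, zero_sub, one_mul, ← neg_smul] at h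

theorem IsOrthMonic.coeff_first {n : ℕ} {P : MatPoly N} (hP : IsOrthMonic n P) (k : ℕ)
    (i j : Fin (N + 1)) :
    (((k : ℂ) + (N + 2) / 2) * (N - 2 * (j : ℕ)) - ((n : ℂ) + (N + 2) / 2) * (N - 2 * (i : ℕ)))
        * P.coeff k i j
      = ((k : ℂ) + 1) * (P.coeff (k + 1) * (raiseMat N ℂ - lowerMat N ℂ)) i j := by
  have h := congrArg (fun p : MatPoly N => p.coeff k i j) hP.firstOrderOp
  rw [coeff_firstOrderOp, coeff_C_mul, neg_mul, Matrix.smul_mul, Matrix.neg_apply,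
    Matrix.sub_apply, Matrix.smul_apply, Matrix.smul_apply, Matrix.smul_apply,
    cartanMat_mul_apply, mul_cartanMat_apply] at h
  simp only [smul_eq_mul] at h
  linear_combination -h

theorem IsOrthMonic.coeff_second {n : ℕ} {P : MatPoly N} (hP : IsOrthMonic n P) (k : ℕ)
    (i j : Fin (N + 1)) :
    ((k : ℂ) * (k + N + 2) + (N - 2 * (j : ℕ)) ^ 2 / 4
        - ((n : ℂ) * (n + N + 2) + (N - 2 * (i : ℕ)) ^ 2 / 4)) * P.coeff k i j
      = ((k : ℂ) + 1) * (k + 2) * P.coeff (k + 2) i j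
        + ((k : ℂ) + 1) * (P.coeff (k + 1) * (raiseMat N ℂ + lowerMat N ℂ)) i j := by
  have h := congrArg (fun p : MatPoly N => p.coeff k i j) hP.secondOrderOp
  rw [coeff_secondOrderOp, coeff_C_mul, sub_mul, Matrix.smul_mul, one_mul, Matrix.smul_mul,
    Matrix.sub_apply, Matrix.sub_apply, Matrix.add_apply, Matrix.sub_apply, Matrix.smul_apply,
    Matrix.smul_apply, Matrix.smul_apply, Matrix.smul_apply, Matrix.smul_apply,
    Matrix.smul_apply, mul_assoc (cartanMat N ℂ), cartanMat_mul_apply, cartanMat_mul_apply,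
    ← mul_assoc (P.coeff k), mul_cartanMat_apply, mul_cartanMat_apply] at h
  simp only [smul_eq_mul] at h
  linear_combination -h

/-- The first order eigenvalue is a nonzero real multiple of h, so symmetry of the operator gives
the commutation; as h has distinct diagonal entries, squared norms are diagonal. -/
theorem IsOrthMonic.commute {n : ℕ} {P : MatPoly N} (hP : IsOrthMonic n P) :
    cartanMat N ℂ * weightForm P P = weightForm P P * cartanMat N ℂ := by
  have h := weightForm_firstOrderOp P P
  have hh : (cartanMat N ℂ)ᴴ = cartanMat N ℂ := by
    ext1 i j
    simp only [cartanMat, Matrix.conjTranspose_apply, Matrix.diagonal_apply]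
    by_cases hij : i = j
    · subst hij
      simp
    · rw [if_neg hij, if_neg (Ne.symm hij), star_zero]
  have hs : star (-((n : ℂ) + (N + 2) / 2)) = -((n : ℂ) + (N + 2) / 2) := by
    simp [star_div₀]
  rw [hP.firstOrderOp, weightForm_C_mul, weightForm_C_mul_right, ← neg_smul,
    Matrix.conjTranspose_smul, hh, hs, Matrix.smul_mul, Matrix.mul_smul] at h
  refine smul_right_injective (Mat N) ?_ h
  rw [neg_ne_zero]
  intro h0
  have h1 : (((n : ℝ) + (N + 2) / 2 : ℝ) : ℂ) = 0 := by
    rw [← h0]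
    push_cast
    ring
  have h2 : (0 : ℝ) < (n : ℝ) + (N + 2) / 2 := by positivity
  exact h2.ne' (Complex.ofReal_eq_zero.mp h1)

/-- The three-term recurrence relation in positive degree. -/
theorem IsOrthMonic.three_term {k : ℕ} {P₀ P₁ P₂ : MatPoly N} (h₀ : IsOrthMonic k P₀)
    (h₁ : IsOrthMonic (k + 1) P₁) (h₂ : IsOrthMonic (k + 2) P₂) :
    ∃ A : Mat N, X * P₁ = P₂ + C (P₁.coeff k - P₂.coeff (k + 1)) * P₁ + C A * P₀ ∧
      ∀ i j, i ≠ j → A i j = 0 := by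
  set B := P₁.coeff k - P₂.coeff (k + 1) with hB
  set F := X * P₁ - P₂ - C B * P₁ with hF
  have hFd : DegLT (k + 1) F := by
    refine DegLT.of_coeff (DegLT.of_coeff
      ((h₁.degLT.X_mul.sub h₂.degLT).sub ((h₁.degLT.mono (by omega)).C_mul B)) ?_) ?_
    · rw [coeff_sub, coeff_sub, coeff_X_mul, h₁.coeff_self, h₂.coeff_self, coeff_C_mul,
        h₁.degLT (k + 2) le_rfl]
      simp
    · rw [coeff_sub, coeff_sub, coeff_X_mul, coeff_C_mul, h₁.coeff_self, mul_one, hB, sub_self]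
  have hD : DegLT k (F - C (F.coeff k) * P₀) := by
    refine DegLT.of_coeff (hFd.sub (h₀.degLT.C_mul _)) ?_
    rw [coeff_sub, coeff_C_mul, h₀.coeff_self, mul_one, sub_self]
  have hF0 : F - C (F.coeff k) * P₀ = 0 := by
    -- D has degree below k, so XD has degree below k + 1: every term of ⟨D, D⟩ vanishes once X is
    -- moved to the second argument.
    set D := F - C (F.coeff k) * P₀ with hDdef
    refine eq_zero_of_weightForm_self ?_
    have e : weightForm D D = weightForm (X * P₁) D - weightForm P₂ D - weightForm (C B * P₁) D
        - weightForm (C (F.coeff k) * P₀) D := by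
      nth_rewrite 1 [hDdef]
      rw [weightForm_sub_left, hF, weightForm_sub_left, weightForm_sub_left]
    rw [e, weightForm_X_mul, weightForm_C_mul, weightForm_C_mul, h₁.orth _ hD.X_mul,
      h₂.orth _ (hD.mono (by omega)), h₁.orth _ (hD.mono (by omega)), h₀.orth _ hD]
    simp
  have hXP : X * P₁ = P₂ + C B * P₁ + C (F.coeff k) * P₀ := by
    rw [← sub_eq_zero, ← hF0, hF]
    abel
  refine ⟨F.coeff k, hXP, ?_⟩
  generalize F.coeff k = A at hXP
  -- Both sides equal ⟨XP₁, P₀⟩ = ⟨P₁, XP₀⟩, because XP₀ - P₁ has degree at most k.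
  have hAH : A * weightForm P₀ P₀ = weightForm P₁ P₁ := by
    have e1 : weightForm (X * P₁) P₀ = A * weightForm P₀ P₀ := by
      rw [hXP, weightForm_add_left, weightForm_add_left, weightForm_C_mul, weightForm_C_mul,
        h₂.orth _ (h₀.degLT.mono (by omega)), h₁.orth _ h₀.degLT]
      simp
    have hd : DegLT (k + 1) (X * P₀ - P₁) := by
      refine DegLT.of_coeff (h₀.degLT.X_mul.sub h₁.degLT) ?_
      rw [coeff_sub, coeff_X_mul, h₀.coeff_self, h₁.coeff_self, sub_self]
    have e2 := h₁.orth _ hd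
    rw [weightForm_sub_right, ← weightForm_X_mul, e1, sub_eq_zero] at e2
    exact e2
  have hcomm : cartanMat N ℂ * A = A * cartanMat N ℂ := by
    have hU := (weightForm_posDef h₀.coeff_self).isUnit
    refine hU.mul_right_cancel ?_
    rw [mul_assoc, hAH, h₁.commute, mul_assoc, h₀.commute, ← mul_assoc, hAH]
  intro i j hij
  have h := congrFun (congrFun hcomm i) j
  rw [cartanMat_mul_apply, mul_cartanMat_apply] at h
  have h' : (2 * ((j : ℕ) : ℂ) - 2 * (i : ℕ)) * A i j = 0 := by linear_combination h
  refine (mul_eq_zero.mp h').resolve_left ?_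
  intro h0
  apply hij
  have : ((j : ℕ) : ℂ) = (i : ℕ) := by linear_combination h0 / 2
  exact Fin.ext (by exact_mod_cast this.symm)

/-- The recurrence relation in degree zero. -/
theorem IsOrthMonic.two_term {P₀ P₁ : MatPoly N} (h₀ : IsOrthMonic 0 P₀)
    (h₁ : IsOrthMonic 1 P₁) : X * P₀ = P₁ + C (-P₁.coeff 0) * P₀ := by
  rw [← sub_eq_zero]
  refine DegLT.eq_zero (DegLT.of_coeff (DegLT.of_coeff
    (h₀.degLT.X_mul.sub (h₁.degLT.add ((h₀.degLT.mono (by omega)).C_mul _))) ?_) ?_)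
  · rw [coeff_sub, coeff_add, coeff_X_mul, coeff_C_mul, h₀.coeff_self, h₁.coeff_self,
      h₀.degLT 1 le_rfl]
    simp
  · rw [coeff_sub, coeff_add, coeff_X_mul_zero, coeff_C_mul, h₀.coeff_self]
    simp

end OrthogonalPolynomials

/-! ### Explicit subleading coefficients and the matrices X_n, Y_n. -/

section RecurrenceCoefficients

open Polynomial Matrix

variable {N : ℕ}

/-- The entries of the coefficient of `x ^ (n - 1)` in the monic orthogonal polynomial of
degree `n`. -/
noncomputable def subEntry (N n i j : ℕ) : ℂ :=
  if j = i + 1 then -((n : ℂ) * (N - i) / (2 * (N + n - i)))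
  else if i = j + 1 then -((n : ℂ) * i / (2 * (n + i))) else 0

/-- The coefficient of `x ^ (n - 1)` in the monic orthogonal polynomial of degree `n`. -/
noncomputable def subCoeff (N n : ℕ) : Mat N :=
  Matrix.of fun i j => subEntry N n i j

theorem subCoeff_eq (N n : ℕ) : subCoeff N n =
    -(Matrix.diagonal (fun i : Fin (N + 1) => (n : ℂ) / (2 * (N + n - (i : ℕ)))) * raiseMat N ℂ)
      - Matrix.diagonal (fun i : Fin (N + 1) => (n : ℂ) / (2 * (n + (i : ℕ)))) * lowerMat N ℂ := by
  ext1 i j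
  rw [Matrix.sub_apply, Matrix.neg_apply, Matrix.diagonal_mul, Matrix.diagonal_mul]
  simp only [subCoeff, subEntry, raiseMat, lowerMat, Matrix.of_apply]
  split_ifs
  · omega
  · ring
  · ring
  · ring

theorem subCoeff_mul_apply (N n : ℕ) (f : ℕ → ℕ → ℂ) (i j : Fin (N + 1)) :
    (subCoeff N n * Matrix.of fun a b : Fin (N + 1) => f a b) i j
      = -((n : ℂ) / (2 * (N + n - (i : ℕ))) * ((N - (i : ℕ)) * f (i + 1) j))
        - (n : ℂ) / (2 * (n + (i : ℕ))) * ((i : ℕ) * f (i - 1) j) := by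
  rw [subCoeff_eq, Matrix.sub_mul, Matrix.neg_mul, mul_assoc, mul_assoc, Matrix.sub_apply,
    Matrix.neg_apply, Matrix.diagonal_mul, Matrix.diagonal_mul, raiseMat_mul_apply,
    lowerMat_mul_apply]

/-- With a = n + (N + 2)/2, u = (N - 2j)/2, v = (N - 2i)/2, simultaneous vanishing means au = (a +
1)v and a² + u² = (a + 1)² + v². This forces v² = a², whereas |v| ≤ N/2 < a. Thus no entry of the
subleading coefficient escapes both operators. -/
theorem coeff_factor_ne_zero {N n i j : ℕ} (hi : i ≤ N)
    (h₁ : ((n : ℂ) + (N + 2) / 2) * (N - 2 * j) - ((n : ℂ) + 1 + (N + 2) / 2) * (N - 2 * i) = 0) :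
    (n : ℂ) * (n + N + 2) + (N - 2 * j) ^ 2 / 4
      - (((n : ℂ) + 1) * (n + 1 + N + 2) + (N - 2 * i) ^ 2 / 4) ≠ 0 := by
  intro h₂
  have h₁' : ((n : ℝ) + (N + 2) / 2) * (N - 2 * j)
      - ((n : ℝ) + 1 + (N + 2) / 2) * (N - 2 * i) = 0 := by
    apply Complex.ofReal_injective
    push_cast
    exact h₁
  have h₂' : (n : ℝ) * (n + N + 2) + (N - 2 * j) ^ 2 / 4
      - (((n : ℝ) + 1) * (n + 1 + N + 2) + (N - 2 * i) ^ 2 / 4) = 0 := by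
    apply Complex.ofReal_injective
    push_cast
    exact h₂
  have hi' : (i : ℝ) ≤ N := by exact_mod_cast hi
  have hi0 : (0 : ℝ) ≤ i := by positivity
  have hn0 : (0 : ℝ) ≤ n := by positivity
  have hN0 : (0 : ℝ) ≤ N := by positivity
  generalize (n : ℝ) = n at *
  generalize (N : ℝ) = N at *
  generalize (i : ℝ) = i at *
  generalize (j : ℝ) = j at *
  have hX : (0 : ℝ) < 2 * n + N + 3 := by positivity
  have key : (2 * n + N + 3) * ((2 * n + N + 2) ^ 2 - (N - 2 * i) ^ 2) = 0 := by
    linear_combination -4 * (n + (N + 2) / 2) ^ 2 * h₂' + 2 * h₁'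
      * ((n + (N + 2) / 2) * ((N - 2 * j) / 2) + (n + 1 + (N + 2) / 2) * ((N - 2 * i) / 2))
  have : (2 * n + N + 2) ^ 2 - (N - 2 * i) ^ 2 = 0 := (mul_eq_zero.mp key).resolve_left hX.ne'
  nlinarith

/-- Next to the diagonal the first order equation alone determines the entry. Everywhere else both
right-hand sides vanish, and one of the two factors is nonzero. -/
theorem IsOrthMonic.coeff_eq_subCoeff {n : ℕ} {P : MatPoly N} (hP : IsOrthMonic (n + 1) P) :
    P.coeff n = subCoeff N (n + 1) := by
  ext1 i j
  have h₁ := hP.coeff_first n i j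
  have h₂ := hP.coeff_second n i j
  rw [hP.coeff_self, one_mul] at h₁ h₂
  rw [hP.degLT (n + 2) le_rfl, Matrix.zero_apply, mul_zero, zero_add] at h₂
  rw [Matrix.sub_apply] at h₁
  rw [Matrix.add_apply] at h₂
  simp only [subCoeff, subEntry, raiseMat, lowerMat, Matrix.of_apply] at h₁ h₂ ⊢
  have hn : (n : ℂ) + 1 ≠ 0 := by exact_mod_cast n.succ_ne_zero
  obtain ⟨m, hm⟩ : ∃ m, N = i + m := ⟨N - i, by omega⟩
  by_cases hij : (j : ℕ) = i + 1
  · rw [if_pos hij, if_neg (by omega)] at h₁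
    rw [if_pos hij]
    have hmc : (N : ℂ) = (i : ℕ) + m := by exact_mod_cast hm
    have hd : (N : ℂ) + ((n + 1 : ℕ) : ℂ) - (i : ℕ) ≠ 0 := by
      have : (N : ℂ) + ((n + 1 : ℕ) : ℂ) - (i : ℕ) = ((n + 1 + m : ℕ) : ℂ) := by
        rw [hmc]
        push_cast
        ring
      rw [this, Nat.cast_ne_zero]
      omega
    rw [hij] at h₁
    rw [← neg_div, eq_div_iff (mul_ne_zero two_ne_zero hd)]
    push_cast at h₁ ⊢
    linear_combination -h₁
  · rw [if_neg hij] at h₁ h₂ ⊢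
    by_cases hji : (i : ℕ) = j + 1
    · rw [if_pos hji] at h₁ ⊢
      have hd : (n : ℂ) + 1 + (i : ℕ) ≠ 0 := by exact_mod_cast (by omega : n + 1 + (i : ℕ) ≠ 0)
      rw [← neg_div]
      push_cast
      rw [eq_div_iff (by simpa using hd)]
      have hj : ((j : ℕ) : ℂ) = (i : ℕ) - 1 := by
        rw [hji]
        push_cast
        ring
      rw [hj] at h₁
      push_cast at h₁
      linear_combination h₁
    · rw [if_neg hji] at h₁ h₂ ⊢
      rw [sub_zero, mul_zero] at h₁
      rw [add_zero, mul_zero] at h₂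
      by_contra hne
      have h₁' := (mul_eq_zero.mp h₁).resolve_right hne
      have h₂' := (mul_eq_zero.mp h₂).resolve_right hne
      push_cast at h₁' h₂'
      exact coeff_factor_ne_zero (by omega) h₁' h₂'

end RecurrenceCoefficients

section RecurrenceCoefficients

open Polynomial Matrix

variable {N : ℕ}

/-- The second order equation two degrees below the top. Multiplying by X lets n = 0 be included,
where the missing coefficient of P counts as zero. -/
theorem IsOrthMonic.coeff_X_mul_diag {n : ℕ} {P : MatPoly N} (hP : IsOrthMonic (n + 1) P)
    (i : Fin (N + 1)) :
    (4 * ((n : ℂ) + 1) + 2 * N) * (X * P).coeff n i i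
      = -((n : ℂ) * (n + 1) - n * ((n : ℂ) + 1)
          * ((N - (i : ℕ)) * ((i : ℕ) + 1) / (2 * (N + (n + 1) - (i : ℕ)))
            + (i : ℕ) * (N - (i : ℕ) + 1) / (2 * (n + 1 + (i : ℕ))))) := by
  rcases n with _ | k
  · rw [coeff_X_mul_zero]
    simp
  rw [coeff_X_mul]
  have h := hP.coeff_second k i i
  obtain ⟨f, hf⟩ : ∃ f : ℕ → ℕ → ℂ, f = fun a b : ℕ =>
    (if b = a + 1 then (N : ℂ) - a else 0) + if a = b + 1 then (a : ℂ) else 0 := ⟨_, rfl⟩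
  have hG : raiseMat N ℂ + lowerMat N ℂ = Matrix.of fun a b : Fin (N + 1) => f a b := by
    rw [hf]
    ext1 a b
    rfl
  rw [hP.coeff_self, hP.coeff_eq_subCoeff, Matrix.one_apply_eq, hG, subCoeff_mul_apply] at h
  have h1 : f ((i : ℕ) + 1) i = (i : ℕ) + 1 := by
    simp only [hf]
    rw [if_neg (by omega), zero_add, if_pos trivial]
    push_cast
    rfl
  have h0 : ((i : ℕ) : ℂ) * f ((i : ℕ) - 1) i = (i : ℕ) * (N - (i : ℕ) + 1) := by
    rcases Nat.eq_zero_or_pos (i : ℕ) with h | h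
    · simp [h]
    · simp only [hf]
      rw [if_pos (by omega), if_neg (by omega), Nat.cast_sub h]
      push_cast
      ring
  rw [h0, h1] at h
  push_cast at h ⊢
  linear_combination -h

theorem subCoeff_sub_mul_apply_diag (n : ℕ) (i : Fin (N + 1)) :
    ((subCoeff N n - subCoeff N (n + 1)) * subCoeff N n) i i
      = ((n : ℂ) / (2 * (N + n - (i : ℕ))) - (n + 1) / (2 * (N + (n + 1) - (i : ℕ))))
          * (N - (i : ℕ)) * (n * ((i : ℕ) + 1) / (2 * (n + ((i : ℕ) + 1))))
        + ((n : ℂ) / (2 * (n + (i : ℕ))) - (n + 1) / (2 * (n + 1 + (i : ℕ))))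
          * (i : ℕ) * (n * (N - (i : ℕ) + 1) / (2 * (N + n - (i : ℕ) + 1))) := by
  have h1 : subEntry N n ((i : ℕ) + 1) i = -(n * ((i : ℕ) + 1) / (2 * (n + ((i : ℕ) + 1)))) := by
    rw [subEntry, if_neg (by omega), if_pos rfl]
    push_cast
    rfl
  have h2 : ((i : ℕ) : ℂ) * subEntry N n ((i : ℕ) - 1) i
      = -((i : ℕ) * (n * (N - (i : ℕ) + 1) / (2 * (N + n - (i : ℕ) + 1)))) := by
    rcases Nat.eq_zero_or_pos (i : ℕ) with h | h
    · simp [h]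
    · rw [subEntry, if_pos (by omega), Nat.cast_sub h, Nat.cast_one,
        show (N : ℂ) - ((i : ℕ) - 1) = N - (i : ℕ) + 1 by ring,
        show (N : ℂ) + n - ((i : ℕ) - 1) = N + n - (i : ℕ) + 1 by ring]
      ring
  rw [Matrix.sub_mul, Matrix.sub_apply]
  nth_rewrite 2 [subCoeff]
  nth_rewrite 3 [subCoeff]
  rw [subCoeff_mul_apply, subCoeff_mul_apply, h1, h2]
  push_cast
  ring

theorem coeffY_apply (n : ℕ) (i j : Fin (N + 1)) :
    coeffY N n i j = if i = j then (n : ℂ) ^ 2 * ((N : ℂ) + n + 1) ^ 2 /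
      (16 * ((n : ℂ) + (i : ℕ)) * ((n : ℂ) + (i : ℕ) + 1) * ((N : ℂ) + n - (i : ℕ))
        * ((N : ℂ) + n - (i : ℕ) + 1)) else 0 := by
  rw [coeffY, Matrix.sum_apply, Finset.sum_eq_single (i : ℕ)]
  · simp only [matUnit, Matrix.smul_apply, Matrix.of_apply, smul_eq_mul, true_and, mul_ite,
      mul_one, mul_zero, Nat.cast_inj, Fin.val_inj, eq_comm]
  · intro b _ hb
    rw [matUnit, Matrix.smul_apply, Matrix.of_apply, if_neg (by omega), smul_zero]
  · intro h
    exact absurd (Finset.mem_range.mpr i.2) h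

theorem coeffX_apply (n : ℕ) (i j : Fin (N + 1)) :
    coeffX N n i j = -((((i : ℕ) : ℂ) ^ 2 / (4 * ((n : ℂ) + (i : ℕ)) * ((n : ℂ) + (i : ℕ) + 1)))
        * (if (i : ℕ) = j + 1 then 1 else 0)
      - 1 / 2 * (if i = j then 1 else 0)
      + (((N : ℂ) - (i : ℕ)) ^ 2 / (4 * ((N : ℂ) + n - (i : ℕ)) * ((N : ℂ) + n - (i : ℕ) + 1)))
        * (if (j : ℕ) = i + 1 then 1 else 0)) := by
  rw [coeffX, Matrix.neg_apply, Matrix.sum_apply, Finset.sum_eq_single (i : ℕ)]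
  · rw [Matrix.add_apply, Matrix.sub_apply, Matrix.smul_apply, Matrix.smul_apply,
      Matrix.smul_apply, matUnit, matUnit, matUnit, Matrix.of_apply, Matrix.of_apply,
      Matrix.of_apply, smul_eq_mul, smul_eq_mul, smul_eq_mul,
      if_congr (show ((i : ℕ) : ℤ) = (i : ℕ) ∧ ((j : ℕ) : ℤ) = ((i : ℕ) : ℤ) - 1 ↔ (i : ℕ) = j + 1 by omega) rfl rfl,
      if_congr (show ((i : ℕ) : ℤ) = (i : ℕ) ∧ ((j : ℕ) : ℤ) = (i : ℕ) ↔ i = j by omega) rfl rfl,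
      if_congr (show ((i : ℕ) : ℤ) = (i : ℕ) ∧ ((j : ℕ) : ℤ) = ((i : ℕ) : ℤ) + 1 ↔ (j : ℕ) = i + 1 by omega) rfl rfl]
  · intro b _ hb
    rw [Matrix.add_apply, Matrix.sub_apply, Matrix.smul_apply, Matrix.smul_apply,
      Matrix.smul_apply, matUnit, matUnit, matUnit, Matrix.of_apply, Matrix.of_apply,
      Matrix.of_apply, if_neg (by omega), if_neg (by omega), if_neg (by omega)]
    simp
  · intro h
    exact absurd (Finset.mem_range.mpr i.2) h

theorem coeffY_zero : coeffY N 0 = 0 := by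
  ext1 i j
  rw [coeffY_apply]
  simp

theorem subCoeff_zero : subCoeff N 0 = 0 := by
  ext1 i j
  simp [subCoeff, subEntry]

theorem subCoeff_sub_subCoeff (n : ℕ) :
    subCoeff N n - subCoeff N (n + 1) = 1 - (2 : ℂ) • coeffX N n := by
  ext1 i j
  obtain ⟨m, hm⟩ : ∃ m, N = i + m := ⟨N - i, by omega⟩
  have hmc : (N : ℂ) - (i : ℕ) = m := by
    rw [sub_eq_iff_eq_add, add_comm]
    exact_mod_cast hm
  have e1 : (N : ℂ) + n - (i : ℕ) = n + m := by linear_combination hmc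
  have e2 : (N : ℂ) + (n + 1 : ℕ) - (i : ℕ) = n + m + 1 := by
    push_cast
    linear_combination hmc
  have hd2 : (n : ℂ) + m + 1 ≠ 0 := by exact_mod_cast (n + m).succ_ne_zero
  have hd4 : (n : ℂ) + (i : ℕ) + 1 ≠ 0 := by exact_mod_cast (n + (i : ℕ)).succ_ne_zero
  rw [Matrix.sub_apply, Matrix.sub_apply, Matrix.smul_apply, coeffX_apply, smul_eq_mul,
    Matrix.one_apply]
  simp only [subCoeff, subEntry, Matrix.of_apply]
  rw [e1, e2, hmc]
  by_cases hij : (j : ℕ) = i + 1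
  -- The denominator n + m can vanish when n = 0, but not here: j = i + 1 ≤ N forces m ≥ 1. The case
  -- below the diagonal similarly has i ≥ 1.
  · have hd1 : (n : ℂ) + m ≠ 0 := by exact_mod_cast (by omega : n + m ≠ 0)
    rw [if_pos hij, if_pos hij, if_pos hij, if_neg (by omega), if_neg (by omega)]
    push_cast
    field_simp
    ring
  · rw [if_neg hij, if_neg hij, if_neg hij]
    by_cases hji : (i : ℕ) = j + 1
    · have hd3 : (n : ℂ) + (i : ℕ) ≠ 0 := by exact_mod_cast (by omega : n + (i : ℕ) ≠ 0)
      have e4 : ((n + 1 : ℕ) : ℂ) + (i : ℕ) = n + (i : ℕ) + 1 := by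
        push_cast
        ring
      rw [if_pos hji, if_pos hji, if_pos hji, if_neg (by omega), e4]
      push_cast
      field_simp
      ring
    · rw [if_neg hji, if_neg hji, if_neg hji]
      split_ifs <;> ring

/-- Here m = N - i, while b and b' are the diagonal entries two degrees below the top of P_n and
P_{n+1}. The left side is what the comparison of coefficients of x^{n-1} leaves for the coefficient
of P_{n-1}. -/
theorem diag_identity {n m i b b' : ℂ} (h1 : n + m ≠ 0) (h2 : n + m + 1 ≠ 0) (h3 : n + i ≠ 0)
    (h4 : n + i + 1 ≠ 0) (h5 : 4 * n + 2 * (i + m) ≠ 0) (h6 : 4 * (n + 1) + 2 * (i + m) ≠ 0)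
    (hb : (4 * n + 2 * (i + m)) * b = -((n - 1) * n - (n - 1) * n
      * (m * (i + 1) / (2 * (n + m)) + i * (m + 1) / (2 * (n + i)))))
    (hb' : (4 * (n + 1) + 2 * (i + m)) * b' = -(n * (n + 1) - n * (n + 1)
      * (m * (i + 1) / (2 * (n + m + 1)) + i * (m + 1) / (2 * (n + i + 1))))) :
    b - b' - ((n / (2 * (n + m)) - (n + 1) / (2 * (n + m + 1))) * m
          * (n * (i + 1) / (2 * (n + i + 1)))
        + (n / (2 * (n + i)) - (n + 1) / (2 * (n + i + 1))) * i
          * (n * (m + 1) / (2 * (n + m + 1))))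
      = 4 * (n ^ 2 * (n + m + i + 1) ^ 2
          / (16 * (n + i) * (n + i + 1) * (n + m) * (n + m + 1))) := by
  rw [mul_comm, ← eq_div_iff h5] at hb
  rw [mul_comm, ← eq_div_iff h6] at hb'
  rw [hb, hb']
  obtain ⟨p, hp⟩ : ∃ p, p = 2 * n + i + m := ⟨_, rfl⟩
  rw [show 4 * n + 2 * (i + m) = 2 * p by rw [hp]; ring] at h5 ⊢
  rw [show 4 * (n + 1) + 2 * (i + m) = 2 * (p + 2) by rw [hp]; ring] at h6 ⊢
  have h5' := right_ne_zero_of_mul h5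
  have h6' := right_ne_zero_of_mul h6
  field_simp
  rw [hp]
  ring

end RecurrenceCoefficients

/-! ### The recurrence for P_n. -/

section Recurrence

open Polynomial Matrix

variable {N : ℕ}

theorem IsOrthMonic.recurrence_succ {k : ℕ} {P₀ P₁ P₂ : MatPoly N} (h₀ : IsOrthMonic k P₀)
    (h₁ : IsOrthMonic (k + 1) P₁) (h₂ : IsOrthMonic (k + 2) P₂) :
    X * P₁ = P₂ + C (1 - (2 : ℂ) • coeffX N (k + 1)) * P₁
      + C ((4 : ℂ) • coeffY N (k + 1)) * P₀ := by
  obtain ⟨A, hA, hA'⟩ := h₀.three_term h₁ h₂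
  have h₁c := h₁.coeff_eq_subCoeff
  have h₂c : P₂.coeff (k + 1) = subCoeff N (k + 1 + 1) := h₂.coeff_eq_subCoeff
  suffices hAY : A = (4 : ℂ) • coeffY N (k + 1) by
    rw [hA, h₁c, h₂c, subCoeff_sub_subCoeff, hAY]
  ext1 i j
  rw [Matrix.smul_apply, smul_eq_mul, coeffY_apply]
  by_cases hij : i = j
  swap
  · rw [hA' i j hij, if_neg hij, mul_zero]
  subst hij
  rw [if_pos rfl]
  -- The coefficient of x^k in the abstract recurrence isolates A, since P₀ is monic of degree k.
  have hc : (X * P₁).coeff k = P₂.coeff k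
      + (subCoeff N (k + 1) - subCoeff N (k + 1 + 1)) * subCoeff N (k + 1) + A := by
    rw [hA, coeff_add, coeff_add, coeff_C_mul, coeff_C_mul, h₀.coeff_self, mul_one, h₁c, h₂c]
  have hb := h₁.coeff_X_mul_diag i
  have hb' := IsOrthMonic.coeff_X_mul_diag (n := k + 1) h₂ i
  rw [coeff_X_mul] at hb'
  rw [hc, Matrix.add_apply, Matrix.add_apply, subCoeff_sub_mul_apply_diag] at hb
  generalize P₂.coeff k i i = b' at hb hb'
  generalize A i i = a at hb
  obtain ⟨m, hm⟩ : ∃ m, N = i + m := ⟨N - i, by omega⟩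
  have hmc : (N : ℂ) = (i : ℕ) + m := by exact_mod_cast hm
  rw [hmc] at hb hb' ⊢
  generalize (i : ℕ) = i at hb hb' ⊢
  have h1 : ((k + 1 : ℕ) : ℂ) + m ≠ 0 := by exact_mod_cast (by omega : k + 1 + m ≠ 0)
  have h2 : ((k + 1 : ℕ) : ℂ) + m + 1 ≠ 0 := by exact_mod_cast (by omega : k + 1 + m + 1 ≠ 0)
  have h3 : ((k + 1 : ℕ) : ℂ) + i ≠ 0 := by exact_mod_cast (by omega : k + 1 + i ≠ 0)
  have h4 : ((k + 1 : ℕ) : ℂ) + i + 1 ≠ 0 := by exact_mod_cast (by omega : k + 1 + i + 1 ≠ 0)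
  have h5 : 4 * ((k + 1 : ℕ) : ℂ) + 2 * (i + m) ≠ 0 := by
    exact_mod_cast (by omega : 4 * (k + 1) + 2 * (i + m) ≠ 0)
  have h6 : 4 * (((k + 1 : ℕ) : ℂ) + 1) + 2 * (i + m) ≠ 0 := by
    exact_mod_cast (by omega : 4 * (k + 1 + 1) + 2 * (i + m) ≠ 0)
  have hk : (k : ℂ) = ((k + 1 : ℕ) : ℂ) - 1 := by
    push_cast
    ring
  rw [hk] at hb
  generalize ((k + 1 : ℕ) : ℂ) = n at *
  rw [sub_add_cancel] at hb
  have e1 : (i : ℂ) + m - i = m := by ring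
  have e2 : (i : ℂ) + m + n - i = n + m := by ring
  have e3 : (i : ℂ) + m + (n + 1) - i = n + m + 1 := by ring
  have e4 : n + ((i : ℂ) + 1) = n + i + 1 := by ring
  have e5 : n + 1 + (i : ℂ) = n + i + 1 := by ring
  have e6 : (i : ℂ) + m + n + 1 = n + m + i + 1 := by ring
  rw [e1, e2, e3, e4, e5] at hb
  rw [e1, e3, e5] at hb'
  rw [e2, e6, ← diag_identity h1 h2 h3 h4 h5 h6 hb hb']
  ring

theorem IsOrthMonic.recurrence_zero {P₀ P₁ : MatPoly N} (h₀ : IsOrthMonic 0 P₀)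
    (h₁ : IsOrthMonic 1 P₁) : X * P₀ = P₁ + C (1 - (2 : ℂ) • coeffX N 0) * P₀ := by
  rw [h₀.two_term h₁, ← subCoeff_sub_subCoeff, subCoeff_zero, zero_sub,
    IsOrthMonic.coeff_eq_subCoeff (n := 0) h₁]

theorem recurrence_at {P : ℕ → MatPoly N} (hP : ∀ n, IsOrthMonic n (P n)) (n : ℕ) (x : ℂ) :
    x • (P n).at x = (P (n + 1)).at x + (1 - (2 : ℂ) • coeffX N n) * (P n).at x
      + ((4 : ℂ) • coeffY N n) * (prevPoly P n).at x := by
  rcases n with _ | k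
  · rw [← MatPoly.at_X_mul, (hP 0).recurrence_zero (hP 1), MatPoly.at_add, MatPoly.at_mul,
      MatPoly.at_C, coeffY_zero, smul_zero, zero_mul, add_zero]
  · rw [← MatPoly.at_X_mul, (hP k).recurrence_succ (hP (k + 1)) (hP (k + 2)), MatPoly.at_add,
      MatPoly.at_add, MatPoly.at_mul, MatPoly.at_C, MatPoly.at_mul, MatPoly.at_C]
    rfl

theorem existsUnique_isMonicOrthogonal (N : ℕ) :
    ∃! P : ℕ → MatPoly N, IsMonicOrthogonal (weightW N) (-1) 1 P := by
  choose P hP using exists_isOrthMonic (N := N)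
  refine ⟨P, (isMonicOrthogonal_iff P).mpr hP, fun Q hQ => ?_⟩
  funext n
  exact ((isMonicOrthogonal_iff Q).mp hQ n).eq (hP n)

end Recurrence

/-! ### Transport to [0, 1] by x = 1 - 2u. -/

section Rescaling

open Polynomial Matrix

variable {N : ℕ}

theorem MatPoly.at_smul (c : ℂ) (P : MatPoly N) (x : ℂ) : (c • P).at x = c • P.at x := by
  have : c • P = C (c • (1 : Mat N)) * P := by
    ext1 k
    rw [coeff_smul, coeff_C_mul, Matrix.smul_mul, one_mul]
  rw [this, MatPoly.at_mul, MatPoly.at_C, Matrix.smul_mul, one_mul]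

theorem MatPoly.at_pow (P : MatPoly N) (k : ℕ) (x : ℂ) : (P ^ k).at x = P.at x ^ k := by
  induction k with
  | zero => rw [pow_zero, pow_zero, ← map_one C, MatPoly.at_C]
  | succ k ih => rw [pow_succ, MatPoly.at_mul, ih, pow_succ]

theorem MatPoly.at_X (x : ℂ) : MatPoly.at (X : MatPoly N) x = x • 1 := by
  rw [← mul_one X, MatPoly.at_X_mul, ← map_one C, MatPoly.at_C]

theorem MatPoly.at_comp (P Q : MatPoly N) {x y : ℂ} (hQ : Q.at x = y • 1) :
    MatPoly.at (P.comp Q) x = P.at y := by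
  induction P using Polynomial.induction_on' with
  | add P P' h h' => rw [add_comp, MatPoly.at_add, MatPoly.at_add, h, h']
  | monomial k A =>
    rw [monomial_comp, MatPoly.at_mul, MatPoly.at_C, MatPoly.at_pow, hQ, ← C_mul_X_pow_eq_monomial,
      MatPoly.at_mul, MatPoly.at_C, MatPoly.at_pow, MatPoly.at_X]

theorem one_sub_two_mul_X : (1 - 2 * X : MatPoly N) = C (-2) * X + C 1 := by
  rw [C_neg, C_1, show (C 2 : MatPoly N) = 2 from map_ofNat C 2, sub_eq_add_neg, add_comm]
  exact congrArg (· + 1) (neg_mul (2 : MatPoly N) X).symm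

theorem neg_two_eq_smul_one : (-2 : Mat N) = (-2 : ℂ) • 1 := by
  rw [neg_smul, ofNat_smul_eq_nsmul, nsmul_eq_mul, mul_one]
  rfl

theorem MatPoly.at_one_sub_two_mul_X (x : ℂ) :
    MatPoly.at (1 - 2 * X : MatPoly N) x = (1 - 2 * x) • 1 := by
  rw [one_sub_two_mul_X, MatPoly.at_add, MatPoly.at_mul, MatPoly.at_C, MatPoly.at_C,
    MatPoly.at_X, mul_smul_comm, mul_one, neg_two_eq_smul_one]
  module

theorem rescale_at (P : ℕ → MatPoly N) (n : ℕ) (x : ℂ) :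
    (rescale P n).at x = ((-1 : ℂ) ^ n * (2 : ℂ)⁻¹ ^ n) • (P n).at (1 - 2 * x) := by
  rw [rescale, MatPoly.at_smul, MatPoly.at_comp _ _ (MatPoly.at_one_sub_two_mul_X x)]

theorem natDegree_rescale_le {P : ℕ → MatPoly N} {n : ℕ} (h : (P n).natDegree = n) :
    (rescale P n).natDegree ≤ n := by
  refine (natDegree_smul_le _ _).trans (natDegree_comp_le.trans ?_)
  rw [h, one_sub_two_mul_X]
  exact (Nat.mul_le_mul_left n natDegree_linear_le).trans (mul_one n).le

theorem coeff_rescale {P : ℕ → MatPoly N} {n : ℕ} (h : (P n).natDegree = n)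
    (h' : (P n).coeff n = 1) : (rescale P n).coeff n = 1 := by
  have h20 : (-2 : Mat N) ≠ 0 := by
    rw [neg_two_eq_smul_one]
    exact smul_ne_zero (by norm_num) one_ne_zero
  have hd : (1 - 2 * X : MatPoly N).natDegree = 1 := by
    rw [one_sub_two_mul_X, natDegree_linear h20]
  have hc := coeff_comp_degree_mul_degree (p := P n) (q := 1 - 2 * X) (by rw [hd]; exact one_ne_zero)
  rw [hd, h, mul_one, leadingCoeff, h, h', one_mul, one_sub_two_mul_X, leadingCoeff_linear h20,
    neg_two_eq_smul_one, _root_.smul_pow, one_pow, ← neg_two_eq_smul_one, ← one_sub_two_mul_X] at hc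
  rw [rescale, coeff_smul, hc, smul_smul, ← mul_pow, ← mul_pow]
  norm_num

/-- The last factor 1/2 is the Jacobian of x = 1 - 2u; for n = m the constant is positive, so
positive definiteness survives. -/
theorem matInner_rescale (P : ℕ → MatPoly N) (n m : ℕ) :
    matInner (weightZ N) 0 1 (rescale P n) (rescale P m)
      = ((((-1) ^ n * 2⁻¹ ^ n * ((-1) ^ m * 2⁻¹ ^ m) * 2⁻¹ : ℝ)) : ℂ)
        • matInner (weightW N) (-1) 1 (P n) (P m) := by
  ext1 i j
  rw [Matrix.smul_apply, smul_eq_mul]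
  simp only [matInner, Matrix.of_apply]
  have h := intervalIntegral.integral_comp_sub_mul (a := 0) (b := 1) (fun x : ℝ =>
    ((P n).at (x : ℂ) * weightW N x * ((P m).at (x : ℂ)).conjTranspose) i j)
    (two_ne_zero (α := ℝ)) 1
  rw [show (1 : ℝ) - 2 * 1 = -1 by norm_num, show (1 : ℝ) - 2 * 0 = 1 by norm_num] at h
  rw [Complex.ofReal_mul, mul_assoc, ← Complex.real_smul (x := 2⁻¹), ← h,
    ← intervalIntegral.integral_const_mul]
  refine intervalIntegral.integral_congr fun u _ => ?_
  simp only [rescale_at, weightZ, Matrix.conjTranspose_smul, Matrix.smul_mul, Matrix.mul_smul,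
    Matrix.smul_apply, smul_eq_mul]
  push_cast
  rw [star_mul', star_pow, star_pow, star_neg, star_one, star_inv₀,
    show star (2 : ℂ) = 2 from Complex.conj_ofNat 2]
  ring

theorem IsMonicOrthogonal.rescale {P : ℕ → MatPoly N}
    (h : IsMonicOrthogonal (weightW N) (-1) 1 P) :
    IsMonicOrthogonal (weightZ N) 0 1 (rescale P) where
  natDegree_eq n := by
    refine le_antisymm (natDegree_rescale_le (h.natDegree_eq n)) (le_natDegree_of_ne_zero ?_)
    rw [coeff_rescale (h.natDegree_eq n) (h.coeff_self n)]
    exact one_ne_zero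
  coeff_self n := coeff_rescale (h.natDegree_eq n) (h.coeff_self n)
  inner_eq_zero n m hnm := by
    rw [matInner_rescale, h.inner_eq_zero n m hnm, smul_zero]
  inner_posDef n := by
    rw [matInner_rescale]
    refine (h.inner_posDef n).smul ?_
    rw [Complex.zero_lt_real, ← pow_two]
    have : ((-1) ^ n * 2⁻¹ ^ n : ℝ) ≠ 0 := by
      rw [← mul_pow]
      exact pow_ne_zero _ (by norm_num)
    positivity

theorem prevPoly_rescale_at (P : ℕ → MatPoly N) (n : ℕ) (x : ℂ) :
    (prevPoly (rescale P) n).at x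
      = (-2 * ((-1 : ℂ) ^ n * (2 : ℂ)⁻¹ ^ n)) • (prevPoly P n).at (1 - 2 * x) := by
  rcases n with _ | k
  · simp only [prevPoly, MatPoly.at_zero, smul_zero]
  · simp only [prevPoly, rescale_at]
    congr 1
    rw [pow_succ, pow_succ]
    ring

theorem rescale_recurrence {P : ℕ → MatPoly N} (hP : ∀ n, IsOrthMonic n (P n)) (n : ℕ) (u : ℂ) :
    u • (rescale P n).at u = (rescale P (n + 1)).at u + coeffX N n * (rescale P n).at u
      + coeffY N n * (prevPoly (rescale P) n).at u := by
  have h := recurrence_at hP n (1 - 2 * u)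
  rw [prevPoly_rescale_at, rescale_at, rescale_at, Matrix.mul_smul, Matrix.mul_smul,
    show (-1 : ℂ) ^ (n + 1) * 2⁻¹ ^ (n + 1) = (-1 / 2) * ((-1) ^ n * 2⁻¹ ^ n) by ring]
  rw [Matrix.sub_mul, one_mul, Matrix.smul_mul, Matrix.smul_mul] at h
  generalize (-1 : ℂ) ^ n * 2⁻¹ ^ n = c
  -- At x = 1 - 2u the term P_n cancels on both sides; -c/2 is the normalization of R_{n+1}, and -2c
  -- that of R_{n-1}.
  linear_combination (norm := module) (-(c / 2)) • h

end Rescaling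

theorem theorem5p3 (N : ℕ) :
    (∃! P : ℕ → MatPoly N, IsMonicOrthogonal (weightW N) (-1) 1 P) ∧
    ∀ P : ℕ → MatPoly N, IsMonicOrthogonal (weightW N) (-1) 1 P →
      IsMonicOrthogonal (weightZ N) 0 1 (rescale P) ∧
      (∀ (n : ℕ) (u : ℂ),
        u • (rescale P n).at u =
          (rescale P (n + 1)).at u + coeffX N n * (rescale P n).at u
            + coeffY N n * (prevPoly (rescale P) n).at u) ∧
      (∀ (n : ℕ) (x : ℂ),
        x • (P n).at x =
          (P (n + 1)).at x + (1 - (2 : ℂ) • coeffX N n) * (P n).at x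
            + ((4 : ℂ) • coeffY N n) * (prevPoly P n).at x) := by
  refine ⟨existsUnique_isMonicOrthogonal N, fun P hP => ?_⟩
  have h := (isMonicOrthogonal_iff P).mp hP
  exact ⟨hP.rescale, rescale_recurrence h, recurrence_at h⟩
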